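/- **Setting.** Let $D>0$. For a function $\rho(x,y,t)$ consider the equation $$\partial_t\rho=\nabla\cdot\big(D\nabla\rho-\vec F[\rho]\,\rho\big),\qquad \rho|_{t=0}=\rho_0,\qquad (1)$$ on $\mathbb R^2$, with $F_x[\rho](x,y,t)=-\int \mathrm{sgn}(x-x')\rho(x',y,t)\,dx'$ and $F_y[\rho](x,y,t)=-\int \mathrm{sgn}(y-y')\rho(x,y',t)\,dy'$. Let $0\le\rho_0\in L^1(\mathbb R^2)$, $M_0=\iint\rho_0\,dy\,dx$, and $0<T\le\infty$. A *smooth solution* of (1) on $[0,T)$ is a function $\rho$ that is $C^2$ in $(x,y,t)$ for $0<t<T$, satisfies the equation pointwise there, takes the datum $\rho_0$ at $t=0$ with $\rho(t)\to\rho_0$ in $L^1_{\rm loc}(\mathbb R^2)$ as $t\to0^+$, and is such that for each finite $\tau<T$ the quantities $\iint|\rho(x,y,t)|\,dy\,dx$, $\sup_y\int|\rho(x,y,t)|\,dx$ and $\sup_x\int|\rho(x,y,t)|\,dy$ are bounded on $(0,\tau]$ (so that $\vec F[\rho]$ is bounded there). For $p\ge1$ let $C_p$ be the best constant in the Gagliardo–Nirenberg–Sobolev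 inequality $$\iint\xi^{p+1}\,dy\,dx\le C_p\iint\xi\,dy\,dx\ \iint|\nabla(\xi^{p/2})|^2\,dy\,dx,$$ where $\xi\ge0$ ranges over the compactly supported functions on $\mathbb R^2$ with $\xi^{p/2}\in C^1$. Write $m_2(t)=\iint(x^2+y^2)\rho(x,y,t)\,dy\,dx$. **Proposition.** Let $\rho$ be a smooth solution of (1) on $[0,T)$. Then: i) $\iint\rho(t)\,dy\,dx=\iint\rho_0\,dy\,dx=M_0$ for all $t\in[0,T)$. ii) If $1\le p<\infty$, $\rho_0\in L^p(\mathbb R^2)$ and $D>pC_pM_0$, then $t\mapsto\|\rho(t)\|_{L^p}$ is nonincreasing on $[0,T)$; in particular $\|\rho(t)\|_{L^p}\le\|\rho_0\|_{L^p}$. iii) If $\rho_0\in L^1\cap L^\infty(\mathbb R^2)$ and $D>2C_2M_0$, then there is a constant $M>0$ such that for every $t\in[0,T)$, $0\le\rho(x,y,t)\le M$ for a.e. $(x,y)\in\mathbb R^2$. The constant $M$ depends only on $D$ and on upper bounds $m\ge M_0$ and $L\ge\|\rho_0\|_{L^\infty}$ with $D>2C_2m$; in particular it does not depend on $T$. iv)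 If $(x^2+y^2)\rho_0\in L^1(\mathbb R^2)$, then for every $t\in[0,T)$, $(x^2+y^2)\rho(t)\in L^1(\mathbb R^2)$ and $m_2(t)\le m_2(0)+4DM_0t$. -/

import Mathlib

open MeasureTheory Filter Topology

noncomputable section

/-- The partial derivative `∂ₓ f` of a function on the plane. -/
def partialX (f : ℝ × ℝ → ℝ) (z : ℝ × ℝ) : ℝ := deriv (fun x => f (x, z.2)) z.1

/-- The partial derivative `∂_y f` of a function on the plane. -/
def partialY (f : ℝ × ℝ → ℝ) (z : ℝ × ℝ) : ℝ := deriv (fun y => f (z.1, y)) z.2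

/-- `F_x[f](x, y) = - ∫ sgn(x - x') f(x', y) dx'`. -/
def forceX (f : ℝ × ℝ → ℝ) (z : ℝ × ℝ) : ℝ := -∫ x' : ℝ, Real.sign (z.1 - x') * f (x', z.2)

/-- `F_y[f](x, y) = - ∫ sgn(y - y') f(x, y') dy'`. -/
def forceY (f : ℝ × ℝ → ℝ) (z : ℝ × ℝ) : ℝ := -∫ y' : ℝ, Real.sign (z.2 - y') * f (z.1, y')

/-- `C` is admissible in the Gagliardo–Nirenberg–Sobolev inequality
`∬ ξ^(p+1) ≤ C (∬ ξ) (∬ |∇(ξ^(p/2))|²)`, for nonnegative compactly supported `ξ` such that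
`ξ^(p/2)` is of class `C¹`. (All three integrals are finite for such `ξ`; the inequality extends
with the same constant to less regular `ξ` by density.) -/
def IsGNSConstant (p C : ℝ) : Prop :=
  ∀ ξ : ℝ × ℝ → ℝ, (∀ z, 0 ≤ ξ z) → HasCompactSupport ξ →
    ContDiff ℝ 1 (fun z => ξ z ^ (p / 2)) →
    ∫ z, ξ z ^ (p + 1) ≤
      C * (∫ z, ξ z) *
        ∫ z, (partialX (fun w => ξ w ^ (p / 2)) z ^ 2 + partialY (fun w => ξ w ^ (p / 2)) z ^ 2)

/-- The (optimal) constant `C_p` of the Gagliardo–Nirenberg–Sobolev inequality. -/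
def gnsConstant (p : ℝ) : ℝ := sInf {C : ℝ | 0 ≤ C ∧ IsGNSConstant p C}

/-- Second moment `∬ (x² + y²) f`. -/
def secondMoment (f : ℝ × ℝ → ℝ) : ℝ := ∫ z : ℝ × ℝ, (z.1 ^ 2 + z.2 ^ 2) * f z

/-- `ρ` is a smooth solution on `[0, T)`, where `T` may be `⊤`, of
`∂ₜρ = ∇·(D ∇ρ - F[ρ] ρ)`, `ρ(0) = ρ₀`, with a nonnegative integrable initial density `ρ₀`.
Nothing is assumed about the sign of `ρ` at positive times, nor about its boundedness,
its moments or the decay of its derivatives. -/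
structure IsSmoothSolution (D : ℝ) (T : EReal) (ρ₀ : ℝ × ℝ → ℝ) (ρ : ℝ → ℝ × ℝ → ℝ) : Prop where
  integrable_data : Integrable ρ₀
  nonneg_data : ∀ᵐ z, 0 ≤ ρ₀ z
  /-- `ρ` is of class `C²` in `(t, x, y)` at positive times. -/
  smooth : ContDiffOn ℝ 2 (fun q : ℝ × (ℝ × ℝ) => ρ q.1 q.2) {q | 0 < q.1 ∧ (q.1 : EReal) < T}
  /-- On each time interval `(0, τ]` with `τ < T`, the `L¹` norms of `ρ(t)` on the plane and on all
  lines parallel to the axes are bounded (hence `F[ρ]` is well defined and bounded there). -/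
  bounded : ∀ τ : ℝ, (τ : EReal) < T → ∃ K : ℝ, ∀ t : ℝ, 0 < t → t ≤ τ →
    (Integrable (ρ t) ∧ ∫ z, |ρ t z| ≤ K) ∧
    (∀ y : ℝ, Integrable (fun x : ℝ => ρ t (x, y)) ∧ ∫ x : ℝ, |ρ t (x, y)| ≤ K) ∧
    (∀ x : ℝ, Integrable (fun y : ℝ => ρ t (x, y)) ∧ ∫ y : ℝ, |ρ t (x, y)| ≤ K)
  /-- The equation holds pointwise at positive times. -/
  equation : ∀ t : ℝ, 0 < t → (t : EReal) < T → ∀ z : ℝ × ℝ,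
    deriv (fun s => ρ s z) t =
      partialX (fun w => D * partialX (ρ t) w - forceX (ρ t) w * ρ t w) z +
      partialY (fun w => D * partialY (ρ t) w - forceY (ρ t) w * ρ t w) z
  initial : ρ 0 = ρ₀
  /-- The initial datum is attained in `L¹_loc`. -/
  attained : ∀ R : ℝ,
    Tendsto (fun t => ∫ z in Metric.closedBall (0 : ℝ × ℝ) R, |ρ t z - ρ₀ z|) (𝓝[>] 0) (𝓝 0)

end

/-!
The argument is a chain of localized entropy estimates. For a convex density `j` with `j'' = w`,
test the equation with `j'(ρ) φ`, where `φ = ψ_R²` is a smooth cutoff. Since `∂ₓ F_x[ρ] = -2 ρ` and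
likewise in `y`, the drift contributes `4 ∬ ρ H(ρ) φ`, where `H'(r) ≈ r w(r)`, and the diffusion
`-D ∬ w(ρ) |∇ρ|² φ`; the mismatch `r w - H'` is absorbed by Young's inequality, and terms with
derivatives of `φ` are `O(1 / R)` for densities of linear growth
(`IsSmoothSolution.exists_deriv_entropy_le`).
No decay of `ρ` or of its derivatives at infinity is used.

* Mass: `j(r) = ± r`. Positivity: a density that vanishes exactly on `[0, ∞)`, whose aggregation
  term has a good sign. Mass does not escape to infinity: `exists_tail_le`.
* Second moment: the weight `x² + y²`, localized, gives by Gronwall a finite moment. A sharper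
  computation follows, in which the drift has a sign because
  `∬ x F_x[ρ] ρ = - ½ ∭ (x - x') sgn(x - x') ρ ρ' ≤ 0`.
* `L^p` norms: the entropy `r ^ p` is truncated smoothly to linear growth at the levels `1 / n` and
  `n` (`IsPowerTruncation`). A Gronwall argument shows that `ρ(t)` stays in `L^p`
  (`exists_integral_rpow_le`). Given this, truncation errors vanish as `n → ∞`. The dissipation
  controls the Dirichlet energy of `u = G(ρ) ψ_R ≈ ρ^(p / 2)` (`exists_deriv_truncation_le`), and
  the Gagliardo–Nirenberg–Sobolev inequality for `u^(2 / p)` bounds the aggregation term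
  `4 (p - 1) ∬ ρ^(p + 1)` by `4 (p - 1) C_p M₀ ∬ |∇u|²`. It is dominated by the dissipation
  `4 (p - 1) / p D ∬ |∇u|²` exactly when `D > p C_p M₀`. That the best constants are finite and
  attained as admissible constants is derived from the Gagliardo–Nirenberg inequality in Mathlib.
* Boundedness: for `p = 2` the previous point bounds `∬ ρ²` by the datum. Then `∬ ρ u²` is absorbed
  for every `p`: the inequalities with `C_1` and `C_2` (the latter giving Nash's inequality) yield
  `J' ≤ -(p - 1) (J - b)` for `J = ∬ ρ^p`, with `b = O(p³) (∬ ρ^(p / 2))²`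
  (`integral_rpow_le_max`). Iterating over `p = 2 ^ k` gives `∬ ρ^p ≤ A^p` with `A` independent of
  `k` and of time, hence `ρ ≤ 2 A` by Chebyshev's inequality.
-/

/-! ### Calculus in the plane -/

theorem partialX_eq_fderiv {f : ℝ × ℝ → ℝ} (hf : Differentiable ℝ f) (z : ℝ × ℝ) :
    partialX f z = fderiv ℝ f z (1, 0) := by
  have h1 : HasDerivAt (fun x : ℝ => ((x, z.2) : ℝ × ℝ)) (1, 0) z.1 :=
    (hasDerivAt_id z.1).prodMk (hasDerivAt_const _ _)
  exact ((hf z).hasFDerivAt.comp_hasDerivAt z.1 h1).deriv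

theorem partialY_eq_partialX_swap (f : ℝ × ℝ → ℝ) (z : ℝ × ℝ) :
    partialY f z = partialX (f ∘ Prod.swap) z.swap := rfl

theorem ContDiff.comp_prodSwap {n : WithTop ℕ∞} {f : ℝ × ℝ → ℝ} (hf : ContDiff ℝ n f) :
    ContDiff ℝ n (f ∘ Prod.swap) := hf.comp (contDiff_snd.prodMk contDiff_fst)

theorem HasCompactSupport.comp_prodSwap {f : ℝ × ℝ → ℝ} (hf : HasCompactSupport f) :
    HasCompactSupport (f ∘ Prod.swap) :=
  hf.comp_homeomorph (Homeomorph.prodComm ℝ ℝ)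

theorem integral_comp_prodSwap (f : ℝ × ℝ → ℝ) : ∫ z : ℝ × ℝ, f z.swap = ∫ z, f z :=
  integral_prod_swap f

theorem integrable_comp_prodSwap {f : ℝ × ℝ → ℝ} (hf : Integrable f) :
    Integrable (fun z : ℝ × ℝ => f z.swap) := Integrable.swap hf

theorem ContDiff.hasDerivAt_partialX {f : ℝ × ℝ → ℝ} (hf : ContDiff ℝ 1 f) (z : ℝ × ℝ) :
    HasDerivAt (fun x => f (x, z.2)) (partialX f z) z.1 := by
  have h1 : HasDerivAt (fun x : ℝ => ((x, z.2) : ℝ × ℝ)) (1, 0) z.1 :=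
    (hasDerivAt_id z.1).prodMk (hasDerivAt_const _ _)
  exact ((hf.differentiable one_ne_zero z).hasFDerivAt.comp_hasDerivAt z.1
    h1).differentiableAt.hasDerivAt

theorem ContDiff.hasDerivAt_partialY {f : ℝ × ℝ → ℝ} (hf : ContDiff ℝ 1 f) (z : ℝ × ℝ) :
    HasDerivAt (fun y => f (z.1, y)) (partialY f z) z.2 :=
  hf.comp_prodSwap.hasDerivAt_partialX z.swap

theorem ContDiff.contDiff_partialX {f : ℝ × ℝ → ℝ} {m n : WithTop ℕ∞} (hf : ContDiff ℝ n f)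
    (h : m + 1 ≤ n) : ContDiff ℝ m (partialX f) := by
  have hn : n ≠ 0 := by
    rintro rfl
    simp at h
  have : partialX f = fun z => fderiv ℝ f z (1, 0) :=
    funext (partialX_eq_fderiv (hf.differentiable hn))
  rw [this]
  exact (hf.fderiv_right h).clm_apply contDiff_const

theorem ContDiff.continuous_partialX {f : ℝ × ℝ → ℝ} (hf : ContDiff ℝ 1 f) :
    Continuous (partialX f) :=
  (hf.contDiff_partialX (m := 0) (by norm_num)).continuous

theorem ContDiff.continuous_partialY {f : ℝ × ℝ → ℝ} (hf : ContDiff ℝ 1 f) :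
    Continuous (partialY f) :=
  hf.comp_prodSwap.continuous_partialX.comp continuous_swap

theorem partialX_eq_zero_of_notMem_tsupport {f : ℝ × ℝ → ℝ} {z : ℝ × ℝ} (hz : z ∉ tsupport f) :
    partialX f z = 0 := by
  have h : f =ᶠ[𝓝 z] 0 := notMem_tsupport_iff_eventuallyEq.1 hz
  have h2 : Tendsto (fun x : ℝ => ((x, z.2) : ℝ × ℝ)) (𝓝 z.1) (𝓝 z) := by
    have : Continuous fun x : ℝ => ((x, z.2) : ℝ × ℝ) := by fun_prop
    simpa using this.tendsto z.1
  have h3 : (fun x => f (x, z.2)) =ᶠ[𝓝 z.1] fun _ => 0 := h2.eventually h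
  simp [partialX, h3.deriv_eq]

theorem HasCompactSupport.partialX {f : ℝ × ℝ → ℝ} (hf : HasCompactSupport f) :
    HasCompactSupport (partialX f) :=
  HasCompactSupport.intro' hf (isClosed_tsupport f)
    fun _ hz => partialX_eq_zero_of_notMem_tsupport hz

theorem HasCompactSupport.partialY {f : ℝ × ℝ → ℝ} (hf : HasCompactSupport f) :
    HasCompactSupport (partialY f) :=
  hf.comp_prodSwap.partialX.comp_homeomorph (Homeomorph.prodComm ℝ ℝ)

/-- The integral over the plane of an `x`-derivative vanishes. -/
theorem integral_eq_zero_of_hasDerivAt_fst {g g' : ℝ × ℝ → ℝ}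
    (hg : ∀ z : ℝ × ℝ, HasDerivAt (fun x => g (x, z.2)) (g' z) z.1)
    (hi : Integrable g) (hi' : Integrable g') : ∫ z, g' z = 0 := by
  have h : ∫ z, g' z = ∫ y : ℝ, ∫ x : ℝ, g' (x, y) := integral_prod_symm g' hi'
  rw [h]
  have h1 := Integrable.prod_left_ae (μ := (volume : Measure ℝ)) (ν := (volume : Measure ℝ)) hi
  have h2 := Integrable.prod_left_ae (μ := (volume : Measure ℝ)) (ν := (volume : Measure ℝ)) hi'
  rw [← integral_zero ℝ ℝ (μ := volume)]
  refine integral_congr_ae ?_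
  filter_upwards [h1, h2] with y hy1 hy2
  exact integral_eq_zero_of_hasDerivAt_of_integrable (fun x => hg (x, y)) hy2 hy1

/-! ### The drift -/

/-- `f` is integrable on the plane and on every line parallel to an axis, with `L¹` norms on
these lines at most `K`. -/
structure LineBounded (f : ℝ × ℝ → ℝ) (K : ℝ) : Prop where
  integrable : Integrable f
  fst : ∀ y : ℝ, Integrable (fun x : ℝ => f (x, y)) ∧ ∫ x : ℝ, |f (x, y)| ≤ K
  snd : ∀ x : ℝ, Integrable (fun y : ℝ => f (x, y)) ∧ ∫ y : ℝ, |f (x, y)| ≤ K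

theorem LineBounded.swap {f : ℝ × ℝ → ℝ} {K : ℝ} (h : LineBounded f K) :
    LineBounded (f ∘ Prod.swap) K :=
  ⟨integrable_comp_prodSwap h.integrable, h.snd, h.fst⟩

theorem abs_sign_le_one (r : ℝ) : |Real.sign r| ≤ 1 := by
  rcases Real.sign_apply_eq r with h | h | h <;> simp [h]

theorem LineBounded.bound_nonneg {f : ℝ × ℝ → ℝ} {K : ℝ} (h : LineBounded f K) : 0 ≤ K :=
  (integral_nonneg fun _ => abs_nonneg _).trans (h.fst 0).2

theorem LineBounded.abs_forceX_le {f : ℝ × ℝ → ℝ} {K : ℝ} (h : LineBounded f K) (z : ℝ × ℝ) :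
    |forceX f z| ≤ K := by
  rw [forceX, abs_neg]
  refine (abs_integral_le_integral_abs).trans (le_trans ?_ (h.fst z.2).2)
  refine integral_mono_of_nonneg (Eventually.of_forall fun _ => abs_nonneg _) (h.fst z.2).1.abs
    (Eventually.of_forall fun x => ?_)
  simp only [abs_mul]
  exact mul_le_of_le_one_left (abs_nonneg _) (abs_sign_le_one _)

theorem measurable_real_sign : Measurable Real.sign := by
  unfold Real.sign
  exact Measurable.ite measurableSet_Iio measurable_const
    (Measurable.ite measurableSet_Ioi measurable_const measurable_const)

theorem stronglyMeasurable_forceX {f : ℝ × ℝ → ℝ} (hf : Measurable f) :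
    StronglyMeasurable (forceX f) := by
  unfold forceX
  refine StronglyMeasurable.neg ?_
  refine StronglyMeasurable.integral_prod_right
    (f := fun (z : ℝ × ℝ) (x' : ℝ) => Real.sign (z.1 - x') * f (x', z.2)) ?_
  refine Measurable.stronglyMeasurable ?_
  refine (measurable_real_sign.comp (by fun_prop)).mul (hf.comp (by fun_prop))

/-- `∂ₓ F_x[f] = -2 f`. -/
theorem hasDerivAt_forceX {f : ℝ × ℝ → ℝ} (hf : Continuous f) {K : ℝ} (h : LineBounded f K)
    (z : ℝ × ℝ) : HasDerivAt (fun x => forceX f (x, z.2)) (-2 * f z) z.1 := by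
  set g : ℝ → ℝ := fun x => f (x, z.2) with hg
  have hgc : Continuous g := by fun_prop
  have hgi : Integrable g := (h.fst z.2).1
  have key : ∀ x, forceX f (x, z.2) = (∫ s, g s) - 2 * (∫ s in Set.Iic 0, g s)
      - 2 * ∫ s in (0 : ℝ)..x, g s := by
    intro x
    have e1 : ∫ s in (0 : ℝ)..x, g s = (∫ s in Set.Iic x, g s) - ∫ s in Set.Iic 0, g s :=
      (intervalIntegral.integral_Iic_sub_Iic hgi.integrableOn hgi.integrableOn).symm
    have e2 : (∫ s in Set.Iic x, g s) + ∫ s in Set.Ioi x, g s = ∫ s, g s :=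
      intervalIntegral.integral_Iic_add_Ioi hgi.integrableOn hgi.integrableOn
    have e3 : ∫ s, Real.sign (x - s) * g s
        = (∫ s in Set.Iic x, Real.sign (x - s) * g s)
          + ∫ s in Set.Ioi x, Real.sign (x - s) * g s := by
      have hi : Integrable fun s => Real.sign (x - s) * g s :=
        hgi.bdd_mul (c := 1) (measurable_real_sign.comp (by fun_prop)).aestronglyMeasurable
          (Eventually.of_forall fun s => abs_sign_le_one _)
      exact (intervalIntegral.integral_Iic_add_Ioi hi.integrableOn hi.integrableOn).symm
    have e4 : ∫ s in Set.Iic x, Real.sign (x - s) * g s = ∫ s in Set.Iic x, g s := by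
      rw [integral_Iic_eq_integral_Iio, integral_Iic_eq_integral_Iio]
      refine setIntegral_congr_fun measurableSet_Iio fun s hs => ?_
      have : Real.sign (x - s) = 1 := Real.sign_of_pos (sub_pos.2 hs)
      simp [this]
    have e5 : ∫ s in Set.Ioi x, Real.sign (x - s) * g s = -∫ s in Set.Ioi x, g s := by
      rw [← integral_neg]
      refine setIntegral_congr_fun measurableSet_Ioi fun s hs => ?_
      have : Real.sign (x - s) = -1 := Real.sign_of_neg (sub_neg.2 hs)
      simp [this]
    change -(∫ s, Real.sign (x - s) * g s) = _
    rw [e3, e4, e5, e1]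
    linarith
  have h1 : HasDerivAt (fun x => ∫ s in (0 : ℝ)..x, g s) (g z.1) z.1 :=
    intervalIntegral.integral_hasDerivAt_right (hgi.intervalIntegrable)
      hgc.stronglyMeasurable.stronglyMeasurableAtFilter hgc.continuousAt
  have h2 := (h1.const_mul 2).const_sub ((∫ s, g s) - 2 * (∫ s in Set.Iic 0, g s))
  rw [funext key]
  exact h2.congr_deriv (by simp [hg])

/-! ### The entropy identity at a fixed time -/

theorem integrable_mul_of_hasCompactSupport {c φ : ℝ × ℝ → ℝ} (hc : Continuous c)
    (hφ : Continuous φ) (hs : HasCompactSupport φ) : Integrable (fun z => c z * φ z) :=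
  (hc.mul hφ).integrable_of_hasCompactSupport hs.mul_left

theorem integrable_mul_forceX {c φ f : ℝ × ℝ → ℝ} {K : ℝ} (hc : Continuous c)
    (hφ : Continuous φ) (hs : HasCompactSupport φ) (hf : Continuous f) (hK : LineBounded f K) :
    Integrable (fun z => c z * φ z * forceX f z) :=
  (integrable_mul_of_hasCompactSupport hc hφ hs).mul_bdd (c := K)
    (stronglyMeasurable_forceX hf.measurable).aestronglyMeasurable
    (Eventually.of_forall hK.abs_forceX_le)

theorem partialX_flux {D K : ℝ} {f : ℝ × ℝ → ℝ} (hf : ContDiff ℝ 2 f) (hK : LineBounded f K)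
    (z : ℝ × ℝ) :
    partialX (fun w => D * partialX f w - forceX f w * f w) z =
      D * partialX (partialX f) z + 2 * f z ^ 2 - forceX f z * partialX f z := by
  have h1 := (hf.contDiff_partialX (m := 1) (by norm_num)).hasDerivAt_partialX z
  have h2 := hasDerivAt_forceX hf.continuous hK z
  have h3 := (hf.of_le (by norm_num : (1 : WithTop ℕ∞) ≤ 2)).hasDerivAt_partialX z
  refine (((h1.const_mul D).sub (h2.mul h3)).congr_deriv ?_).deriv
  simp only [Prod.mk.eta]
  ring

/-- The `x`-part of the entropy identity, written as the integral of an `x`-derivative: `j` is the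
entropy density (with derivatives `j'`, `j''`), and `H` is an arbitrary function subtracted
from the flux `∫₀^r s j''(s) ds` and integrated by parts separately, using `∂ₓ Fₓ = -2 f`. -/
theorem integral_fluxX_eq {D K : ℝ} {f φ : ℝ × ℝ → ℝ} (hf : ContDiff ℝ 2 f)
    (hK : LineBounded f K) (hφ : ContDiff ℝ 2 φ) (hs : HasCompactSupport φ)
    {j j' j'' H H' : ℝ → ℝ} (hj : ∀ r, HasDerivAt j (j' r) r) (hj' : ∀ r, HasDerivAt j' (j'' r) r)
    (hj'' : Continuous j'') (hH : ∀ r, HasDerivAt H (H' r) r) (hH' : Continuous H') :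
    Integrable (fun z => j' (f z) * φ z *
      partialX (fun w => D * partialX f w - forceX f w * f w) z) ∧
    Integrable (fun z => (2 * f z * H (f z) - D * j'' (f z) * partialX f z ^ 2) * φ z
      + D * j (f z) * partialX (partialX φ) z
      + ((f z * j'' (f z) - H' (f z)) * partialX f z * φ z * forceX f z
      + (j' (f z) * f z - H (f z)) * partialX φ z * forceX f z)) ∧
    ∫ z, j' (f z) * φ z * partialX (fun w => D * partialX f w - forceX f w * f w) z =
      ∫ z, ((2 * f z * H (f z) - D * j'' (f z) * partialX f z ^ 2) * φ z
      + D * j (f z) * partialX (partialX φ) z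
      + ((f z * j'' (f z) - H' (f z)) * partialX f z * φ z * forceX f z
      + (j' (f z) * f z - H (f z)) * partialX φ z * forceX f z)) := by
  have hf1 : ContDiff ℝ 1 f := hf.of_le (by norm_num)
  have hφ1 : ContDiff ℝ 1 φ := hφ.of_le (by norm_num)
  have hfx : ContDiff ℝ 1 (partialX f) := hf.contDiff_partialX (by norm_num)
  have hφx : ContDiff ℝ 1 (partialX φ) := hφ.contDiff_partialX (by norm_num)
  have cf : Continuous f := hf.continuous
  have cfx := hfx.continuous
  have cfxx := hfx.continuous_partialX
  have cj : Continuous j := continuous_iff_continuousAt.2 fun r => (hj r).continuousAt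
  have cj' : Continuous j' := continuous_iff_continuousAt.2 fun r => (hj' r).continuousAt
  have cH : Continuous H := continuous_iff_continuousAt.2 fun r => (hH r).continuousAt
  have iL : Integrable (fun z => j' (f z) * φ z *
      partialX (fun w => D * partialX f w - forceX f w * f w) z) := by
    have i1 : Integrable fun z => j' (f z) * (D * partialX (partialX f) z + 2 * f z ^ 2) * φ z :=
      integrable_mul_of_hasCompactSupport (by fun_prop) hφ.continuous hs
    have i2 := integrable_mul_forceX (c := fun z => - j' (f z) * partialX f z) (by fun_prop)
      hφ.continuous hs cf hK
    refine (i1.add i2).congr (Eventually.of_forall fun z => ?_)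
    simp only [partialX_flux hf hK, Pi.add_apply]
    ring
  have iR : Integrable (fun z => (2 * f z * H (f z) - D * j'' (f z) * partialX f z ^ 2) * φ z
      + D * j (f z) * partialX (partialX φ) z
      + ((f z * j'' (f z) - H' (f z)) * partialX f z * φ z * forceX f z
      + (j' (f z) * f z - H (f z)) * partialX φ z * forceX f z)) := by
    refine ((integrable_mul_of_hasCompactSupport (by fun_prop) hφ.continuous hs).add
      (integrable_mul_of_hasCompactSupport (by fun_prop) hφx.continuous_partialX
        hs.partialX.partialX)).add
      ((integrable_mul_forceX (by fun_prop) hφ.continuous hs cf hK).add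
      (integrable_mul_forceX (by fun_prop) hφx.continuous hs.partialX cf hK))
  refine ⟨iL, iR, ?_⟩
  rw [← sub_eq_zero, ← integral_sub iL iR]
  refine integral_eq_zero_of_hasDerivAt_fst
    (g := fun z => j' (f z) * φ z * (D * partialX f z - forceX f z * f z)
      - D * (j (f z) * partialX φ z) + H (f z) * (φ z * forceX f z)) (fun z => ?_) ?_ (iL.sub iR)
  · have dF := hasDerivAt_forceX cf hK z
    have df := hf1.hasDerivAt_partialX z
    have dφ := hφ1.hasDerivAt_partialX z
    have dj := (hj (f z)).comp_of_eq z.1 df rfl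
    have dj' := (hj' (f z)).comp_of_eq z.1 df rfl
    have dH := (hH (f z)).comp_of_eq z.1 df rfl
    have dfx := hfx.hasDerivAt_partialX z
    have dφx := hφx.hasDerivAt_partialX z
    refine ((((dj'.mul dφ).mul ((dfx.const_mul D).sub (dF.mul df))).sub
      ((dj.mul dφx).const_mul D)).add (dH.mul (dφ.mul dF))).congr_deriv ?_
    simp only [partialX_flux hf hK, Prod.mk.eta, Function.comp_apply, Pi.mul_apply,
      Pi.sub_apply]
    ring
  · have i1 : Integrable fun z => (D * j' (f z) * partialX f z) * φ z :=
      integrable_mul_of_hasCompactSupport (by fun_prop) hφ.continuous hs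
    have i2 : Integrable fun z => (- D * j (f z)) * partialX φ z :=
      integrable_mul_of_hasCompactSupport (by fun_prop) hφx.continuous hs.partialX
    have i3 := integrable_mul_forceX (c := fun z => H (f z) - j' (f z) * f z) (by fun_prop)
      hφ.continuous hs cf hK
    refine ((i1.add i2).add i3).congr (Eventually.of_forall fun z => ?_)
    simp only [Pi.add_apply]
    ring

/-- The `x`-part of the entropy inequality: the flux not absorbed in `H` is controlled by the
dissipation, the boundedness of the drift and Young's inequality. -/
theorem integral_fluxX_le {D K δ B b₁ b₂ : ℝ} {f φ S : ℝ × ℝ → ℝ} (hD : 0 < D) (hδ : 0 < δ)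
    (hf : ContDiff ℝ 2 f)
    (hK : LineBounded f K) (hφ : ContDiff ℝ 2 φ) (hs : HasCompactSupport φ) (hφ0 : ∀ z, 0 ≤ φ z)
    {j j' j'' H H' : ℝ → ℝ} (hj : ∀ r, HasDerivAt j (j' r) r) (hj' : ∀ r, HasDerivAt j' (j'' r) r)
    (hj'' : Continuous j'') (hH : ∀ r, HasDerivAt H (H' r) r) (hH' : Continuous H')
    (hw : ∀ r, 0 ≤ j'' r) (hS0 : ∀ z, 0 ≤ S z) (hS : Integrable fun z => S z * φ z)
    (hYoung : ∀ z, (f z * j'' (f z) - H' (f z)) ^ 2 ≤ j'' (f z) * S z)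
    (hB1 : ∀ z, |j (f z)| ≤ B * |f z|) (hB2 : ∀ z, |j' (f z) * f z - H (f z)| ≤ B * |f z|)
    (hb1 : ∀ z, |partialX φ z| ≤ b₁) (hb2 : ∀ z, |partialX (partialX φ) z| ≤ b₂) :
    ∫ z, j' (f z) * φ z * partialX (fun w => D * partialX f w - forceX f w * f w) z ≤
      2 * (∫ z, f z * H (f z) * φ z)
      - (1 - δ) * D * (∫ z, j'' (f z) * partialX f z ^ 2 * φ z)
      + K ^ 2 / (4 * δ * D) * (∫ z, S z * φ z)
      + B * (D * b₂ + K * b₁) * ∫ z, |f z| := by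
  obtain ⟨-, iR, hE⟩ := integral_fluxX_eq (D := D) hf hK hφ hs hj hj' hj'' hH hH'
  have cf : Continuous f := hf.continuous
  have cfx := (hf.contDiff_partialX (m := 1) (by norm_num)).continuous
  have cH : Continuous H := continuous_iff_continuousAt.2 fun r => (hH r).continuousAt
  have i1 : Integrable fun z => f z * H (f z) * φ z :=
    integrable_mul_of_hasCompactSupport (by fun_prop) hφ.continuous hs
  have i2 : Integrable fun z => j'' (f z) * partialX f z ^ 2 * φ z :=
    integrable_mul_of_hasCompactSupport (by fun_prop) hφ.continuous hs
  have i3 : Integrable fun z => 2 * (f z * H (f z) * φ z)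
      - (1 - δ) * D * (j'' (f z) * partialX f z ^ 2 * φ z) :=
    (i1.const_mul _).sub (i2.const_mul _)
  have i4 : Integrable fun z => 2 * (f z * H (f z) * φ z)
      - (1 - δ) * D * (j'' (f z) * partialX f z ^ 2 * φ z)
      + K ^ 2 / (4 * δ * D) * (S z * φ z) := i3.add (hS.const_mul _)
  have i5 : Integrable fun z => B * (D * b₂ + K * b₁) * |f z| := hK.integrable.abs.const_mul _
  rw [hE, ← integral_const_mul, ← integral_const_mul, ← integral_const_mul, ← integral_const_mul,
    ← integral_sub (i1.const_mul _) (i2.const_mul _), ← integral_add i3 (hS.const_mul _),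
    ← integral_add i4 i5]
  refine integral_mono iR (i4.add i5) fun z => ?_
  beta_reduce
  have hF := hK.abs_forceX_le z
  have hK0 := hK.bound_nonneg
  have y1 : D * j (f z) * partialX (partialX φ) z ≤ B * (D * b₂) * |f z| := by
    have hm := mul_le_mul (hB1 z) (hb2 z) (abs_nonneg _) ((abs_nonneg _).trans (hB1 z))
    rw [← abs_mul] at hm
    have := mul_le_mul_of_nonneg_left ((le_abs_self _).trans hm) hD.le
    linarith
  have y2 : (j' (f z) * f z - H (f z)) * partialX φ z * forceX f z ≤ B * (K * b₁) * |f z| := by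
    have hm := mul_le_mul (mul_le_mul (hB2 z) (hb1 z) (abs_nonneg _)
      ((abs_nonneg _).trans (hB2 z))) hF (abs_nonneg _)
      (mul_nonneg ((abs_nonneg _).trans (hB2 z)) ((abs_nonneg _).trans (hb1 z)))
    rw [← abs_mul, ← abs_mul] at hm
    have := (le_abs_self _).trans hm
    linarith
  have y3 : (f z * j'' (f z) - H' (f z)) * partialX f z * forceX f z ≤
      δ * D * (j'' (f z) * partialX f z ^ 2) + K ^ 2 / (4 * δ * D) * S z := by
    set a := f z * j'' (f z) - H' (f z)
    set q := partialX f z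
    set F := forceX f z
    set w := j'' (f z)
    have hw0 : 0 ≤ w := hw _
    have hY : a ^ 2 ≤ w * S z := hYoung z
    have hF2 : F ^ 2 ≤ K ^ 2 := sq_le_sq' (by linarith [(abs_le.1 hF).1]) ((abs_le.1 hF).2)
    -- `(a q F)² ≤ w q² K² S = 4 X Y`, so `a q F ≤ X + Y` for the two terms `X`, `Y` on the right
    have hX : 0 ≤ δ * D * (w * q ^ 2) := by positivity
    have hY' : 0 ≤ K ^ 2 / (4 * δ * D) * S z := mul_nonneg (by positivity) (hS0 z)
    refine abs_le_of_sq_le_sq' ?_ (add_nonneg hX hY') |>.2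
    have e : (a * q * F) ^ 2 ≤ 4 * (δ * D * (w * q ^ 2)) * (K ^ 2 / (4 * δ * D) * S z) := by
      have : 4 * (δ * D * (w * q ^ 2)) * (K ^ 2 / (4 * δ * D) * S z)
          = (w * S z) * q ^ 2 * K ^ 2 := by field_simp
      rw [this, mul_pow, mul_pow]
      have h0 : 0 ≤ w * S z := mul_nonneg hw0 (hS0 z)
      gcongr
    nlinarith [sq_nonneg (δ * D * (w * q ^ 2) - K ^ 2 / (4 * δ * D) * S z)]
  have y3' := mul_le_mul_of_nonneg_right y3 (hφ0 z)
  linarith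

/-- **Entropy inequality** at a fixed time. -/
theorem integral_entropy_production_le {D K δ B b₁ b₂ : ℝ} {f φ S : ℝ × ℝ → ℝ} (hD : 0 < D)
    (hδ : 0 < δ) (hf : ContDiff ℝ 2 f)
    (hK : LineBounded f K) (hφ : ContDiff ℝ 2 φ) (hs : HasCompactSupport φ) (hφ0 : ∀ z, 0 ≤ φ z)
    {j j' j'' H H' : ℝ → ℝ} (hj : ∀ r, HasDerivAt j (j' r) r) (hj' : ∀ r, HasDerivAt j' (j'' r) r)
    (hj'' : Continuous j'') (hH : ∀ r, HasDerivAt H (H' r) r) (hH' : Continuous H')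
    (hw : ∀ r, 0 ≤ j'' r) (hS0 : ∀ z, 0 ≤ S z) (hS : Integrable fun z => S z * φ z)
    (hYoung : ∀ z, (f z * j'' (f z) - H' (f z)) ^ 2 ≤ j'' (f z) * S z)
    (hB1 : ∀ z, |j (f z)| ≤ B * |f z|) (hB2 : ∀ z, |j' (f z) * f z - H (f z)| ≤ B * |f z|)
    (hb1 : ∀ z, |partialX φ z| ≤ b₁) (hb2 : ∀ z, |partialX (partialX φ) z| ≤ b₂)
    (hb1' : ∀ z, |partialY φ z| ≤ b₁) (hb2' : ∀ z, |partialY (partialY φ) z| ≤ b₂) :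
    ∫ z, j' (f z) * φ z * (partialX (fun w => D * partialX f w - forceX f w * f w) z +
        partialY (fun w => D * partialY f w - forceY f w * f w) z) ≤
      4 * (∫ z, f z * H (f z) * φ z)
      - (1 - δ) * D * (∫ z, j'' (f z) * (partialX f z ^ 2 + partialY f z ^ 2) * φ z)
      + K ^ 2 / (2 * δ * D) * (∫ z, S z * φ z)
      + 2 * B * (D * b₂ + K * b₁) * ∫ z, |f z| := by
  have i1 := (integral_fluxX_eq (D := D) hf hK hφ hs hj hj' hj'' hH hH').1
  have i2 := (integral_fluxX_eq (D := D) hf.comp_prodSwap hK.swap hφ.comp_prodSwap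
    hs.comp_prodSwap hj hj' hj'' hH hH').1
  have h1 := integral_fluxX_le hD hδ hf hK hφ hs hφ0 hj hj' hj'' hH hH' hw hS0 hS hYoung hB1 hB2
    hb1 hb2
  have h2 := integral_fluxX_le (S := S ∘ Prod.swap) hD hδ hf.comp_prodSwap hK.swap
    hφ.comp_prodSwap hs.comp_prodSwap (fun z => hφ0 _) hj hj' hj'' hH hH' hw (fun z => hS0 _)
    (integrable_comp_prodSwap hS) (fun z => hYoung z.swap) (fun z => hB1 z.swap)
    (fun z => hB2 z.swap) (fun z => hb1' z.swap) (fun z => hb2' z.swap)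
  have cfx := (hf.contDiff_partialX (m := 1) (by norm_num)).continuous
  have cfy : Continuous (partialY f) := (hf.of_le (by norm_num)).continuous_partialY
  have cf := hf.continuous
  have e1 : ∫ z, j'' (f z) * (partialX f z ^ 2 + partialY f z ^ 2) * φ z =
      (∫ z, j'' (f z) * partialX f z ^ 2 * φ z) + ∫ z, j'' (f z) * partialY f z ^ 2 * φ z := by
    rw [← integral_add (integrable_mul_of_hasCompactSupport (by fun_prop) hφ.continuous hs)
      (integrable_mul_of_hasCompactSupport (by fun_prop) hφ.continuous hs)]
    congr 1 with z
    ring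
  have e2 : ∫ z, j' (f z) * φ z * (partialX (fun w => D * partialX f w - forceX f w * f w) z +
        partialY (fun w => D * partialY f w - forceY f w * f w) z) =
      (∫ z, j' (f z) * φ z * partialX (fun w => D * partialX f w - forceX f w * f w) z) +
      ∫ z, j' (f z) * φ z * partialY (fun w => D * partialY f w - forceY f w * f w) z := by
    have i3 : Integrable fun z => j' (f z) * φ z *
        partialY (fun w => D * partialY f w - forceY f w * f w) z := integrable_comp_prodSwap i2
    rw [← integral_add i1 i3]
    congr 1 with z
    ring
  have s1 := integral_comp_prodSwap (fun z => j' (f z) * φ z *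
    partialY (fun w => D * partialY f w - forceY f w * f w) z)
  have s2 := integral_comp_prodSwap (fun z => f z * H (f z) * φ z)
  have s3 := integral_comp_prodSwap (fun z => j'' (f z) * partialY f z ^ 2 * φ z)
  have s4 := integral_comp_prodSwap (fun z => S z * φ z)
  have s5 := integral_comp_prodSwap (fun z => |f z|)
  have h2' : (∫ z : ℝ × ℝ, j' (f z.swap) * φ z.swap *
    partialY (fun w => D * partialY f w - forceY f w * f w) z.swap) ≤
      2 * (∫ z : ℝ × ℝ, f z.swap * H (f z.swap) * φ z.swap)
      - (1 - δ) * D * (∫ z : ℝ × ℝ, j'' (f z.swap) * partialY f z.swap ^ 2 * φ z.swap)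
      + K ^ 2 / (4 * δ * D) * (∫ z : ℝ × ℝ, S z.swap * φ z.swap)
      + B * (D * b₂ + K * b₁) * ∫ z : ℝ × ℝ, |f z.swap| := h2
  rw [s1, s2, s3, s4, s5] at h2'
  have e3 : K ^ 2 / (2 * δ * D) = K ^ 2 / (4 * δ * D) + K ^ 2 / (4 * δ * D) := by field_simp; ring
  rw [e1, e2, e3]
  linarith

/-! ### Evolution of entropies -/

namespace IsSmoothSolution

variable {D : ℝ} {T : EReal} {ρ₀ : ℝ × ℝ → ℝ} {ρ : ℝ → ℝ × ℝ → ℝ}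

theorem isOpen_domain (T : EReal) :
    IsOpen {q : ℝ × (ℝ × ℝ) | 0 < q.1 ∧ (q.1 : EReal) < T} :=
  (isOpen_lt continuous_const continuous_fst).inter
    (isOpen_lt (continuous_coe_real_ereal.comp continuous_fst) continuous_const)

theorem lt_of_le {s t : ℝ} (hst : s ≤ t) (ht : (t : EReal) < T) : (s : EReal) < T :=
  (EReal.coe_le_coe_iff.2 hst).trans_lt ht

theorem contDiff_slice (h : IsSmoothSolution D T ρ₀ ρ) {t : ℝ} (ht : 0 < t)
    (htT : (t : EReal) < T) : ContDiff ℝ 2 (ρ t) := by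
  rw [← contDiffOn_univ]
  exact h.smooth.comp (f := fun z : ℝ × ℝ => (t, z)) (by fun_prop) fun z _ => ⟨ht, htT⟩

theorem exists_lineBounded (h : IsSmoothSolution D T ρ₀ ρ) {τ : ℝ} (hτ : (τ : EReal) < T) :
    ∃ K : ℝ, 0 ≤ K ∧ ∀ t, 0 < t → t ≤ τ → LineBounded (ρ t) K ∧ ∫ z, |ρ t z| ≤ K := by
  obtain ⟨K, hK⟩ := h.bounded τ hτ
  refine ⟨max K 0, le_max_right _ _, fun t h0 h1 => ?_⟩
  obtain ⟨h2, h3, h4⟩ := hK t h0 h1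
  exact ⟨⟨h2.1, fun y => ⟨(h3 y).1, (h3 y).2.trans (le_max_left _ _)⟩,
    fun x => ⟨(h4 x).1, (h4 x).2.trans (le_max_left _ _)⟩⟩, h2.2.trans (le_max_left _ _)⟩

theorem hasDerivAt_time (h : IsSmoothSolution D T ρ₀ ρ) {t : ℝ} (ht : 0 < t)
    (htT : (t : EReal) < T) (z : ℝ × ℝ) :
    HasDerivAt (fun s => ρ s z) (fderiv ℝ (fun q : ℝ × (ℝ × ℝ) => ρ q.1 q.2) (t, z) (1, 0)) t := by
  have hd : DifferentiableAt ℝ (fun q : ℝ × (ℝ × ℝ) => ρ q.1 q.2) (t, z) :=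
    ((h.smooth.contDiffAt ((isOpen_domain T).mem_nhds ⟨ht, htT⟩))).differentiableAt two_ne_zero
  have h1 : HasDerivAt (fun s : ℝ => ((s, z) : ℝ × (ℝ × ℝ))) (1, 0) t :=
    (hasDerivAt_id t).prodMk (hasDerivAt_const _ _)
  exact hd.hasFDerivAt.comp_hasDerivAt t h1

theorem integrable_slice (h : IsSmoothSolution D T ρ₀ ρ) {t : ℝ} (ht : 0 ≤ t)
    (htT : (t : EReal) < T) : Integrable (ρ t) := by
  rcases ht.eq_or_lt with rfl | h0
  · rw [h.initial]; exact h.integrable_data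
  · obtain ⟨K, -, hK⟩ := h.exists_lineBounded htT
    exact (hK t h0 le_rfl).1.integrable

theorem hasDerivAt_integral_entropy (h : IsSmoothSolution D T ρ₀ ρ) {t : ℝ} (ht : 0 < t)
    (htT : (t : EReal) < T) {φ : ℝ × ℝ → ℝ} (hφ : Continuous φ) (hs : HasCompactSupport φ)
    {j j' : ℝ → ℝ} (hj : ∀ r, HasDerivAt j (j' r) r) (hj' : Continuous j') :
    HasDerivAt (fun s => ∫ z, j (ρ s z) * φ z)
      (∫ z, j' (ρ t z) * φ z *
        (partialX (fun w => D * partialX (ρ t) w - forceX (ρ t) w * ρ t w) z +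
        partialY (fun w => D * partialY (ρ t) w - forceY (ρ t) w * ρ t w) z)) t := by
  set R : ℝ × (ℝ × ℝ) → ℝ := fun q => ρ q.1 q.2 with hR
  set Ω := {q : ℝ × (ℝ × ℝ) | 0 < q.1 ∧ (q.1 : EReal) < T} with hΩ
  have cj : Continuous j := continuous_iff_continuousAt.2 fun r => (hj r).continuousAt
  have hopen : IsOpen {s : ℝ | 0 < s ∧ (s : EReal) < T} :=
    (isOpen_lt continuous_const continuous_id).inter
      (isOpen_lt continuous_coe_real_ereal continuous_const)
  obtain ⟨ε, hε, hball⟩ := Metric.nhds_basis_closedBall.mem_iff.1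
    (hopen.mem_nhds (show t ∈ {s : ℝ | 0 < s ∧ (s : EReal) < T} from ⟨ht, htT⟩))
  have hQ : IsCompact (Metric.closedBall t ε ×ˢ tsupport φ) := (isCompact_closedBall t ε).prod hs
  have hQΩ : Metric.closedBall t ε ×ˢ tsupport φ ⊆ Ω := fun q hq => hball hq.1
  have cR : ContinuousOn R Ω := h.smooth.continuousOn
  have cdR : ContinuousOn (fun q => fderiv ℝ R q (1, 0)) Ω :=
    ((h.smooth.continuousOn_fderiv_of_isOpen (isOpen_domain T) (by norm_num))).clm_apply
      continuousOn_const
  have cG : ContinuousOn (fun q : ℝ × (ℝ × ℝ) => j' (R q) * φ q.2 * fderiv ℝ R q (1, 0)) Ω :=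
    ((hj'.comp_continuousOn cR).mul (hφ.comp continuous_snd).continuousOn).mul cdR
  obtain ⟨C, hC⟩ := hQ.exists_bound_of_continuousOn (cG.mono hQΩ)
  have cs : ∀ s ∈ Metric.closedBall t ε, Continuous (ρ s) := fun s hs' =>
    (h.contDiff_slice (hball hs').1 (hball hs').2).continuous
  have key := (hasDerivAt_integral_of_dominated_loc_of_deriv_le (μ := (volume : Measure (ℝ × ℝ)))
    (F := fun s z => j (ρ s z) * φ z)
    (F' := fun s z => j' (R (s, z)) * φ z * fderiv ℝ R (s, z) (1, 0))
    (bound := (tsupport φ).indicator fun _ => C)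
    (Metric.closedBall_mem_nhds t hε) ?_ ?_ ?_ ?_ ?_ ?_).2
  · refine key.congr_deriv (integral_congr_ae (Eventually.of_forall fun z => ?_))
    beta_reduce
    rw [← h.equation t ht htT z, (h.hasDerivAt_time ht htT z).deriv]
  · filter_upwards [Metric.closedBall_mem_nhds t hε] with s hs'
    exact ((cj.comp (cs s hs')).mul hφ).aestronglyMeasurable
  · exact integrable_mul_of_hasCompactSupport
      (cj.comp (cs t (Metric.mem_closedBall_self hε.le))) hφ hs
  · have : Continuous fun z : ℝ × ℝ => j' (R (t, z)) * φ z * fderiv ℝ R (t, z) (1, 0) :=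
      cG.comp_continuous (f := fun z : ℝ × ℝ => (t, z)) (by fun_prop) fun z => ⟨ht, htT⟩
    exact this.aestronglyMeasurable
  · refine Eventually.of_forall fun z s hs' => ?_
    by_cases hz : z ∈ tsupport φ
    · rw [Set.indicator_of_mem hz]
      exact hC (s, z) ⟨hs', hz⟩
    · rw [Set.indicator_of_notMem hz, image_eq_zero_of_notMem_tsupport hz]
      simp
  · exact (integrable_indicator_iff (isClosed_tsupport φ).measurableSet).2
      (integrableOn_const hs.measure_lt_top.ne)
  · refine Eventually.of_forall fun z s hs' => ?_
    have h1 : HasDerivAt (fun x => j (ρ x z)) (j' (R (s, z)) * fderiv ℝ R (s, z) (1, 0)) s :=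
      (hj _).comp_of_eq s (h.hasDerivAt_time (hball hs').1 (hball hs').2 z) rfl
    exact (h1.mul_const (φ z)).congr_deriv (by ring)

theorem tendsto_integral_entropy_zero (h : IsSmoothSolution D T ρ₀ ρ) (hT : 0 < T)
    {φ : ℝ × ℝ → ℝ} (hφ : Continuous φ) (hs : HasCompactSupport φ)
    {j : ℝ → ℝ} {B : ℝ} (hj : ∀ r s, |j r - j s| ≤ B * |r - s|) :
    Tendsto (fun s => ∫ z, j (ρ s z) * φ z) (𝓝[>] 0) (𝓝 (∫ z, j (ρ 0 z) * φ z)) := by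
  have hB : 0 ≤ B := by simpa using (abs_nonneg _).trans (hj 1 0)
  have cj : Continuous j := by
    refine LipschitzWith.continuous (K := ⟨B, hB⟩) (LipschitzWith.of_dist_le_mul fun r s => ?_)
    exact hj r s
  obtain ⟨C, hC⟩ := hφ.bounded_above_of_compact_support hs
  obtain ⟨R, hR⟩ := hs.isCompact.isBounded.subset_closedBall (0 : ℝ × ℝ)
  have ev : ∀ᶠ s : ℝ in 𝓝[>] 0, 0 < s ∧ (s : EReal) < T := by
    refine eventually_mem_nhdsWithin.and (nhdsWithin_le_nhds ?_)
    exact (continuous_coe_real_ereal.tendsto 0).eventually_lt_const (by simpa using hT)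
  have ij : ∀ f : ℝ × ℝ → ℝ, Integrable f → Integrable fun z => j (f z) * φ z := by
    intro f hf
    have i1 : Integrable fun z => |f z| * (B * C) + |j 0| * |φ z| :=
      (hf.abs.mul_const _).add ((hφ.integrable_of_hasCompactSupport hs).abs.const_mul _)
    refine i1.mono' ((cj.comp_aestronglyMeasurable hf.aestronglyMeasurable).mul
      hφ.aestronglyMeasurable) (Eventually.of_forall fun z => ?_)
    have h1 : |j (f z)| ≤ B * |f z| + |j 0| := by
      have h2 := hj (f z) 0
      have h3 := abs_sub_abs_le_abs_sub (j (f z)) (j 0)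
      rw [sub_zero] at h2
      linarith
    have h4 : |φ z| ≤ C := hC z
    rw [Real.norm_eq_abs, abs_mul]
    calc |j (f z)| * |φ z| ≤ (B * |f z| + |j 0|) * |φ z| := by gcongr
      _ = (B * |f z|) * |φ z| + |j 0| * |φ z| := by ring
      _ ≤ (B * |f z|) * C + |j 0| * |φ z| := by gcongr
      _ = _ := by ring
  rw [tendsto_iff_norm_sub_tendsto_zero]
  have h0 : Integrable (ρ 0) := by rw [h.initial]; exact h.integrable_data
  refine squeeze_zero' (Eventually.of_forall fun _ => norm_nonneg _) ?_
    (g := fun s => (B * C) * ∫ z in Metric.closedBall (0 : ℝ × ℝ) R, |ρ s z - ρ₀ z|) ?_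
  · filter_upwards [ev] with s hs'
    have hsi := h.integrable_slice hs'.1.le hs'.2
    have hi : IntegrableOn (fun z => B * C * |ρ s z - ρ₀ z|) (Metric.closedBall (0 : ℝ × ℝ) R) :=
      ((hsi.sub h.integrable_data).abs.const_mul _).integrableOn
    rw [← integral_sub (ij _ hsi) (ij _ h0), ← integral_const_mul,
      ← integral_indicator Metric.isClosed_closedBall.measurableSet]
    refine (norm_integral_le_integral_norm _).trans ?_
    refine integral_mono ((ij _ hsi).sub (ij _ h0)).norm
      (hi.integrable_indicator Metric.isClosed_closedBall.measurableSet) fun z => ?_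
    rw [← sub_mul, norm_mul]
    by_cases hz : z ∈ Metric.closedBall (0 : ℝ × ℝ) R
    · rw [Set.indicator_of_mem hz, Real.norm_eq_abs, ← h.initial]
      have h1 := hj (ρ s z) (ρ 0 z)
      have h2 := hC z
      calc |j (ρ s z) - j (ρ 0 z)| * ‖φ z‖ ≤ (B * |ρ s z - ρ 0 z|) * C := by gcongr
        _ = _ := by ring
    · have : φ z = 0 := image_eq_zero_of_notMem_tsupport fun h' => hz (hR h')
      simp [Set.indicator_of_notMem hz, this]
  · simpa using (h.attained R).const_mul (B * C)

theorem continuousOn_integral_entropy (h : IsSmoothSolution D T ρ₀ ρ) {t : ℝ}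
    (htT : (t : EReal) < T) {φ : ℝ × ℝ → ℝ} (hφ : Continuous φ) (hs : HasCompactSupport φ)
    {j j' : ℝ → ℝ} (hj : ∀ r, HasDerivAt j (j' r) r) (hj' : Continuous j') {B : ℝ}
    (hB : ∀ r, |j' r| ≤ B) :
    ContinuousOn (fun s => ∫ z, j (ρ s z) * φ z) (Set.Icc 0 t) := by
  intro s hs'
  rcases hs'.1.eq_or_lt with rfl | h0
  · have hT : 0 < T := by
      have := lt_of_le hs'.2 htT
      simpa using this
    have hL : ∀ r s, |j r - j s| ≤ B * |r - s| := fun r s => by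
      simpa using Convex.norm_image_sub_le_of_norm_hasDerivWithin_le (s := Set.univ)
        (fun x _ => (hj x).hasDerivWithinAt) (fun x _ => hB x) convex_univ (Set.mem_univ s)
        (Set.mem_univ r)
    have := h.tendsto_integral_entropy_zero hT hφ hs hL
    refine ContinuousWithinAt.mono (t := Set.Ici 0) ?_ Set.Icc_subset_Ici_self
    rw [← Set.Ioi_insert, continuousWithinAt_insert_self]
    exact this
  · exact (h.hasDerivAt_integral_entropy h0 (lt_of_le hs'.2 htT) hφ hs hj
      hj').continuousAt.continuousWithinAt

end IsSmoothSolution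

/-- A linear differential inequality: `J' ≤ -l (J - b)` makes `e^(l t) (J - b)` nonincreasing. -/
theorem sub_le_exp_mul_sub_of_deriv_le {J J' : ℝ → ℝ} {l b s t : ℝ} (hst : s ≤ t)
    (hc : ContinuousOn J (Set.Icc s t)) (hd : ∀ r ∈ Set.Ioo s t, HasDerivAt J (J' r) r)
    (hle : ∀ r ∈ Set.Ioo s t, J' r ≤ -l * (J r - b)) :
    J t - b ≤ Real.exp (-l * (t - s)) * (J s - b) := by
  have hE : ∀ r, HasDerivAt (fun r => Real.exp (l * (r - s))) (Real.exp (l * (r - s)) * l) r :=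
    fun r => by simpa using (((hasDerivAt_id r).sub_const s).const_mul l).exp
  have hanti : AntitoneOn (fun r => Real.exp (l * (r - s)) * (J r - b)) (Set.Icc s t) := by
    refine antitoneOn_of_deriv_nonpos (convex_Icc s t)
      ((Continuous.continuousOn (by fun_prop)).mul (hc.sub continuousOn_const)) ?_ ?_
    · rw [interior_Icc]
      exact fun r hr => ((hE r).mul ((hd r hr).sub_const b)).differentiableAt.differentiableWithinAt
    · rw [interior_Icc]
      intro r hr
      have hdr : HasDerivAt (fun r => Real.exp (l * (r - s)) * (J r - b)) _ r :=
        (hE r).mul ((hd r hr).sub_const b)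
      rw [hdr.deriv]
      have := hle r hr
      have h2 := Real.exp_pos (l * (r - s))
      nlinarith
  have := hanti (Set.left_mem_Icc.2 hst) (Set.right_mem_Icc.2 hst) hst
  simp only [sub_self, mul_zero, Real.exp_zero, one_mul] at this
  calc J t - b = Real.exp (-l * (t - s)) * (Real.exp (l * (t - s)) * (J t - b)) := by
        rw [← mul_assoc, ← Real.exp_add]; simp
    _ ≤ _ := by gcongr

theorem sub_le_integral_of_hasDerivAt_le {J J' g : ℝ → ℝ} {s t : ℝ} (hst : s ≤ t)
    (hc : ContinuousOn J (Set.Icc s t)) (hd : ∀ r ∈ Set.Ioo s t, HasDerivAt J (J' r) r)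
    (hg : IntegrableOn g (Set.Icc s t)) (hle : ∀ r ∈ Set.Ioo s t, J' r ≤ g r) :
    J t - J s ≤ ∫ r in s..t, g r :=
  intervalIntegral.sub_le_integral_of_hasDeriv_right_of_le hst hc
    (fun r hr => (hd r hr).hasDerivWithinAt) hg hle

theorem sub_le_mul_of_hasDerivAt_le {J J' : ℝ → ℝ} {s t c : ℝ} (hst : s ≤ t)
    (hc : ContinuousOn J (Set.Icc s t)) (hd : ∀ r ∈ Set.Ioo s t, HasDerivAt J (J' r) r)
    (hle : ∀ r ∈ Set.Ioo s t, J' r ≤ c) : J t - J s ≤ c * (t - s) := by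
  refine (sub_le_integral_of_hasDerivAt_le hst hc hd
    (integrableOn_const (by simp)) hle).trans ?_
  simp [mul_comm]

/-! ### Spatial cutoffs -/

/-- A smooth bump on the line, equal to `1` on `[-1, 1]` and vanishing outside `(-2, 2)`. -/
noncomputable def lineBump : ContDiffBump (0 : ℝ) := ⟨1, 2, one_pos, one_lt_two⟩

/-- The cutoff `b(x / R) b(y / R)` at scale `R`. -/
noncomputable def planeCutoff (R : ℝ) (z : ℝ × ℝ) : ℝ :=
  lineBump (z.1 / R) * lineBump (z.2 / R)

theorem partialX_scaled_mul (a b : ℝ → ℝ) (R : ℝ) (z : ℝ × ℝ) :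
    partialX (fun z => a (z.1 / R) * b (z.2 / R)) z = R⁻¹ * (deriv a (z.1 / R) * b (z.2 / R)) := by
  have h : deriv (fun x => a (x / R)) z.1 = R⁻¹ * deriv a (z.1 / R) := by
    have := deriv_comp_mul_left R⁻¹ a z.1
    simp only [smul_eq_mul] at this
    simpa only [div_eq_inv_mul] using this
  simp only [partialX]
  rw [deriv_mul_const_field, h, mul_assoc]

theorem partialX_const_mul (c : ℝ) (f : ℝ × ℝ → ℝ) (z : ℝ × ℝ) :
    partialX (fun z => c * f z) z = c * partialX f z := by
  simp only [partialX]
  exact deriv_const_mul_field c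

theorem contDiff_planeCutoff (R : ℝ) {n : ℕ} : ContDiff ℝ n (planeCutoff R) := by
  unfold planeCutoff
  exact (lineBump.contDiff.comp (contDiff_fst.div_const R)).mul
    (lineBump.contDiff.comp (contDiff_snd.div_const R))

theorem planeCutoff_nonneg (R : ℝ) (z : ℝ × ℝ) : 0 ≤ planeCutoff R z :=
  mul_nonneg lineBump.nonneg lineBump.nonneg

theorem planeCutoff_le_one (R : ℝ) (z : ℝ × ℝ) : planeCutoff R z ≤ 1 :=
  mul_le_one₀ lineBump.le_one lineBump.nonneg lineBump.le_one

theorem planeCutoff_eq_one {R : ℝ} (hR : 0 < R) {z : ℝ × ℝ} (h : ‖z‖ ≤ R) :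
    planeCutoff R z = 1 := by
  have h1 : ∀ x : ℝ, |x| ≤ R → lineBump (x / R) = 1 := fun x hx =>
    lineBump.one_of_mem_closedBall (by
      rw [mem_closedBall_zero_iff, Real.norm_eq_abs, abs_div, abs_of_pos hR]
      exact (div_le_one hR).2 hx)
  rw [planeCutoff, h1 _ ((norm_fst_le z).trans h), h1 _ ((norm_snd_le z).trans h), one_mul]

theorem lineBump_eq_zero {x : ℝ} (h : 2 ≤ |x|) : lineBump x = 0 :=
  lineBump.zero_of_le_dist (by rw [Real.dist_eq, sub_zero]; exact h)

theorem planeCutoff_eq_zero {R : ℝ} (hR : 0 < R) {z : ℝ × ℝ} (h : 2 * R ≤ ‖z‖) :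
    planeCutoff R z = 0 := by
  have h1 : ∀ x : ℝ, 2 * R ≤ |x| → lineBump (x / R) = 0 := fun x hx => lineBump_eq_zero (by
    rw [abs_div, abs_of_pos hR]
    exact (le_div_iff₀ hR).2 hx)
  rw [Prod.norm_def, le_max_iff] at h
  rcases h with h | h
  · rw [planeCutoff, h1 _ h, zero_mul]
  · rw [planeCutoff, h1 _ h, mul_zero]

theorem hasCompactSupport_planeCutoff {R : ℝ} (hR : 0 < R) :
    HasCompactSupport (planeCutoff R) :=
  HasCompactSupport.intro (isCompact_closedBall (0 : ℝ × ℝ) (2 * R)) fun z hz =>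
    planeCutoff_eq_zero hR (by
      rw [mem_closedBall_zero_iff, not_le] at hz
      exact hz.le)

theorem planeCutoff_swap (R : ℝ) : planeCutoff R ∘ Prod.swap = planeCutoff R := by
  ext z
  simp [planeCutoff, mul_comm]

theorem hasCompactSupport_planeCutoff_sq {R : ℝ} (hR : 0 < R) :
    HasCompactSupport (fun z => planeCutoff R z ^ 2) :=
  (hasCompactSupport_planeCutoff hR).comp_left (g := fun r => r ^ 2) (by simp)

theorem contDiff_planeCutoff_sq (R : ℝ) {n : ℕ} : ContDiff ℝ n (fun z => planeCutoff R z ^ 2) :=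
  (contDiff_planeCutoff R).pow 2

/-- Derivatives of the cutoffs `ψ_R` and `ψ_R²` are `O(1 / R)`. -/
theorem exists_planeCutoff_bound : ∃ A : ℝ, 0 ≤ A ∧ ∀ R : ℝ, 1 ≤ R → ∀ z : ℝ × ℝ,
    (|partialX (planeCutoff R) z| ≤ A / R ∧ |partialY (planeCutoff R) z| ≤ A / R) ∧
    (|partialX (fun z => planeCutoff R z ^ 2) z| ≤ A / R ∧
      |partialX (partialX (fun z => planeCutoff R z ^ 2)) z| ≤ A / R) ∧
    (|partialY (fun z => planeCutoff R z ^ 2) z| ≤ A / R ∧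
      |partialY (partialY (fun z => planeCutoff R z ^ 2)) z| ≤ A / R) := by
  have hb : ContDiff ℝ 2 lineBump := lineBump.contDiff
  have hbc : HasCompactSupport lineBump := lineBump.hasCompactSupport
  set q : ℝ → ℝ := fun x => lineBump x ^ 2 with hq
  have hqd : ContDiff ℝ 2 q := hb.pow 2
  have hqc : HasCompactSupport q := hbc.comp_left (g := fun r => r ^ 2) (by simp)
  have hq1 : ContDiff ℝ 1 (deriv q) := by
    have : ContDiff ℝ (1 + 1) q := hqd
    exact (contDiff_succ_iff_deriv.1 this).2.2
  obtain ⟨A₁, h1⟩ := (hb.continuous_deriv (by norm_num)).bounded_above_of_compact_support hbc.deriv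
  obtain ⟨A₂, h2⟩ := hq1.continuous.bounded_above_of_compact_support hqc.deriv
  obtain ⟨A₃, h3⟩ := (hq1.continuous_deriv le_rfl).bounded_above_of_compact_support hqc.deriv.deriv
  have n1 := (norm_nonneg _).trans (h1 0)
  have n2 := (norm_nonneg _).trans (h2 0)
  have n3 := (norm_nonneg _).trans (h3 0)
  have key : ∀ R : ℝ, 1 ≤ R → ∀ z : ℝ × ℝ,
      |partialX (planeCutoff R) z| ≤ (A₁ + A₂ + A₃) / R ∧
      |partialX (fun z => planeCutoff R z ^ 2) z| ≤ (A₁ + A₂ + A₃) / R ∧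
      |partialX (partialX (fun z => planeCutoff R z ^ 2)) z| ≤ (A₁ + A₂ + A₃) / R := by
    intro R hR z
    have hR0 : 0 < R := one_pos.trans_le hR
    have hRi : |R⁻¹| = R⁻¹ := abs_of_pos (inv_pos.2 hR0)
    have hRi1 : R⁻¹ ≤ 1 := inv_le_one_of_one_le₀ hR
    have hb1 : |lineBump (z.2 / R)| ≤ 1 := by
      rw [abs_of_nonneg lineBump.nonneg]; exact lineBump.le_one
    have hq1 : |q (z.2 / R)| ≤ 1 := by
      rw [hq, abs_of_nonneg (sq_nonneg _)]
      exact pow_le_one₀ lineBump.nonneg lineBump.le_one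
    have e : (fun z => planeCutoff R z ^ 2) = fun z : ℝ × ℝ => q (z.1 / R) * q (z.2 / R) := by
      ext z; simp only [planeCutoff, hq]; ring
    have gen : ∀ a b c : ℝ, |a| ≤ c → |b| ≤ 1 → c ≤ A₁ + A₂ + A₃ →
        |R⁻¹ * (a * b)| ≤ (A₁ + A₂ + A₃) / R := by
      intro a b c ha hb hc
      rw [abs_mul, abs_mul, hRi, div_eq_inv_mul]
      have : |a| * |b| ≤ A₁ + A₂ + A₃ := by
        have := mul_le_mul (ha.trans hc) hb (abs_nonneg _) (by linarith)
        linarith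
      exact mul_le_mul_of_nonneg_left this (inv_pos.2 hR0).le
    refine ⟨?_, ?_, ?_⟩
    · have := partialX_scaled_mul lineBump lineBump R z
      rw [show planeCutoff R = fun z => lineBump (z.1 / R) * lineBump (z.2 / R) from rfl, this]
      exact gen _ _ _ (h1 _) hb1 (by linarith)
    · rw [e, partialX_scaled_mul]
      exact gen _ _ _ (h2 _) hq1 (by linarith)
    · rw [e, show partialX (fun z : ℝ × ℝ => q (z.1 / R) * q (z.2 / R)) = _ from
        funext (partialX_scaled_mul q q R), partialX_const_mul, partialX_scaled_mul, abs_mul, hRi]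
      exact (mul_le_of_le_one_left (abs_nonneg _) hRi1).trans
        (gen _ _ _ (h3 _) hq1 (by linarith))
  refine ⟨A₁ + A₂ + A₃, by positivity, fun R hR z => ?_⟩
  have k1 := key R hR z
  have k2 := key R hR z.swap
  have eY : ∀ z, partialY (planeCutoff R) z = partialX (planeCutoff R) z.swap := fun z => by
    rw [partialY_eq_partialX_swap, planeCutoff_swap]
  have eY2 : ∀ z, partialY (fun z => planeCutoff R z ^ 2) z =
      partialX (fun z => planeCutoff R z ^ 2) z.swap := fun z => by
    rw [partialY_eq_partialX_swap]
    congr 1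
    ext z
    exact congrArg (· ^ 2) (congrFun (planeCutoff_swap R) z)
  have eYY : partialY (partialY (fun z => planeCutoff R z ^ 2)) z =
      partialX (partialX (fun z => planeCutoff R z ^ 2)) z.swap := by
    rw [partialY_eq_partialX_swap]
    congr 1
    ext w
    exact eY2 w.swap
  rw [eY, eY2, eYY]
  exact ⟨⟨k1.1, k2.1⟩, k1.2, k2.2⟩

theorem tendsto_integral_mul_planeCutoff_sq {f : ℝ × ℝ → ℝ} (hf : Integrable f) :
    Tendsto (fun R => ∫ z, f z * planeCutoff R z ^ 2) atTop (𝓝 (∫ z, f z)) := by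
  refine tendsto_integral_filter_of_dominated_convergence (fun z => |f z|) ?_ ?_ hf.abs ?_
  · exact Eventually.of_forall fun R => hf.aestronglyMeasurable.mul
      ((contDiff_planeCutoff_sq R (n := 0)).continuous.aestronglyMeasurable)
  · refine Eventually.of_forall fun R => Eventually.of_forall fun z => ?_
    rw [Real.norm_eq_abs, abs_mul, abs_of_nonneg (sq_nonneg (planeCutoff R z))]
    exact mul_le_of_le_one_right (abs_nonneg _)
      (pow_le_one₀ (planeCutoff_nonneg R z) (planeCutoff_le_one R z))
  · refine Eventually.of_forall fun z => ?_
    refine tendsto_const_nhds.congr' ?_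
    filter_upwards [eventually_ge_atTop ‖z‖, eventually_gt_atTop 0] with R h1 h2
    rw [planeCutoff_eq_one h2 h1]
    ring

theorem integrable_mul_planeCutoff_sq {f : ℝ × ℝ → ℝ} (hf : Integrable f) (R : ℝ) :
    Integrable (fun z => f z * planeCutoff R z ^ 2) :=
  hf.mul_bdd (c := 1) (contDiff_planeCutoff_sq R (n := 0)).continuous.aestronglyMeasurable
    (Eventually.of_forall fun z => by
      rw [Real.norm_eq_abs, abs_of_nonneg (sq_nonneg _)]
      exact pow_le_one₀ (planeCutoff_nonneg R z) (planeCutoff_le_one R z))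

/-! ### Entropies of linear growth -/

/-- The derivative `∫₀^r w` of the entropy with second derivative `w`. -/
noncomputable def entropyDeriv (w : ℝ → ℝ) (r : ℝ) : ℝ := ∫ s in (0 : ℝ)..r, w s

/-- The flux `∫₀^r s w(s) ds` of the entropy with second derivative `w`. -/
noncomputable def entropyFlux (w : ℝ → ℝ) (r : ℝ) : ℝ := ∫ s in (0 : ℝ)..r, s * w s

/-- The entropy `∫₀^r (r - s) w(s) ds` with second derivative `w`, vanishing to first order at
`0`. -/
noncomputable def entropy (w : ℝ → ℝ) (r : ℝ) : ℝ := r * entropyDeriv w r - entropyFlux w r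

theorem hasDerivAt_entropyDeriv {w : ℝ → ℝ} (hw : Continuous w) (r : ℝ) :
    HasDerivAt (entropyDeriv w) (w r) r :=
  intervalIntegral.integral_hasDerivAt_right (hw.intervalIntegrable _ _)
    hw.stronglyMeasurable.stronglyMeasurableAtFilter hw.continuousAt

theorem hasDerivAt_entropyFlux {w : ℝ → ℝ} (hw : Continuous w) (r : ℝ) :
    HasDerivAt (entropyFlux w) (r * w r) r :=
  hasDerivAt_entropyDeriv (w := fun s => s * w s) (by fun_prop) r

theorem hasDerivAt_entropy {w : ℝ → ℝ} (hw : Continuous w) (r : ℝ) :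
    HasDerivAt (entropy w) (entropyDeriv w r) r := by
  refine (((hasDerivAt_id r).mul (hasDerivAt_entropyDeriv hw r)).sub
    (hasDerivAt_entropyFlux hw r)).congr_deriv ?_
  simp

theorem entropy_zero (w : ℝ → ℝ) : entropy w 0 = 0 := by
  simp [entropy, entropyFlux]

theorem abs_entropyDeriv_le {w : ℝ → ℝ} (hi : Integrable w) (r : ℝ) :
    |entropyDeriv w r| ≤ ∫ s, |w s| := by
  rw [entropyDeriv, ← Real.norm_eq_abs]
  refine (intervalIntegral.norm_integral_le_integral_norm_uIoc).trans ?_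
  exact setIntegral_le_integral hi.norm (Eventually.of_forall fun _ => norm_nonneg _)

theorem abs_entropy_le {w : ℝ → ℝ} (hw : Continuous w) (hi : Integrable w) (r : ℝ) :
    |entropy w r| ≤ (∫ s, |w s|) * |r| := by
  have := Convex.norm_image_sub_le_of_norm_hasDerivWithin_le (s := Set.univ)
    (fun x _ => (hasDerivAt_entropy hw x).hasDerivWithinAt)
    (fun x _ => abs_entropyDeriv_le hi x) convex_univ (Set.mem_univ 0) (Set.mem_univ r)
  simpa [entropy_zero] using this

theorem entropy_eq_integral {w : ℝ → ℝ} (hw : Continuous w) (r : ℝ) :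
    entropy w r = ∫ s in (0 : ℝ)..r, (r - s) * w s := by
  rw [entropy, entropyDeriv, entropyFlux, ← intervalIntegral.integral_const_mul,
    ← intervalIntegral.integral_sub (by apply Continuous.intervalIntegrable; fun_prop)
      (by apply Continuous.intervalIntegrable; fun_prop)]
  congr 1 with s
  ring

theorem entropy_nonneg {w : ℝ → ℝ} (hw : Continuous w) (h0 : ∀ r, 0 ≤ w r) (r : ℝ) :
    0 ≤ entropy w r := by
  rw [entropy_eq_integral hw]
  rcases le_total 0 r with hr | hr
  · exact intervalIntegral.integral_nonneg hr fun s hs =>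
      mul_nonneg (sub_nonneg.2 hs.2) (h0 s)
  · rw [intervalIntegral.integral_symm, ← intervalIntegral.integral_neg]
    refine intervalIntegral.integral_nonneg hr fun s hs => ?_
    nlinarith [hs.1, h0 s]

/-- A convex entropy density `j` of linear growth with derivatives `j'`, `j''`, together with a
function `H` (with derivative `H'`) to be split off from its flux `∫₀^r s j''(s) ds`. -/
structure IsLinearEntropy (j j' j'' H H' : ℝ → ℝ) (B : ℝ) : Prop where
  hasDerivAt : ∀ r, HasDerivAt j (j' r) r
  hasDerivAt_deriv : ∀ r, HasDerivAt j' (j'' r) r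
  continuous : Continuous j''
  nonneg : ∀ r, 0 ≤ j'' r
  hasDerivAt_flux : ∀ r, HasDerivAt H (H' r) r
  continuous_flux : Continuous H'
  abs_deriv_le : ∀ r, |j' r| ≤ B
  abs_le : ∀ r, |j r| ≤ B * |r|
  abs_flux_le : ∀ r, |j' r * r - H r| ≤ B * |r|

namespace IsSmoothSolution

variable {D : ℝ} {T : EReal} {ρ₀ : ℝ × ℝ → ℝ} {ρ : ℝ → ℝ × ℝ → ℝ}

/-- The localized entropy inequality along a solution, on a time interval `(0, τ]`. -/
theorem exists_deriv_entropy_le (hD : 0 < D) (h : IsSmoothSolution D T ρ₀ ρ) {τ : ℝ}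
    (hτ : (τ : EReal) < T) : ∃ K C : ℝ, 0 ≤ K ∧ 0 ≤ C ∧
      (∀ t, 0 < t → t ≤ τ → LineBounded (ρ t) K ∧ ∫ z, |ρ t z| ≤ K) ∧
      ∀ (j j' j'' H H' : ℝ → ℝ) (B : ℝ), IsLinearEntropy j j' j'' H H' B →
      ∀ R : ℝ, 1 ≤ R →
        ContinuousOn (fun s => ∫ z, j (ρ s z) * planeCutoff R z ^ 2) (Set.Icc 0 τ) ∧
        ∀ t, 0 < t → t ≤ τ →
        DifferentiableAt ℝ (fun s => ∫ z, j (ρ s z) * planeCutoff R z ^ 2) t ∧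
        ∀ (δ : ℝ) (S : ℝ × ℝ → ℝ), 0 < δ → (∀ z, 0 ≤ S z) →
          Integrable (fun z => S z * planeCutoff R z ^ 2) →
          (∀ z, (ρ t z * j'' (ρ t z) - H' (ρ t z)) ^ 2 ≤ j'' (ρ t z) * S z) →
          deriv (fun s => ∫ z, j (ρ s z) * planeCutoff R z ^ 2) t ≤
            4 * (∫ z, ρ t z * H (ρ t z) * planeCutoff R z ^ 2)
            - (1 - δ) * D * (∫ z, j'' (ρ t z) * (partialX (ρ t) z ^ 2 + partialY (ρ t) z ^ 2)
                * planeCutoff R z ^ 2)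
            + K ^ 2 / (2 * δ * D) * (∫ z, S z * planeCutoff R z ^ 2)
            + B * C / R := by
  obtain ⟨K, hK0, hK⟩ := h.exists_lineBounded hτ
  obtain ⟨A, hA0, hA⟩ := exists_planeCutoff_bound
  refine ⟨K, 2 * (D + K) * A * K, hK0, by positivity, hK, fun j j' j'' H H' B hj R hR => ?_⟩
  have hR0 : 0 < R := one_pos.trans_le hR
  have hs := hasCompactSupport_planeCutoff_sq hR0
  have hφ : ContDiff ℝ 2 (fun z => planeCutoff R z ^ 2) := contDiff_planeCutoff_sq R
  have cj' : Continuous j' := continuous_iff_continuousAt.2 fun r =>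
    (hj.hasDerivAt_deriv r).continuousAt
  refine ⟨h.continuousOn_integral_entropy hτ hφ.continuous hs hj.hasDerivAt cj'
    hj.abs_deriv_le, fun t ht htτ => ?_⟩
  have htT := lt_of_le htτ hτ
  have hd := h.hasDerivAt_integral_entropy ht htT hφ.continuous hs hj.hasDerivAt cj'
  refine ⟨hd.differentiableAt, fun δ S hδ hS0 hS hY => ?_⟩
  rw [hd.deriv]
  obtain ⟨hL, hI⟩ := hK t ht htτ
  refine (integral_entropy_production_le (b₁ := A / R) (b₂ := A / R) (B := B) hD hδ
    (h.contDiff_slice ht htT) hL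
    hφ hs (fun z => sq_nonneg _) hj.hasDerivAt hj.hasDerivAt_deriv hj.continuous
    hj.hasDerivAt_flux hj.continuous_flux hj.nonneg hS0 hS hY (fun z => hj.abs_le _)
    (fun z => hj.abs_flux_le _) (fun z => (hA R hR z).2.1.1) (fun z => (hA R hR z).2.1.2)
    (fun z => (hA R hR z).2.2.1) (fun z => (hA R hR z).2.2.2)).trans ?_
  have hB : 0 ≤ B := (abs_nonneg _).trans (hj.abs_deriv_le 0)
  have : 2 * B * (D * (A / R) + K * (A / R)) * ∫ z, |ρ t z| ≤
      2 * B * (D * (A / R) + K * (A / R)) * K := by gcongr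
  have e : 2 * B * (D * (A / R) + K * (A / R)) * K = B * (2 * (D + K) * A * K) / R := by ring
  linarith

/-! ### Conservation of mass and positivity -/

theorem exists_abs_integral_cutoff_sub_le (hD : 0 < D) (h : IsSmoothSolution D T ρ₀ ρ) {τ : ℝ}
    (hτ : (τ : EReal) < T) : ∃ C : ℝ, 0 ≤ C ∧ ∀ R : ℝ, 1 ≤ R → ∀ t, 0 ≤ t → t ≤ τ →
      |(∫ z, ρ t z * planeCutoff R z ^ 2) - ∫ z, ρ₀ z * planeCutoff R z ^ 2| ≤ C / R := by
  rcases lt_or_ge τ 0 with hneg | hτ0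
  · exact ⟨0, le_rfl, fun R _ t h0 h1 => absurd (h0.trans h1) (not_le.2 hneg)⟩
  obtain ⟨K, C, hK0, hC0, hK, hE⟩ := h.exists_deriv_entropy_le hD hτ
  refine ⟨C * τ, by positivity, fun R hR t ht htτ => ?_⟩
  have hR0 : 0 < R := one_pos.trans_le hR
  have key : ∀ ε : ℝ, |ε| = 1 → (∫ z, ε * ρ t z * planeCutoff R z ^ 2)
      - ∫ z, ε * ρ 0 z * planeCutoff R z ^ 2 ≤ C * τ / R := by
    intro ε hε
    have hL : IsLinearEntropy (fun r => ε * r) (fun _ => ε) (fun _ => 0) (fun _ => 0) (fun _ => 0)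
        1 :=
      ⟨fun r => by simpa using (hasDerivAt_id r).const_mul ε, fun r => hasDerivAt_const _ _,
        continuous_const, fun _ => le_rfl, fun r => hasDerivAt_const _ _, continuous_const,
        fun _ => hε.le, fun r => by simp [abs_mul, hε], fun r => by simp [abs_mul, hε]⟩
    obtain ⟨hc, hd⟩ := hE _ _ _ _ _ _ hL R hR
    have := sub_le_mul_of_hasDerivAt_le ht (hc.mono (Set.Icc_subset_Icc_right htτ))
      (fun r hr => (hd r hr.1 (hr.2.le.trans htτ)).1.hasDerivAt) (c := C / R) fun r hr => by
        have := (hd r hr.1 (hr.2.le.trans htτ)).2 1 0 one_pos (fun _ => le_rfl) (by simp)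
          (fun z => by simp)
        simpa using this
    refine this.trans ?_
    rw [sub_zero, div_mul_eq_mul_div]
    gcongr
  rw [← h.initial, abs_le]
  have k1 := key 1 (by simp)
  have k2 := key (-1) (by simp)
  simp only [one_mul, neg_mul, integral_neg] at k1 k2
  constructor <;> linarith

theorem mass_eq (hD : 0 < D) (h : IsSmoothSolution D T ρ₀ ρ) {t : ℝ} (ht : 0 ≤ t)
    (htT : (t : EReal) < T) : ∫ z, ρ t z = ∫ z, ρ₀ z := by
  obtain ⟨C, -, hC⟩ := h.exists_abs_integral_cutoff_sub_le hD htT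
  have l1 := (tendsto_integral_mul_planeCutoff_sq (h.integrable_slice ht htT)).sub
    (tendsto_integral_mul_planeCutoff_sq h.integrable_data)
  have l2 : Tendsto (fun R : ℝ => C / R) atTop (𝓝 0) := tendsto_const_nhds.div_atTop tendsto_id
  have l3 : Tendsto (fun R => (∫ z, ρ t z * planeCutoff R z ^ 2)
      - ∫ z, ρ₀ z * planeCutoff R z ^ 2) atTop (𝓝 0) := squeeze_zero_norm' (by
    filter_upwards [eventually_ge_atTop 1] with R hR
    exact hC R hR t ht le_rfl) l2
  exact sub_eq_zero.1 (tendsto_nhds_unique l1 l3)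

/-- A strictly convex entropy on the negative axis, vanishing on the positive one, shows that the
solution stays nonnegative. -/
theorem nonneg (hD : 0 < D) (h : IsSmoothSolution D T ρ₀ ρ) {t : ℝ} (ht : 0 < t)
    (htT : (t : EReal) < T) (z : ℝ × ℝ) : 0 ≤ ρ t z := by
  set w : ℝ → ℝ := fun r => max (-r) 0 * Real.exp (-1 * r ^ 2) with hw
  have cw : Continuous w := by fun_prop
  have w0 : ∀ r, 0 ≤ w r := fun r => mul_nonneg (le_max_right _ _) (Real.exp_pos _).le
  have wpos : ∀ r, 0 ≤ r → w r = 0 := fun r hr => by simp [hw, hr]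
  have iw : Integrable w := by
    refine (integrable_mul_exp_neg_mul_sq one_pos).norm.mono' cw.aestronglyMeasurable
      (Eventually.of_forall fun r => ?_)
    rw [norm_mul, norm_mul]
    gcongr
    rw [Real.norm_eq_abs, Real.norm_eq_abs, abs_of_nonneg (le_max_right _ _)]
    exact max_le (neg_le_abs r) (abs_nonneg r)
  have ent0 : ∀ r, 0 ≤ r → entropy w r = 0 := fun r hr => by
    rw [entropy_eq_integral cw]
    refine intervalIntegral.integral_zero_ae (Eventually.of_forall fun s hs => ?_)
    rw [Set.uIoc_of_le hr] at hs
    simp [wpos s hs.1.le]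
  have entpos : ∀ r, r < 0 → 0 < entropy w r := fun r hr => by
    rw [entropy_eq_integral cw, intervalIntegral.integral_symm, ← intervalIntegral.integral_neg]
    refine intervalIntegral.intervalIntegral_pos_of_pos_on
      (by apply Continuous.intervalIntegrable; fun_prop) (fun s hs => ?_) hr
    have h1 : 0 < w s := mul_pos (lt_max_of_lt_left (neg_pos.2 hs.2)) (Real.exp_pos _)
    nlinarith [hs.1]
  have hflux : ∀ r, r * entropyFlux w r ≤ 0 := fun r => by
    rcases le_total 0 r with hr | hr
    · have : entropyFlux w r = 0 := by
        rw [entropyFlux]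
        refine intervalIntegral.integral_zero_ae (Eventually.of_forall fun s hs => ?_)
        rw [Set.uIoc_of_le hr] at hs
        simp [wpos s hs.1.le]
      simp [this]
    · refine mul_nonpos_of_nonpos_of_nonneg hr ?_
      rw [entropyFlux, intervalIntegral.integral_symm, ← intervalIntegral.integral_neg]
      refine intervalIntegral.integral_nonneg hr fun s hs => ?_
      nlinarith [hs.2, w0 s]
  have hL : IsLinearEntropy (entropy w) (entropyDeriv w) w (entropyFlux w) (fun r => r * w r)
      (∫ s, |w s|) :=
    ⟨hasDerivAt_entropy cw, hasDerivAt_entropyDeriv cw, cw, w0, hasDerivAt_entropyFlux cw,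
      by fun_prop, abs_entropyDeriv_le iw, abs_entropy_le cw iw, fun r => by
        rw [mul_comm]; exact abs_entropy_le cw iw r⟩
  obtain ⟨K, C, hK0, hC0, hK, hE⟩ := h.exists_deriv_entropy_le hD htT
  have cρ := (h.contDiff_slice ht htT).continuous
  have cent : Continuous (entropy w) :=
    continuous_iff_continuousAt.2 fun r => (hasDerivAt_entropy cw r).continuousAt
  have hi := h.integrable_slice ht.le htT
  have ient : Integrable fun z => entropy w (ρ t z) :=
    (hi.abs.const_mul (∫ s, |w s|)).mono' (cent.comp cρ).aestronglyMeasurable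
      (Eventually.of_forall fun z => abs_entropy_le cw iw _)
  have hle : ∀ R : ℝ, 1 ≤ R → ∫ z, entropy w (ρ t z) * planeCutoff R z ^ 2 ≤
      (∫ s, |w s|) * C * t / R := by
    intro R hR
    obtain ⟨hc, hd⟩ := hE _ _ _ _ _ _ hL R hR
    have := sub_le_mul_of_hasDerivAt_le ht.le hc
      (fun r hr => (hd r hr.1 hr.2.le).1.hasDerivAt) (c := (∫ s, |w s|) * C / R) fun r hr => by
        have h1 := (hd r hr.1 hr.2.le).2 1 0 one_pos (fun _ => le_rfl) (by simp)
          (fun z => by simp)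
        have h2 : ∫ z, ρ r z * entropyFlux w (ρ r z) * planeCutoff R z ^ 2 ≤ 0 :=
          integral_nonpos fun z => mul_nonpos_of_nonpos_of_nonneg (hflux _) (sq_nonneg _)
        simp only [sub_self, zero_mul, Pi.zero_apply, integral_zero, mul_zero] at h1
        linarith
    have h0 : ∫ z, entropy w (ρ 0 z) * planeCutoff R z ^ 2 = 0 := by
      rw [h.initial]
      refine integral_eq_zero_of_ae ?_
      filter_upwards [h.nonneg_data] with z hz
      simp [ent0 _ hz]
    rw [h0] at this
    calc _ ≤ (∫ s, |w s|) * C / R * (t - 0) := by linarith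
      _ = _ := by ring
  have l1 := tendsto_integral_mul_planeCutoff_sq ient
  have l2 : Tendsto (fun R : ℝ => (∫ s, |w s|) * C * t / R) atTop (𝓝 0) :=
    tendsto_const_nhds.div_atTop tendsto_id
  have h3 : ∫ z, entropy w (ρ t z) ≤ 0 := le_of_tendsto_of_tendsto l1 l2 (by
    filter_upwards [eventually_ge_atTop 1] with R hR using hle R hR)
  have h4 : ∫ z, entropy w (ρ t z) = 0 :=
    le_antisymm h3 (integral_nonneg fun z => entropy_nonneg cw w0 _)
  have h5 : (fun z => entropy w (ρ t z)) = 0 :=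
    ((cent.comp cρ).ae_eq_iff_eq volume continuous_zero).1
      ((integral_eq_zero_iff_of_nonneg (fun z => entropy_nonneg cw w0 _) ient).1 h4)
  by_contra hneg
  exact (entpos _ (not_le.1 hneg)).ne' (congrFun h5 z)

theorem ae_nonneg (hD : 0 < D) (h : IsSmoothSolution D T ρ₀ ρ) {t : ℝ} (ht : 0 ≤ t)
    (htT : (t : EReal) < T) : ∀ᵐ z, 0 ≤ ρ t z := by
  rcases ht.eq_or_lt with rfl | h0
  · rw [h.initial]; exact h.nonneg_data
  · exact Eventually.of_forall (h.nonneg hD h0 htT)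

/-- Mass does not escape to infinity, uniformly on bounded time intervals. -/
theorem exists_tail_le (hD : 0 < D) (h : IsSmoothSolution D T ρ₀ ρ) {τ : ℝ}
    (hτ : (τ : EReal) < T) : ∃ e : ℝ → ℝ, Tendsto e atTop (𝓝 0) ∧
      ∀ R : ℝ, 1 ≤ R → ∀ t, 0 ≤ t → t ≤ τ →
        ∫ z, ρ t z * (1 - planeCutoff R z ^ 2) ≤ e R := by
  obtain ⟨C, -, hC⟩ := h.exists_abs_integral_cutoff_sub_le hD hτ
  refine ⟨fun R => ((∫ z, ρ₀ z) - ∫ z, ρ₀ z * planeCutoff R z ^ 2) + C / R, ?_, ?_⟩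
  · have l1 := (tendsto_const_nhds (x := ∫ z, ρ₀ z)).sub
      (tendsto_integral_mul_planeCutoff_sq h.integrable_data)
    simpa using l1.add ((tendsto_const_nhds (x := C)).div_atTop tendsto_id)
  · intro R hR t ht htτ
    have htT := lt_of_le htτ hτ
    have hi := h.integrable_slice ht htT
    have e : ∫ z, ρ t z * (1 - planeCutoff R z ^ 2) =
        (∫ z, ρ t z) - ∫ z, ρ t z * planeCutoff R z ^ 2 := by
      rw [← integral_sub hi (integrable_mul_planeCutoff_sq hi R)]
      congr 1 with z
      ring
    have := (abs_le.1 (hC R hR t ht htτ)).1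
    rw [e, h.mass_eq hD ht htT]
    linarith

end IsSmoothSolution

/-! ### The second moment -/

/-- A form of Fatou's lemma. -/
theorem integrable_of_tendsto_of_integral_le {α : Type*} [MeasurableSpace α] {μ : Measure α}
    {g : ℕ → α → ℝ} {f : α → ℝ} {b : ℕ → ℝ} {N : ℝ} (hi : ∀ n, Integrable (g n) μ)
    (h0 : ∀ n, ∀ᵐ z ∂μ, 0 ≤ g n z) (hlim : ∀ᵐ z ∂μ, Tendsto (fun n => g n z) atTop (𝓝 (f z)))
    (hle : ∀ᶠ n in atTop, ∫ z, g n z ∂μ ≤ b n) (hb : Tendsto b atTop (𝓝 N)) :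
    Integrable f μ ∧ ∫ z, f z ∂μ ≤ N := by
  have hm : AEStronglyMeasurable f μ :=
    aestronglyMeasurable_of_tendsto_ae atTop (fun n => (hi n).aestronglyMeasurable) hlim
  have hf0 : ∀ᵐ z ∂μ, 0 ≤ f z := by
    filter_upwards [hlim, ae_all_iff.2 h0] with z hz hz0
    exact ge_of_tendsto' hz hz0
  have key : ∫⁻ z, ENNReal.ofReal (f z) ∂μ ≤ ENNReal.ofReal N := by
    calc ∫⁻ z, ENNReal.ofReal (f z) ∂μ
        = ∫⁻ z, liminf (fun n => ENNReal.ofReal (g n z)) atTop ∂μ := by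
          refine lintegral_congr_ae ?_
          filter_upwards [hlim] with z hz
          exact ((ENNReal.continuous_ofReal.tendsto _).comp hz).liminf_eq.symm
      _ ≤ liminf (fun n => ∫⁻ z, ENNReal.ofReal (g n z) ∂μ) atTop :=
          lintegral_liminf_le' fun n => (hi n).aemeasurable.ennreal_ofReal
      _ ≤ liminf (fun n => ENNReal.ofReal (b n)) atTop := by
          refine liminf_le_liminf ?_
          filter_upwards [hle] with n hn
          rw [← ofReal_integral_eq_lintegral_ofReal (hi n) (h0 n)]
          exact ENNReal.ofReal_le_ofReal hn
      _ = ENNReal.ofReal N := ((ENNReal.continuous_ofReal.tendsto _).comp hb).liminf_eq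
  have hfi : Integrable f μ :=
    (lintegral_ofReal_ne_top_iff_integrable hm hf0).1 (key.trans_lt ENNReal.ofReal_lt_top).ne
  refine ⟨hfi, ?_⟩
  have hN : 0 ≤ N := by
    refine ge_of_tendsto hb ?_
    filter_upwards [hle] with n hn
    exact (integral_nonneg_of_ae (h0 n)).trans hn
  rwa [← ofReal_integral_eq_lintegral_ofReal hfi hf0, ENNReal.ofReal_le_ofReal_iff hN] at key

theorem Filter.EventuallyEq.partialX {f g : ℝ × ℝ → ℝ} {z : ℝ × ℝ} (h : f =ᶠ[𝓝 z] g) :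
    partialX f =ᶠ[𝓝 z] partialX g := by
  refine h.eventually_nhds.mono fun w hw => ?_
  have h2 : Tendsto (fun x : ℝ => ((x, w.2) : ℝ × ℝ)) (𝓝 w.1) (𝓝 w) := by
    have : Continuous fun x : ℝ => ((x, w.2) : ℝ × ℝ) := by fun_prop
    simpa using this.tendsto w.1
  have h3 : (fun x => f (x, w.2)) =ᶠ[𝓝 w.1] fun x => g (x, w.2) := h2.eventually hw
  exact h3.deriv_eq

theorem contDiff_momentCutoff (R : ℝ) {n : ℕ} :
    ContDiff ℝ n (fun z : ℝ × ℝ => (z.1 ^ 2 + z.2 ^ 2) * planeCutoff R z ^ 2) :=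
  ((contDiff_fst.pow 2).add (contDiff_snd.pow 2)).mul (contDiff_planeCutoff_sq R)

theorem le_sq_add_sq_div_of_le_norm {R : ℝ} (hR : 0 < R) {z : ℝ × ℝ} (hz : R ≤ ‖z‖) :
    R ≤ (z.1 ^ 2 + z.2 ^ 2) / R ∧ |z.1| ≤ (z.1 ^ 2 + z.2 ^ 2) / R := by
  rw [Prod.norm_def, le_max_iff, Real.norm_eq_abs, Real.norm_eq_abs] at hz
  rw [le_div_iff₀ hR, le_div_iff₀ hR, ← sq_abs z.1, ← sq_abs z.2]
  have h1 := abs_nonneg z.1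
  have h2 := abs_nonneg z.2
  rcases hz with hz | hz
  · exact ⟨by nlinarith, by nlinarith⟩
  · exact ⟨by nlinarith, by nlinarith [sq_nonneg (|z.1| - |z.2|)]⟩

theorem moment_gradient_bound {R eu cu ev cv e' c' a₁ b₀ b₁ : ℝ} (hR0 : 0 < R) (cu0 : 0 ≤ cu)
    (cu1 : cu ≤ 1) (cv0 : 0 ≤ cv) (cv1 : cv ≤ 1) (heu : |eu| ≤ b₀) (hev : |ev| ≤ b₀)
    (he' : |e'| ≤ b₁) (hc' : |c'| ≤ a₁) :
    |R * (2 * eu * e' * cv ^ 2 + 2 * cu * c' * ev ^ 2)| ≤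
      (2 * b₁ + 2 * a₁ * b₀) * (1 + R ^ 2 * (eu ^ 2 * cv ^ 2 + cu ^ 2 * ev ^ 2)) ∧
    |R * (2 * eu * e' * cv ^ 2 + 2 * cu * c' * ev ^ 2)| ≤
      (2 * b₀ * b₁ + 2 * a₁ * b₀ ^ 2) * R := by
  have n3 : 0 ≤ b₀ := (abs_nonneg _).trans heu
  have n1 : 0 ≤ a₁ := (abs_nonneg _).trans hc'
  have n4 : 0 ≤ b₁ := (abs_nonneg _).trans he'
  have t1 : |R * (2 * eu * e' * cv ^ 2 + 2 * cu * c' * ev ^ 2)| ≤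
      R * (2 * |eu| * b₁ * cv ^ 2 + 2 * cu * a₁ * ev ^ 2) := by
    rw [abs_mul, abs_of_pos hR0]
    refine mul_le_mul_of_nonneg_left ((abs_add_le _ _).trans (add_le_add ?_ ?_)) hR0.le
    · rw [abs_mul, abs_mul, abs_mul, abs_two, abs_of_nonneg (sq_nonneg cv)]
      gcongr
    · rw [abs_mul, abs_mul, abs_mul, abs_two, abs_of_nonneg (sq_nonneg ev), abs_of_nonneg cu0]
      gcongr
  refine ⟨t1.trans ?_, t1.trans ?_⟩
  · have x1 : R * (2 * |eu| * b₁ * cv ^ 2) ≤ 2 * b₁ * (R * |eu| * cv) := by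
      have : cv ^ 2 ≤ cv := by nlinarith [cv1]
      calc _ = 2 * b₁ * (R * |eu|) * cv ^ 2 := by ring
        _ ≤ 2 * b₁ * (R * |eu|) * cv := by gcongr
        _ = _ := by ring
    have x2 : R * (2 * cu * a₁ * ev ^ 2) ≤ 2 * a₁ * b₀ * (R * cu * |ev|) := by
      have : ev ^ 2 ≤ b₀ * |ev| := by
        rw [← sq_abs, sq]
        exact mul_le_mul_of_nonneg_right hev (abs_nonneg _)
      calc _ = 2 * a₁ * (R * cu) * ev ^ 2 := by ring
        _ ≤ 2 * a₁ * (R * cu) * (b₀ * |ev|) := by gcongr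
        _ = _ := by ring
    have hsq : R ^ 2 * (eu ^ 2 * cv ^ 2 + cu ^ 2 * ev ^ 2) =
        (R * |eu| * cv) ^ 2 + (R * cu * |ev|) ^ 2 := by
      rw [← sq_abs eu, ← sq_abs ev]
      ring
    have gen : ∀ x y : ℝ, x ≤ 1 + (x ^ 2 + y ^ 2) ∧ y ≤ 1 + (x ^ 2 + y ^ 2) := fun x y =>
      ⟨by nlinarith [sq_nonneg (x - 1), sq_nonneg y],
        by nlinarith [sq_nonneg (y - 1), sq_nonneg x]⟩
    obtain ⟨y1, y2⟩ := gen (R * |eu| * cv) (R * cu * |ev|)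
    rw [← hsq] at y1 y2
    have y1' := mul_le_mul_of_nonneg_left y1 (by positivity : 0 ≤ 2 * b₁)
    have y2' := mul_le_mul_of_nonneg_left y2 (by positivity : 0 ≤ 2 * a₁ * b₀)
    linarith
  · have x1 : 2 * |eu| * b₁ * cv ^ 2 ≤ 2 * b₀ * b₁ * 1 := by
      have := pow_le_one₀ cv0 cv1 (n := 2)
      gcongr
    have x2 : 2 * cu * a₁ * ev ^ 2 ≤ 2 * 1 * a₁ * b₀ ^ 2 := by
      have : ev ^ 2 ≤ b₀ ^ 2 := by
        rw [← sq_abs]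
        exact pow_le_pow_left₀ (abs_nonneg _) hev 2
      gcongr
    rw [mul_comm _ R]
    refine mul_le_mul_of_nonneg_left ?_ hR0.le
    linarith

theorem moment_hessian_bound {eu cu ev cv e' c' e'' c'' a₁ a₂ b₀ b₁ b₂ : ℝ} (cu0 : 0 ≤ cu)
    (cu1 : cu ≤ 1) (cv0 : 0 ≤ cv) (cv1 : cv ≤ 1) (heu : |eu| ≤ b₀) (hev : |ev| ≤ b₀)
    (he' : |e'| ≤ b₁) (hc' : |c'| ≤ a₁) (he'' : |e''| ≤ b₂) (hc'' : |c''| ≤ a₂) :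
    |2 * (e' ^ 2 + eu * e'') * cv ^ 2 + 2 * (c' ^ 2 + cu * c'') * ev ^ 2| ≤
      2 * (b₁ ^ 2 + b₀ * b₂) + 2 * (a₁ ^ 2 + a₂) * b₀ ^ 2 := by
  have n2 : 0 ≤ a₂ := (abs_nonneg _).trans hc''
  refine (abs_add_le _ _).trans (add_le_add ?_ ?_)
  · rw [abs_mul, abs_mul, abs_two, abs_of_nonneg (sq_nonneg cv)]
    have k1 : |e' ^ 2 + eu * e''| ≤ b₁ ^ 2 + b₀ * b₂ := by
      refine (abs_add_le _ _).trans (add_le_add ?_ ?_)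
      · rw [abs_pow]; exact pow_le_pow_left₀ (abs_nonneg _) he' 2
      · rw [abs_mul]; exact mul_le_mul heu he'' (abs_nonneg _) ((abs_nonneg _).trans heu)
    exact (mul_le_of_le_one_right (by positivity) (pow_le_one₀ cv0 cv1)).trans (by gcongr)
  · rw [abs_mul, abs_mul, abs_two, abs_of_nonneg (sq_nonneg ev)]
    have k1 : |c' ^ 2 + cu * c''| ≤ a₁ ^ 2 + a₂ := by
      refine (abs_add_le _ _).trans (add_le_add ?_ ?_)
      · rw [abs_pow]; exact pow_le_pow_left₀ (abs_nonneg _) hc' 2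
      · rw [abs_mul, abs_of_nonneg cu0]
        exact (mul_le_of_le_one_left (abs_nonneg _) cu1).trans hc''
    have k2 : ev ^ 2 ≤ b₀ ^ 2 := by
      rw [← sq_abs]
      exact pow_le_pow_left₀ (abs_nonneg _) hev 2
    gcongr

/-- Derivatives of the truncated moment `φ = (x² + y²) ψ_R²`: uniformly in `R` one has
`|∂ₓ φ| ≲ 1 + φ` and `|∂ₓ² φ| ≲ 1`, and `∂ₓ φ`, `∂ₓ² φ` differ from `2 x`, `2` only far out. -/
theorem exists_momentCutoff_bound : ∃ A : ℝ, 0 ≤ A ∧ ∀ R : ℝ, 1 ≤ R → ∀ z : ℝ × ℝ,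
    |partialX (fun z => (z.1 ^ 2 + z.2 ^ 2) * planeCutoff R z ^ 2) z| ≤
      A * (1 + (z.1 ^ 2 + z.2 ^ 2) * planeCutoff R z ^ 2) ∧
    |partialX (partialX (fun z => (z.1 ^ 2 + z.2 ^ 2) * planeCutoff R z ^ 2)) z| ≤ A ∧
    |partialX (fun z => (z.1 ^ 2 + z.2 ^ 2) * planeCutoff R z ^ 2) z - 2 * z.1| ≤
      A * (z.1 ^ 2 + z.2 ^ 2) / R ∧
    |partialX (partialX (fun z => (z.1 ^ 2 + z.2 ^ 2) * planeCutoff R z ^ 2)) z - 2| ≤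
      A * (z.1 ^ 2 + z.2 ^ 2) / R := by
  set c : ℝ → ℝ := fun u => lineBump u with hc
  set e : ℝ → ℝ := fun u => u * c u with he
  have cd : ContDiff ℝ 2 c := lineBump.contDiff
  have ed : ContDiff ℝ 2 e := contDiff_id.mul cd
  have cs : HasCompactSupport c := lineBump.hasCompactSupport
  have es : HasCompactSupport e := cs.mul_left
  have c1 : ContDiff ℝ 1 (deriv c) := 
    (contDiff_succ_iff_deriv.1 (show ContDiff ℝ (1 + 1) c from cd)).2.2
  have e1 : ContDiff ℝ 1 (deriv e) := 
    (contDiff_succ_iff_deriv.1 (show ContDiff ℝ (1 + 1) e from ed)).2.2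
  have dc : ∀ u, HasDerivAt c (deriv c u) u := fun u =>
    (cd.differentiable two_ne_zero u).hasDerivAt
  have de : ∀ u, HasDerivAt e (deriv e u) u := fun u =>
    (ed.differentiable two_ne_zero u).hasDerivAt
  have ddc : ∀ u, HasDerivAt (deriv c) (deriv (deriv c) u) u := fun u =>
    (c1.differentiable one_ne_zero u).hasDerivAt
  have dde : ∀ u, HasDerivAt (deriv e) (deriv (deriv e) u) u := fun u =>
    (e1.differentiable one_ne_zero u).hasDerivAt
  obtain ⟨a₁, h1⟩ := c1.continuous.bounded_above_of_compact_support cs.deriv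
  obtain ⟨a₂, h2⟩ := (c1.continuous_deriv le_rfl).bounded_above_of_compact_support cs.deriv.deriv
  obtain ⟨b₀, g0⟩ := ed.continuous.bounded_above_of_compact_support es
  obtain ⟨b₁, g1⟩ := e1.continuous.bounded_above_of_compact_support es.deriv
  obtain ⟨b₂, g2⟩ := (e1.continuous_deriv le_rfl).bounded_above_of_compact_support es.deriv.deriv
  have n1 := (norm_nonneg _).trans (h1 0)
  have n2 := (norm_nonneg _).trans (h2 0)
  have n3 := (norm_nonneg _).trans (g0 0)
  have n4 := (norm_nonneg _).trans (g1 0)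
  have n5 := (norm_nonneg _).trans (g2 0)
  simp only [Real.norm_eq_abs] at h1 h2 g0 g1 g2
  have hc0 : ∀ u, 0 ≤ c u := fun u => lineBump.nonneg
  have hc1 : ∀ u, c u ≤ 1 := fun u => lineBump.le_one
  set A₁ := 2 * b₁ + 2 * a₁ * b₀ with hA1
  set A₂ := 2 * (b₁ ^ 2 + b₀ * b₂) + 2 * (a₁ ^ 2 + a₂) * b₀ ^ 2 with hA2
  set A₃ := 2 * b₀ * b₁ + 2 * a₁ * b₀ ^ 2 with hA3
  have p1 : 0 ≤ A₁ := by positivity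
  have p2 : 0 ≤ A₂ := by positivity
  have p3 : 0 ≤ A₃ := by positivity
  refine ⟨A₁ + A₂ + A₃ + 2, by positivity, fun R hR z => ?_⟩
  have hR0 : 0 < R := one_pos.trans_le hR
  have du : ∀ x : ℝ, HasDerivAt (fun x : ℝ => x / R) R⁻¹ x := fun x => by
    simpa using (hasDerivAt_id x).div_const R
  have eφ : (fun z : ℝ × ℝ => (z.1 ^ 2 + z.2 ^ 2) * planeCutoff R z ^ 2) = fun z =>
      R ^ 2 * (e (z.1 / R) ^ 2 * c (z.2 / R) ^ 2 + c (z.1 / R) ^ 2 * e (z.2 / R) ^ 2) := by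
    ext z
    simp only [planeCutoff, he, hc]
    field_simp
  have eX : partialX (fun z : ℝ × ℝ => (z.1 ^ 2 + z.2 ^ 2) * planeCutoff R z ^ 2) = fun z =>
      R * (2 * e (z.1 / R) * deriv e (z.1 / R) * c (z.2 / R) ^ 2
        + 2 * c (z.1 / R) * deriv c (z.1 / R) * e (z.2 / R) ^ 2) := by
    ext z
    have k1 := (de (z.1 / R)).comp z.1 (du z.1)
    have k2 := (dc (z.1 / R)).comp z.1 (du z.1)
    rw [eφ]
    refine (((((k1.pow 2).mul_const (c (z.2 / R) ^ 2)).add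
      ((k2.pow 2).mul_const (e (z.2 / R) ^ 2))).const_mul (R ^ 2)).congr_deriv ?_).deriv
    simp only [Function.comp_apply]
    field_simp
    simp
    ring
  have eXX : partialX (partialX (fun z : ℝ × ℝ => (z.1 ^ 2 + z.2 ^ 2) * planeCutoff R z ^ 2)) z =
      2 * (deriv e (z.1 / R) ^ 2 + e (z.1 / R) * deriv (deriv e) (z.1 / R)) * c (z.2 / R) ^ 2
      + 2 * (deriv c (z.1 / R) ^ 2 + c (z.1 / R) * deriv (deriv c) (z.1 / R))
        * e (z.2 / R) ^ 2 := by
    have k1 := (de (z.1 / R)).comp z.1 (du z.1)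
    have k2 := (dc (z.1 / R)).comp z.1 (du z.1)
    have k3 := (dde (z.1 / R)).comp z.1 (du z.1)
    have k4 := (ddc (z.1 / R)).comp z.1 (du z.1)
    rw [eX]
    refine (((((k1.const_mul 2).mul k3).mul_const (c (z.2 / R) ^ 2)).add
      (((k2.const_mul 2).mul k4).mul_const (e (z.2 / R) ^ 2))).const_mul R
      |>.congr_deriv ?_).deriv
    simp only [Function.comp_apply]
    field_simp
  clear_value c e
  have bX : |partialX (fun z : ℝ × ℝ => (z.1 ^ 2 + z.2 ^ 2) * planeCutoff R z ^ 2) z| ≤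
      A₁ * (1 + (z.1 ^ 2 + z.2 ^ 2) * planeCutoff R z ^ 2) ∧
      |partialX (fun z : ℝ × ℝ => (z.1 ^ 2 + z.2 ^ 2) * planeCutoff R z ^ 2) z| ≤ A₃ * R := by
    have q := congrFun eφ z
    beta_reduce at q
    rw [q, eX]
    beta_reduce
    generalize z.1 / R = u
    generalize z.2 / R = v
    have hu := hc0 u
    have hv := hc0 v
    exact moment_gradient_bound hR0 (hc0 u) (hc1 u) (hc0 v) (hc1 v) (g0 u) (g0 v) (g1 u) (h1 u)
  have bXX : |partialX (partialX (fun z : ℝ × ℝ => (z.1 ^ 2 + z.2 ^ 2) * planeCutoff R z ^ 2)) z|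
      ≤ A₂ := by
    rw [eXX]
    generalize z.1 / R = u
    generalize z.2 / R = v
    have hu := hc0 u
    have hv := hc0 v
    exact moment_hessian_bound (hc0 u) (hc1 u) (hc0 v) (hc1 v) (g0 u) (g0 v) (g1 u) (h1 u)
      (g2 u) (h2 u)
  have hφ0 : 0 ≤ (z.1 ^ 2 + z.2 ^ 2) * planeCutoff R z ^ 2 := by positivity
  have hm : 0 ≤ z.1 ^ 2 + z.2 ^ 2 := by positivity
  refine ⟨bX.1.trans (by gcongr; linarith), bXX.trans (by linarith), ?_⟩
  rcases lt_or_ge ‖z‖ R with hz | hz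
  · have ev : (fun z : ℝ × ℝ => (z.1 ^ 2 + z.2 ^ 2) * planeCutoff R z ^ 2) =ᶠ[𝓝 z]
        fun z => z.1 ^ 2 + z.2 ^ 2 := by
      filter_upwards [(continuous_norm.tendsto z).eventually_lt_const hz] with w hw
      rw [planeCutoff_eq_one hR0 hw.le]
      ring
    have k1 : partialX (fun z : ℝ × ℝ => z.1 ^ 2 + z.2 ^ 2) = fun z => 2 * z.1 := by
      ext w
      simp [partialX]
    have k2 : partialX (fun z : ℝ × ℝ => 2 * z.1) z = 2 := by
      simp [partialX]
    rw [ev.partialX.eq_of_nhds, ev.partialX.partialX.eq_of_nhds, k1, k2, sub_self, sub_self,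
      abs_zero]
    exact ⟨by positivity, by positivity⟩
  · obtain ⟨hzR, hzx⟩ := le_sq_add_sq_div_of_le_norm hR0 hz
    rw [mul_div_assoc]
    generalize (z.1 ^ 2 + z.2 ^ 2) / R = m at hzR hzx
    clear_value A₁ A₂ A₃
    have hm1 : 1 ≤ m := hR.trans hzR
    have hm0 : 0 ≤ m := zero_le_one.trans hm1
    have r1 := mul_nonneg p1 hm0
    have r2 := mul_nonneg p2 hm0
    have r3 := mul_nonneg p3 hm0
    constructor
    · refine (abs_sub _ _).trans ?_
      have q1 := bX.2.trans (mul_le_mul_of_nonneg_left hzR p3)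
      rw [abs_mul, abs_two]
      linarith
    · refine (abs_sub _ _).trans ?_
      have q1 := bXX.trans (le_mul_of_one_le_right p2 hm1)
      rw [abs_two]
      linarith

/-- The drift is attractive: `∬ x f Fₓ[f] = -½ ∭ |x - x'| f(x, y) f(x', y) ≤ 0`. -/
theorem integral_fst_mul_forceX_nonpos {f : ℝ × ℝ → ℝ} {K : ℝ} (h0 : ∀ z, 0 ≤ f z)
    (hK : LineBounded f K) (hm : Integrable fun z : ℝ × ℝ => z.1 * f z)
    (hf : Measurable f) : ∫ z : ℝ × ℝ, z.1 * f z * forceX f z ≤ 0 := by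
  have hi : Integrable fun z : ℝ × ℝ => z.1 * f z * forceX f z :=
    hm.mul_bdd (c := K) (stronglyMeasurable_forceX hf).aestronglyMeasurable
      (Eventually.of_forall hK.abs_forceX_le)
  have h : ∫ z : ℝ × ℝ, z.1 * f z * forceX f z =
      ∫ y : ℝ, ∫ x : ℝ, x * f (x, y) * forceX f (x, y) := integral_prod_symm _ hi
  rw [h]
  refine integral_nonpos_of_ae ?_
  have h1 := Integrable.prod_left_ae (μ := (volume : Measure ℝ)) (ν := (volume : Measure ℝ)) hm
  filter_upwards [h1] with y hy
  set g : ℝ → ℝ := fun x => f (x, y) with hg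
  have hgi : Integrable g := (hK.fst y).1
  have ms : Measurable fun q : ℝ × ℝ => Real.sign (q.1 - q.2) :=
    measurable_real_sign.comp (measurable_fst.sub measurable_snd)
  have i1 : Integrable fun q : ℝ × ℝ => Real.sign (q.1 - q.2) * (q.1 * g q.1 * g q.2) :=
    (hy.mul_prod hgi).bdd_mul (c := 1) ms.aestronglyMeasurable
      (Eventually.of_forall fun q => abs_sign_le_one _)
  have e1 : ∫ x, x * f (x, y) * forceX f (x, y) =
      -∫ q : ℝ × ℝ, Real.sign (q.1 - q.2) * (q.1 * g q.1 * g q.2) := by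
    have : ∫ q : ℝ × ℝ, Real.sign (q.1 - q.2) * (q.1 * g q.1 * g q.2) =
      ∫ x : ℝ, ∫ x' : ℝ, Real.sign (x - x') * (x * g x * g x') := integral_prod _ i1
    rw [this, ← integral_neg]
    congr 1 with x
    rw [forceX, mul_neg, ← integral_const_mul]
    congr 2 with x'
    ring
  have e2 := integral_comp_prodSwap fun q : ℝ × ℝ => Real.sign (q.1 - q.2) * (q.1 * g q.1 * g q.2)
  have e3 : 0 ≤ (∫ q : ℝ × ℝ, Real.sign (q.1 - q.2) * (q.1 * g q.1 * g q.2)) +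
      ∫ q : ℝ × ℝ, Real.sign (q.swap.1 - q.swap.2) * (q.swap.1 * g q.swap.1 * g q.swap.2) := by
    rw [← integral_add i1 (integrable_comp_prodSwap i1)]
    refine integral_nonneg fun q => ?_
    have hs : Real.sign (q.2 - q.1) = - Real.sign (q.1 - q.2) := by
      rw [← Real.sign_neg, neg_sub]
    have ha : 0 ≤ Real.sign (q.1 - q.2) * (q.1 - q.2) := Real.sign_mul_nonneg _
    have hgg : 0 ≤ g q.1 * g q.2 := mul_nonneg (h0 _) (h0 _)
    simp only [Prod.fst_swap, Prod.snd_swap, hs, Pi.zero_apply]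
    nlinarith
  rw [e2] at e3
  simp only [Pi.zero_apply]
  linarith

theorem integral_linear_fluxX_eq {D K : ℝ} {f φ : ℝ × ℝ → ℝ} (hf : ContDiff ℝ 2 f)
    (hK : LineBounded f K) (hφ : ContDiff ℝ 2 φ) (hs : HasCompactSupport φ) :
    Integrable (fun z => φ z * partialX (fun w => D * partialX f w - forceX f w * f w) z) ∧
    Integrable (fun z => D * f z * partialX (partialX φ) z
      + f z * partialX φ z * forceX f z) ∧
    ∫ z, φ z * partialX (fun w => D * partialX f w - forceX f w * f w) z =
      ∫ z, (D * f z * partialX (partialX φ) z + f z * partialX φ z * forceX f z) := by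
  have := integral_fluxX_eq (D := D) hf hK hφ hs (j := id) (j' := fun _ => 1) (j'' := fun _ => 0)
    (H := fun _ => 0) (H' := fun _ => 0) (fun r => hasDerivAt_id r) (fun r => hasDerivAt_const _ _)
    continuous_const (fun r => hasDerivAt_const _ _) continuous_const
  simpa using this

theorem hasCompactSupport_momentCutoff {R : ℝ} (hR : 0 < R) :
    HasCompactSupport (fun z : ℝ × ℝ => (z.1 ^ 2 + z.2 ^ 2) * planeCutoff R z ^ 2) :=
  (hasCompactSupport_planeCutoff_sq hR).mul_left

theorem momentCutoff_swap (R : ℝ) :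
    (fun z : ℝ × ℝ => (z.1 ^ 2 + z.2 ^ 2) * planeCutoff R z ^ 2) ∘ Prod.swap =
      fun z : ℝ × ℝ => (z.1 ^ 2 + z.2 ^ 2) * planeCutoff R z ^ 2 := by
  ext z
  have := congrFun (planeCutoff_swap R) z
  simp only [Function.comp_apply] at this ⊢
  rw [this]
  simp only [Prod.fst_swap, Prod.snd_swap]
  ring

/-- A rough bound for the production of the truncated moment, good enough for a Gronwall
argument. -/
theorem moment_fluxX_le {D K A R : ℝ} {f : ℝ × ℝ → ℝ} (hD : 0 < D) (hR : 0 < R)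
    (hf : ContDiff ℝ 2 f) (hK : LineBounded f K) (h0 : ∀ z, 0 ≤ f z)
    (hA1 : ∀ z, |partialX (fun z => (z.1 ^ 2 + z.2 ^ 2) * planeCutoff R z ^ 2) z| ≤
      A * (1 + (z.1 ^ 2 + z.2 ^ 2) * planeCutoff R z ^ 2))
    (hA2 : ∀ z, |partialX (partialX (fun z => (z.1 ^ 2 + z.2 ^ 2) * planeCutoff R z ^ 2)) z| ≤ A) :
    ∫ z : ℝ × ℝ, (z.1 ^ 2 + z.2 ^ 2) * planeCutoff R z ^ 2 *
      partialX (fun w => D * partialX f w - forceX f w * f w) z ≤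
    (D * A + K * A) * (∫ z, f z)
      + K * A * ∫ z, f z * ((z.1 ^ 2 + z.2 ^ 2) * planeCutoff R z ^ 2) := by
  obtain ⟨-, i2, e⟩ := integral_linear_fluxX_eq (D := D) hf hK (contDiff_momentCutoff R)
    (hasCompactSupport_momentCutoff hR)
  have i3 : Integrable fun z : ℝ × ℝ => f z * ((z.1 ^ 2 + z.2 ^ 2) * planeCutoff R z ^ 2) :=
    integrable_mul_of_hasCompactSupport hf.continuous
      (contDiff_momentCutoff R (n := 0)).continuous (hasCompactSupport_momentCutoff hR)
  rw [e, ← integral_const_mul, ← integral_const_mul,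
    ← integral_add (hK.integrable.const_mul _) (i3.const_mul _)]
  refine integral_mono i2 ((hK.integrable.const_mul _).add (i3.const_mul _)) fun z => ?_
  have y1 : D * f z * partialX (partialX (fun z => (z.1 ^ 2 + z.2 ^ 2) * planeCutoff R z ^ 2)) z ≤
      D * f z * A :=
    mul_le_mul_of_nonneg_left ((le_abs_self _).trans (hA2 z)) (mul_nonneg hD.le (h0 z))
  have y2 : f z * partialX (fun z => (z.1 ^ 2 + z.2 ^ 2) * planeCutoff R z ^ 2) z * forceX f z ≤
      f z * (A * (1 + (z.1 ^ 2 + z.2 ^ 2) * planeCutoff R z ^ 2) * K) := by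
    rw [mul_assoc]
    refine mul_le_mul_of_nonneg_left ((le_abs_self _).trans ?_) (h0 z)
    rw [abs_mul]
    exact mul_le_mul (hA1 z) (hK.abs_forceX_le z) (abs_nonneg _) ((abs_nonneg _).trans (hA1 z))
  beta_reduce
  linarith

theorem integrable_fst_mul_of_moment {f : ℝ × ℝ → ℝ} (hi : Integrable f)
    (hm : Integrable fun z : ℝ × ℝ => (z.1 ^ 2 + z.2 ^ 2) * f z) :
    Integrable fun z : ℝ × ℝ => z.1 * f z := by
  refine (hi.norm.add hm.norm).mono' (continuous_fst.aestronglyMeasurable.mul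
    hi.aestronglyMeasurable) (Eventually.of_forall fun z => ?_)
  have h2 : |z.1| ≤ 1 + (z.1 ^ 2 + z.2 ^ 2) := by
    nlinarith [sq_abs z.1, sq_nonneg (|z.1| - 1), sq_nonneg z.2]
  simp only [Pi.add_apply, norm_mul, Real.norm_eq_abs]
  rw [abs_of_nonneg (by positivity : 0 ≤ z.1 ^ 2 + z.2 ^ 2)]
  nlinarith [abs_nonneg (f z)]

/-- The sharp bound for the production of the truncated moment, once the moment is finite. -/
theorem moment_fluxX_le_sharp {D K A R : ℝ} {f : ℝ × ℝ → ℝ} (hD : 0 < D) (hR : 0 < R)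
    (hf : ContDiff ℝ 2 f) (hK : LineBounded f K) (h0 : ∀ z, 0 ≤ f z)
    (hm : Integrable fun z : ℝ × ℝ => (z.1 ^ 2 + z.2 ^ 2) * f z)
    (hA1 : ∀ z, |partialX (fun z => (z.1 ^ 2 + z.2 ^ 2) * planeCutoff R z ^ 2) z - 2 * z.1| ≤
      A * (z.1 ^ 2 + z.2 ^ 2) / R)
    (hA2 : ∀ z, |partialX (partialX (fun z => (z.1 ^ 2 + z.2 ^ 2) * planeCutoff R z ^ 2)) z - 2| ≤
      A * (z.1 ^ 2 + z.2 ^ 2) / R) :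
    ∫ z : ℝ × ℝ, (z.1 ^ 2 + z.2 ^ 2) * planeCutoff R z ^ 2 *
      partialX (fun w => D * partialX f w - forceX f w * f w) z ≤
    2 * D * (∫ z, f z) + (D + K) * A / R * ∫ z : ℝ × ℝ, (z.1 ^ 2 + z.2 ^ 2) * f z := by
  obtain ⟨-, i2, e⟩ := integral_linear_fluxX_eq (D := D) hf hK (contDiff_momentCutoff R)
    (hasCompactSupport_momentCutoff hR)
  have hx := integrable_fst_mul_of_moment hK.integrable hm
  have hneg := integral_fst_mul_forceX_nonpos h0 hK hx hf.continuous.measurable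
  have hi : Integrable fun z : ℝ × ℝ => z.1 * f z * forceX f z :=
    hx.mul_bdd (c := K) (stronglyMeasurable_forceX hf.continuous.measurable).aestronglyMeasurable
      (Eventually.of_forall hK.abs_forceX_le)
  have i4 : Integrable fun z : ℝ × ℝ => 2 * D * f z
      + (D + K) * A / R * ((z.1 ^ 2 + z.2 ^ 2) * f z) :=
    (hK.integrable.const_mul _).add (hm.const_mul _)
  have key : ∫ z, (D * f z * partialX (partialX
      (fun z => (z.1 ^ 2 + z.2 ^ 2) * planeCutoff R z ^ 2)) z
      + f z * partialX (fun z => (z.1 ^ 2 + z.2 ^ 2) * planeCutoff R z ^ 2) z * forceX f z) ≤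
      ∫ z : ℝ × ℝ, (2 * D * f z + (D + K) * A / R * ((z.1 ^ 2 + z.2 ^ 2) * f z)
        + 2 * (z.1 * f z * forceX f z)) := by
    refine integral_mono i2 (i4.add (hi.const_mul _)) fun z => ?_
    have y1 : D * f z * (partialX (partialX
        (fun z => (z.1 ^ 2 + z.2 ^ 2) * planeCutoff R z ^ 2)) z - 2) ≤
        D * f z * (A * (z.1 ^ 2 + z.2 ^ 2) / R) :=
      mul_le_mul_of_nonneg_left ((le_abs_self _).trans (hA2 z)) (mul_nonneg hD.le (h0 z))
    have y2 : f z * ((partialX (fun z => (z.1 ^ 2 + z.2 ^ 2) * planeCutoff R z ^ 2) z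
        - 2 * z.1) * forceX f z) ≤ f z * (A * (z.1 ^ 2 + z.2 ^ 2) / R * K) := by
      refine mul_le_mul_of_nonneg_left ((le_abs_self _).trans ?_) (h0 z)
      rw [abs_mul]
      exact mul_le_mul (hA1 z) (hK.abs_forceX_le z) (abs_nonneg _) ((abs_nonneg _).trans (hA1 z))
    have e3 : (D + K) * A / R * ((z.1 ^ 2 + z.2 ^ 2) * f z) =
      D * f z * (A * (z.1 ^ 2 + z.2 ^ 2) / R) + f z * (A * (z.1 ^ 2 + z.2 ^ 2) / R * K) := by ring
    beta_reduce
    linarith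
  rw [e]
  rw [integral_add i4 (hi.const_mul _), integral_add (hK.integrable.const_mul _) (hm.const_mul _),
    integral_const_mul, integral_const_mul, integral_const_mul] at key
  linarith

namespace IsSmoothSolution

variable {D : ℝ} {T : EReal} {ρ₀ : ℝ × ℝ → ℝ} {ρ : ℝ → ℝ × ℝ → ℝ}

theorem hasDerivAt_truncatedMoment (h : IsSmoothSolution D T ρ₀ ρ) {t : ℝ} (ht : 0 < t)
    (htT : (t : EReal) < T) {R : ℝ} (hR : 0 < R) :
    HasDerivAt (fun s => ∫ z : ℝ × ℝ, ρ s z * ((z.1 ^ 2 + z.2 ^ 2) * planeCutoff R z ^ 2))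
      ((∫ z : ℝ × ℝ, (z.1 ^ 2 + z.2 ^ 2) * planeCutoff R z ^ 2 *
        partialX (fun w => D * partialX (ρ t) w - forceX (ρ t) w * ρ t w) z) +
      ∫ z : ℝ × ℝ, (z.1 ^ 2 + z.2 ^ 2) * planeCutoff R z ^ 2 *
        partialX (fun w => D * partialX (ρ t ∘ Prod.swap) w
          - forceX (ρ t ∘ Prod.swap) w * (ρ t ∘ Prod.swap) w) z) t := by
  have hs := hasCompactSupport_momentCutoff hR
  have hφ := contDiff_momentCutoff R (n := 2)
  obtain ⟨K, -, hK⟩ := h.exists_lineBounded htT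
  have hL := (hK t ht le_rfl).1
  have hf := h.contDiff_slice ht htT
  have hd := h.hasDerivAt_integral_entropy ht htT hφ.continuous hs (j := fun r => r)
    (j' := fun _ => 1) (fun r => hasDerivAt_id r) continuous_const
  refine hd.congr_deriv ?_
  have i1 := (integral_linear_fluxX_eq (D := D) hf hL hφ hs).1
  have i2 := integrable_comp_prodSwap
    (integral_linear_fluxX_eq (D := D) hf.comp_prodSwap hL.swap hφ hs).1
  rw [← integral_comp_prodSwap fun z : ℝ × ℝ => (z.1 ^ 2 + z.2 ^ 2) * planeCutoff R z ^ 2 *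
        partialX (fun w => D * partialX (ρ t ∘ Prod.swap) w
          - forceX (ρ t ∘ Prod.swap) w * (ρ t ∘ Prod.swap) w) z, ← integral_add i1 i2]
  congr 1 with z
  have e := congrFun (momentCutoff_swap R) z
  simp only [Function.comp_apply] at e
  rw [e, one_mul, mul_add]
  rfl

theorem integral_truncatedMoment_zero_le (h : IsSmoothSolution D T ρ₀ ρ)
    (hm : Integrable fun z : ℝ × ℝ => (z.1 ^ 2 + z.2 ^ 2) * ρ₀ z) (R : ℝ) :
    ∫ z : ℝ × ℝ, ρ 0 z * ((z.1 ^ 2 + z.2 ^ 2) * planeCutoff R z ^ 2) ≤ secondMoment ρ₀ := by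
  rw [h.initial, secondMoment]
  have e : ∀ z : ℝ × ℝ, ρ₀ z * ((z.1 ^ 2 + z.2 ^ 2) * planeCutoff R z ^ 2) =
      (z.1 ^ 2 + z.2 ^ 2) * ρ₀ z * planeCutoff R z ^ 2 := fun z => by ring
  simp_rw [e]
  refine integral_mono_ae (integrable_mul_planeCutoff_sq hm R) hm ?_
  filter_upwards [h.nonneg_data] with z hz
  exact mul_le_of_le_one_right (by positivity)
    (pow_le_one₀ (planeCutoff_nonneg R z) (planeCutoff_le_one R z))

/-- Bounds on truncated moments pass to the second moment. -/
theorem moment_le_of_truncated_le (hD : 0 < D) (h : IsSmoothSolution D T ρ₀ ρ) {t : ℝ} (ht : 0 < t)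
    (htT : (t : EReal) < T) {b : ℝ → ℝ} {N : ℝ} (hb : Tendsto b atTop (𝓝 N))
    (hle : ∀ R : ℝ, 1 ≤ R →
      ∫ z : ℝ × ℝ, ρ t z * ((z.1 ^ 2 + z.2 ^ 2) * planeCutoff R z ^ 2) ≤ b R) :
    Integrable (fun z : ℝ × ℝ => (z.1 ^ 2 + z.2 ^ 2) * ρ t z) ∧
      ∫ z : ℝ × ℝ, (z.1 ^ 2 + z.2 ^ 2) * ρ t z ≤ N := by
  refine integrable_of_tendsto_of_integral_le
    (g := fun (n : ℕ) z => ρ t z * ((z.1 ^ 2 + z.2 ^ 2) * planeCutoff ((n : ℝ) + 1) z ^ 2))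
    (b := fun n : ℕ => b ((n : ℝ) + 1)) (fun n => ?_) (fun n => ?_) ?_ ?_ ?_
  · exact integrable_mul_of_hasCompactSupport (h.contDiff_slice ht htT).continuous
      (contDiff_momentCutoff _ (n := 0)).continuous (hasCompactSupport_momentCutoff (by positivity))
  · exact Eventually.of_forall fun z => mul_nonneg (h.nonneg hD ht htT z) (by positivity)
  · refine Eventually.of_forall fun z => tendsto_const_nhds.congr' ?_
    filter_upwards [tendsto_natCast_atTop_atTop.eventually_ge_atTop ‖z‖] with n hn
    rw [planeCutoff_eq_one (by positivity) (by linarith)]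
    ring
  · exact Eventually.of_forall fun n => hle _ (by simp)
  · exact hb.comp (tendsto_atTop_add_const_right _ _ tendsto_natCast_atTop_atTop)

theorem exists_moment_le (hD : 0 < D) (h : IsSmoothSolution D T ρ₀ ρ)
    (hm : Integrable fun z : ℝ × ℝ => (z.1 ^ 2 + z.2 ^ 2) * ρ₀ z) {τ : ℝ}
    (hτ : (τ : EReal) < T) : ∃ N : ℝ, 0 ≤ N ∧ ∀ t, 0 < t → t ≤ τ →
      Integrable (fun z : ℝ × ℝ => (z.1 ^ 2 + z.2 ^ 2) * ρ t z) ∧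
      ∫ z : ℝ × ℝ, (z.1 ^ 2 + z.2 ^ 2) * ρ t z ≤ N := by
  obtain ⟨K, hK0, hK⟩ := h.exists_lineBounded hτ
  obtain ⟨A, hA0, hA⟩ := exists_momentCutoff_bound
  have hM : 0 ≤ ∫ z, ρ₀ z := integral_nonneg_of_ae h.nonneg_data
  have hm0 : 0 ≤ secondMoment ρ₀ := integral_nonneg_of_ae (by
    filter_upwards [h.nonneg_data] with z hz
    exact mul_nonneg (by positivity) hz)
  set b := 2 * (D * A + K * A) * ∫ z, ρ₀ z with hb
  set a := 2 * K * A + 1 with ha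
  have hb0 : 0 ≤ b := by positivity
  refine ⟨Real.exp (a * τ) * (secondMoment ρ₀ + b), by positivity, fun t ht htτ => ?_⟩
  have htT := lt_of_le htτ hτ
  refine h.moment_le_of_truncated_le hD ht htT
    (b := fun _ => Real.exp (a * τ) * (secondMoment ρ₀ + b)) tendsto_const_nhds fun R hR => ?_
  have hR0 : 0 < R := one_pos.trans_le hR
  have hc := h.continuousOn_integral_entropy htT (contDiff_momentCutoff R (n := 0)).continuous
    (hasCompactSupport_momentCutoff hR0) (j := fun r => r) (j' := fun _ => 1) (B := 1)
    (fun r => hasDerivAt_id r) continuous_const (fun _ => by simp)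
  have key := sub_le_exp_mul_sub_of_deriv_le (l := -a) (b := -b) ht.le hc
    (fun r hr => h.hasDerivAt_truncatedMoment hr.1 (lt_of_le hr.2.le htT) hR0) fun r hr => by
      have hrT := lt_of_le hr.2.le htT
      have hL := (hK r hr.1 (hr.2.le.trans htτ)).1
      have hf := h.contDiff_slice hr.1 hrT
      have hnn := h.nonneg hD hr.1 hrT
      have k1 := moment_fluxX_le hD hR0 hf hL hnn (fun z => (hA R hR z).1)
        (fun z => (hA R hR z).2.1)
      have k2 := moment_fluxX_le hD hR0 hf.comp_prodSwap hL.swap (fun z => hnn z.swap)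
        (fun z => (hA R hR z).1) (fun z => (hA R hR z).2.1)
      have e1 : ∫ z, (ρ r ∘ Prod.swap) z = ∫ z, ρ r z := integral_comp_prodSwap _
      have e2 : ∫ z, (ρ r ∘ Prod.swap) z * ((z.1 ^ 2 + z.2 ^ 2) * planeCutoff R z ^ 2) =
          ∫ z, ρ r z * ((z.1 ^ 2 + z.2 ^ 2) * planeCutoff R z ^ 2) := by
        rw [← integral_comp_prodSwap fun z : ℝ × ℝ =>
          ρ r z * ((z.1 ^ 2 + z.2 ^ 2) * planeCutoff R z ^ 2)]
        congr 1 with z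
        have e := congrFun (momentCutoff_swap R) z
        simp only [Function.comp_apply] at e
        rw [e]
        rfl
      rw [e1, e2, h.mass_eq hD hr.1.le hrT] at k2
      rw [h.mass_eq hD hr.1.le hrT] at k1
      have hJ : 0 ≤ ∫ z, ρ r z * ((z.1 ^ 2 + z.2 ^ 2) * planeCutoff R z ^ 2) :=
        integral_nonneg fun z => mul_nonneg (hnn z) (by positivity)
      have hab : 0 ≤ 2 * K * A * b := by positivity
      rw [neg_neg, sub_neg_eq_add]
      calc _ ≤ _ := add_le_add k1 k2
        _ = b + 2 * K * A * ∫ z, ρ r z * ((z.1 ^ 2 + z.2 ^ 2) * planeCutoff R z ^ 2) := by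
          rw [hb]; ring
        _ ≤ _ := by rw [ha]; linarith
  simp only [neg_neg, sub_neg_eq_add, sub_zero] at key
  have h0 := h.integral_truncatedMoment_zero_le hm R
  have hexp : Real.exp (a * t) ≤ Real.exp (a * τ) :=
    Real.exp_le_exp.2 (mul_le_mul_of_nonneg_left htτ (by positivity))
  calc _ ≤ _ := (le_add_of_nonneg_right hb0).trans key
    _ ≤ Real.exp (a * t) * (secondMoment ρ₀ + b) := by gcongr
    _ ≤ _ := by gcongr

theorem secondMoment_le (hD : 0 < D) (h : IsSmoothSolution D T ρ₀ ρ)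
    (hm : Integrable fun z : ℝ × ℝ => (z.1 ^ 2 + z.2 ^ 2) * ρ₀ z) {t : ℝ} (ht : 0 ≤ t)
    (htT : (t : EReal) < T) : Integrable (fun z : ℝ × ℝ => (z.1 ^ 2 + z.2 ^ 2) * ρ t z) ∧
      secondMoment (ρ t) ≤ secondMoment ρ₀ + 4 * D * (∫ z, ρ₀ z) * t := by
  rcases ht.eq_or_lt with rfl | ht
  · rw [h.initial]
    exact ⟨hm, by simp⟩
  obtain ⟨K, hK0, hK⟩ := h.exists_lineBounded htT
  obtain ⟨A, hA0, hA⟩ := exists_momentCutoff_bound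
  obtain ⟨N, hN0, hN⟩ := h.exists_moment_le hD hm htT
  refine h.moment_le_of_truncated_le hD ht htT (b := fun R => secondMoment ρ₀ +
    (4 * D * (∫ z, ρ₀ z) + 2 * ((D + K) * A * N) / R) * t) ?_ fun R hR => ?_
  · have l : Tendsto (fun R : ℝ => 2 * ((D + K) * A * N) / R) atTop (𝓝 0) :=
      tendsto_const_nhds.div_atTop tendsto_id
    simpa using ((l.const_add (4 * D * (∫ z, ρ₀ z))).mul_const t).const_add (secondMoment ρ₀)
  have hR0 : 0 < R := one_pos.trans_le hR
  have hc := h.continuousOn_integral_entropy htT (contDiff_momentCutoff R (n := 0)).continuous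
    (hasCompactSupport_momentCutoff hR0) (j := fun r => r) (j' := fun _ => 1) (B := 1)
    (fun r => hasDerivAt_id r) continuous_const (fun _ => by simp)
  have key := sub_le_mul_of_hasDerivAt_le ht.le hc
    (fun r hr => h.hasDerivAt_truncatedMoment hr.1 (lt_of_le hr.2.le htT) hR0)
    (c := 4 * D * (∫ z, ρ₀ z) + 2 * ((D + K) * A * N) / R) fun r hr => by
      have hrT := lt_of_le hr.2.le htT
      have hL := (hK r hr.1 hr.2.le).1
      have hf := h.contDiff_slice hr.1 hrT
      have hnn := h.nonneg hD hr.1 hrT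
      obtain ⟨mi, mN⟩ := hN r hr.1 hr.2.le
      have es : (fun z : ℝ × ℝ => (z.1 ^ 2 + z.2 ^ 2) * (ρ r ∘ Prod.swap) z) =
          fun z : ℝ × ℝ => (z.swap.1 ^ 2 + z.swap.2 ^ 2) * ρ r z.swap := by
        ext z
        simp only [Function.comp_apply, Prod.fst_swap, Prod.snd_swap]
        ring
      have k1 := moment_fluxX_le_sharp hD hR0 hf hL hnn mi (fun z => (hA R hR z).2.2.1)
        (fun z => (hA R hR z).2.2.2)
      have k2 := moment_fluxX_le_sharp hD hR0 hf.comp_prodSwap hL.swap (fun z => hnn z.swap)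
        (by rw [es]; exact integrable_comp_prodSwap mi) (fun z => (hA R hR z).2.2.1)
        (fun z => (hA R hR z).2.2.2)
      have e1 : ∫ z, (ρ r ∘ Prod.swap) z = ∫ z, ρ r z := integral_comp_prodSwap _
      rw [es, integral_comp_prodSwap fun z : ℝ × ℝ => (z.1 ^ 2 + z.2 ^ 2) * ρ r z, e1,
        h.mass_eq hD hr.1.le hrT] at k2
      rw [h.mass_eq hD hr.1.le hrT] at k1
      have hb : (D + K) * A / R * ∫ z : ℝ × ℝ, (z.1 ^ 2 + z.2 ^ 2) * ρ r z ≤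
          (D + K) * A / R * N := by gcongr
      calc _ ≤ _ := add_le_add k1 k2
        _ ≤ 2 * (2 * D * (∫ z, ρ₀ z) + (D + K) * A / R * N) := by linarith
        _ = _ := by ring
  have h0 := h.integral_truncatedMoment_zero_le hm R
  beta_reduce at key
  rw [sub_zero] at key
  linarith

end IsSmoothSolution

/-! ### The Gagliardo–Nirenberg–Sobolev constants -/

theorem sq_integral_mul_le {α : Type*} [MeasurableSpace α] {μ : Measure α} {f g : α → ℝ}
    (hf : Integrable (fun x => f x ^ 2) μ) (hg : Integrable (fun x => g x ^ 2) μ)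
    (hfg : Integrable (fun x => f x * g x) μ) :
    (∫ x, f x * g x ∂μ) ^ 2 ≤ (∫ x, f x ^ 2 ∂μ) * ∫ x, g x ^ 2 ∂μ := by
  have h : ∀ t : ℝ, 0 ≤ (∫ x, g x ^ 2 ∂μ) * (t * t) + (2 * ∫ x, f x * g x ∂μ) * t
      + ∫ x, f x ^ 2 ∂μ := by
    intro t
    have e : (∫ x, (f x + t * g x) ^ 2 ∂μ) = (∫ x, g x ^ 2 ∂μ) * (t * t)
        + (2 * ∫ x, f x * g x ∂μ) * t + ∫ x, f x ^ 2 ∂μ := by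
      have e1 : ∀ x, (f x + t * g x) ^ 2 = t * t * g x ^ 2 + 2 * t * (f x * g x) + f x ^ 2 :=
        fun x => by ring
      simp_rw [e1]
      have i1 : Integrable (fun x => t * t * g x ^ 2 + 2 * t * (f x * g x)) μ :=
        (hg.const_mul _).add (hfg.const_mul _)
      rw [integral_add i1 hf,
        integral_add (hg.const_mul _) (hfg.const_mul _), integral_const_mul, integral_const_mul]
      ring
    rw [← e]
    exact integral_nonneg fun x => sq_nonneg _
  have := discrim_le_zero h
  rw [discrim] at this
  linarith

theorem norm_fderiv_le_abs_partial {v : ℝ × ℝ → ℝ} (hv : Differentiable ℝ v) (z : ℝ × ℝ) :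
    ‖fderiv ℝ v z‖ ≤ |partialX v z| + |partialY v z| := by
  have hy : partialY v z = fderiv ℝ v z (0, 1) := by
    have h1 : HasDerivAt (fun y : ℝ => ((z.1, y) : ℝ × ℝ)) (0, 1) z.2 :=
      (hasDerivAt_const _ _).prodMk (hasDerivAt_id z.2)
    exact ((hv z).hasFDerivAt.comp_hasDerivAt z.2 h1).deriv
  rw [partialX_eq_fderiv hv, hy]
  refine ContinuousLinearMap.opNorm_le_bound _ (by positivity) fun w => ?_
  have e : w = w.1 • ((1, 0) : ℝ × ℝ) + w.2 • ((0, 1) : ℝ × ℝ) := by ext <;> simp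
  have e2 : fderiv ℝ v z w = w.1 * fderiv ℝ v z (1, 0) + w.2 * fderiv ℝ v z (0, 1) := by
    conv_lhs => rw [e]
    rw [map_add, map_smul, map_smul, smul_eq_mul, smul_eq_mul]
  rw [e2, Real.norm_eq_abs]
  refine (abs_add_le _ _).trans ?_
  rw [abs_mul, abs_mul]
  have h1 : |w.1| ≤ ‖w‖ := norm_fst_le w
  have h2 : |w.2| ≤ ‖w‖ := norm_snd_le w
  have h3 := mul_le_mul_of_nonneg_right h1 (abs_nonneg (fderiv ℝ v z (1, 0)))
  have h4 := mul_le_mul_of_nonneg_right h2 (abs_nonneg (fderiv ℝ v z (0, 1)))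
  linarith

/-- The Sobolev embedding `W^{1,1} ⊂ L²` of the plane. -/
theorem exists_integral_sq_le_sq_integral_grad : ∃ C : ℝ, 0 ≤ C ∧ ∀ v : ℝ × ℝ → ℝ,
    ContDiff ℝ 1 v → HasCompactSupport v →
      ∫ z, v z ^ 2 ≤ C * (∫ z, (|partialX v z| + |partialY v z|)) ^ 2 := by
  set c := eLpNormLESNormFDerivOneConst (volume : Measure (ℝ × ℝ)) ((2 : NNReal) : ℝ) with hc
  refine ⟨(c : ℝ) ^ 2, by positivity, fun v hv hs => ?_⟩
  have hconj : NNReal.HolderConjugate (Module.finrank ℝ (ℝ × ℝ) : NNReal) 2 := by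
    have : (Module.finrank ℝ (ℝ × ℝ) : NNReal) = 2 := by simp
    rw [this]
    rw [NNReal.holderConjugate_iff]
    constructor
    · norm_num
    · exact add_self_div_two (1 : NNReal) ▸ by norm_num
  have h := eLpNorm_le_eLpNorm_fderiv_one (volume : Measure (ℝ × ℝ)) hv hs hconj
  have hvL : MemLp v 2 := hv.continuous.memLp_of_hasCompactSupport hs
  have hfd : Integrable (fderiv ℝ v) :=
    (hv.continuous_fderiv one_ne_zero).integrable_of_hasCompactSupport (hs.fderiv ℝ)
  have hg : Integrable fun z => |partialX v z| + |partialY v z| :=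
    ((hv.continuous_partialX.integrable_of_hasCompactSupport hs.partialX).abs).add
      ((hv.continuous_partialY.integrable_of_hasCompactSupport hs.partialY).abs)
  have h1 : ∫ z, ‖fderiv ℝ v z‖ ≤ ∫ z, (|partialX v z| + |partialY v z|) :=
    integral_mono hfd.norm hg fun z => norm_fderiv_le_abs_partial (hv.differentiable one_ne_zero) z
  have h2 : (eLpNorm v 2 volume).toReal ^ 2 = ∫ z, v z ^ 2 := by
    have e := hvL.eLpNorm_eq_integral_rpow_norm two_ne_zero ENNReal.ofNat_ne_top
    rw [e, ENNReal.toReal_ofReal (by positivity)]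
    simp only [ENNReal.toReal_ofNat, Real.rpow_ofNat, Real.norm_eq_abs, sq_abs]
    rw [← Real.rpow_natCast, ← Real.rpow_mul (integral_nonneg fun z => sq_nonneg _)]
    norm_num
  have h3 : eLpNorm (fderiv ℝ v) 1 volume = ENNReal.ofReal (∫ z, ‖fderiv ℝ v z‖) := by
    rw [eLpNorm_one_eq_lintegral_enorm, ← ofReal_integral_norm_eq_lintegral_enorm hfd]
  have h4 : (eLpNorm v 2 volume).toReal ≤ c * ∫ z, ‖fderiv ℝ v z‖ := by
    refine ENNReal.toReal_le_of_le_ofReal (by positivity) ?_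
    rw [ENNReal.ofReal_mul (NNReal.coe_nonneg c), ← h3, ENNReal.ofReal_coe_nnreal]
    exact_mod_cast h
  rw [← h2, ← mul_pow]
  exact pow_le_pow_left₀ ENNReal.toReal_nonneg
    (h4.trans (mul_le_mul_of_nonneg_left h1 c.2)) 2

/-- The Gagliardo–Nirenberg–Sobolev inequality holds with some constant: apply the embedding
`W^{1,1} ⊂ L²` to `ξ^((p+1)/2)`. -/
theorem exists_isGNSConstant {p : ℝ} (hp : 1 ≤ p) : ∃ C : ℝ, 0 ≤ C ∧ IsGNSConstant p C := by
  obtain ⟨C, hC0, hC⟩ := exists_integral_sq_le_sq_integral_grad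
  have hp0 : 0 < p := one_pos.trans_le hp
  refine ⟨C * (2 * (1 + 1 / p) ^ 2), by positivity, fun ξ h0 hs hu => ?_⟩
  set u : ℝ × ℝ → ℝ := fun z => ξ z ^ (p / 2) with hu_def
  have hu0 : ∀ z, 0 ≤ u z := fun z => Real.rpow_nonneg (h0 z) _
  have hus : HasCompactSupport u :=
    hs.comp_left (g := fun r => r ^ (p / 2)) (Real.zero_rpow (by positivity))
  have hsq : ∀ z, Real.sqrt (ξ z) = u z ^ (1 / p) := fun z => by
    rw [hu_def, ← Real.rpow_mul (h0 z), Real.sqrt_eq_rpow]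
    congr 1
    field_simp
  have hξu : ∀ z, ξ z = u z ^ (2 / p) := fun z => by
    rw [hu_def, ← Real.rpow_mul (h0 z)]
    rw [show p / 2 * (2 / p) = 1 by field_simp, Real.rpow_one]
  have cu := hu.continuous
  have cξ : Continuous ξ := by
    rw [funext hξu]
    exact cu.rpow_const fun z => Or.inr (by positivity)
  have e1 : (1 : ℝ) ≤ 1 + 1 / p := by
    have : 0 < 1 / p := by positivity
    linarith
  set v : ℝ × ℝ → ℝ := fun z => u z ^ (1 + 1 / p) with hv_def
  have hv : ContDiff ℝ 1 v := by
    have := hu.rpow_const_of_le (m := 1) (p := 1 + 1 / p) (by exact_mod_cast e1)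
    exact this
  have hvs : HasCompactSupport v :=
    hus.comp_left (g := fun r => r ^ (1 + 1 / p)) (Real.zero_rpow (by positivity))
  have hv2 : ∀ z, v z ^ 2 = ξ z ^ (p + 1) := fun z => by
    rw [hv_def, ← Real.rpow_natCast, ← Real.rpow_mul (hu0 z), hu_def, ← Real.rpow_mul (h0 z)]
    congr 1
    push_cast
    field_simp
  have hvx : ∀ z, partialX v z = (1 + 1 / p) * (Real.sqrt (ξ z) * partialX u z) := fun z => by
    have := (hu.hasDerivAt_partialX z).rpow_const (p := 1 + 1 / p) (Or.inr e1)
    refine (this.congr_deriv ?_).deriv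
    rw [hsq, add_sub_cancel_left]
    ring
  have hvy : ∀ z, partialY v z = (1 + 1 / p) * (Real.sqrt (ξ z) * partialY u z) := fun z => by
    have := (hu.hasDerivAt_partialY z).rpow_const (p := 1 + 1 / p) (Or.inr e1)
    refine (this.congr_deriv ?_).deriv
    rw [hsq, add_sub_cancel_left]
    ring
  have cux := hu.continuous_partialX
  have cuy := hu.continuous_partialY
  have hgs : HasCompactSupport fun z => |partialX u z| + |partialY u z| :=
    (hus.partialX.abs).add hus.partialY.abs
  have iξ : Integrable ξ := cξ.integrable_of_hasCompactSupport hs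
  have ig2 : Integrable fun z => (|partialX u z| + |partialY u z|) ^ 2 :=
    Continuous.integrable_of_hasCompactSupport (by fun_prop)
      (hgs.comp_left (g := fun r => r ^ 2) (by simp))
  have iξg : Integrable fun z => Real.sqrt (ξ z) * (|partialX u z| + |partialY u z|) :=
    Continuous.integrable_of_hasCompactSupport (by fun_prop) hgs.mul_left
  have igrad : Integrable fun z => partialX u z ^ 2 + partialY u z ^ 2 :=
    Continuous.integrable_of_hasCompactSupport (by fun_prop)
      ((hus.partialX.comp_left (g := fun r => r ^ 2) (by simp)).add
        (hus.partialY.comp_left (g := fun r => r ^ 2) (by simp)))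
  have hCS := sq_integral_mul_le (μ := volume) (f := fun z => Real.sqrt (ξ z))
    (g := fun z => |partialX u z| + |partialY u z|)
    (iξ.congr (Eventually.of_forall fun z => (Real.sq_sqrt (h0 z)).symm)) ig2 iξg
  have e2 : ∫ z, Real.sqrt (ξ z) ^ 2 = ∫ z, ξ z := by
    congr 1 with z
    exact Real.sq_sqrt (h0 z)
  have e3 : ∫ z, (|partialX u z| + |partialY u z|) ^ 2 ≤
      2 * ∫ z, (partialX u z ^ 2 + partialY u z ^ 2) := by
    rw [← integral_const_mul]
    refine integral_mono ig2 (igrad.const_mul _) fun z => ?_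
    have := sq_nonneg (|partialX u z| - |partialY u z|)
    nlinarith [sq_abs (partialX u z), sq_abs (partialY u z)]
  have e4 : ∫ z, (|partialX v z| + |partialY v z|) =
      (1 + 1 / p) * ∫ z, Real.sqrt (ξ z) * (|partialX u z| + |partialY u z|) := by
    rw [← integral_const_mul]
    congr 1 with z
    rw [hvx, hvy, abs_mul, abs_mul, abs_mul, abs_mul, abs_of_nonneg (Real.sqrt_nonneg _),
      abs_of_nonneg (by positivity : 0 ≤ 1 + 1 / p)]
    ring
  have h := hC v hv hvs
  rw [e4] at h
  simp_rw [hv2] at h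
  have hξ0 : 0 ≤ ∫ z, ξ z := integral_nonneg h0
  calc ∫ z, ξ z ^ (p + 1)
      ≤ C * ((1 + 1 / p) * ∫ z, Real.sqrt (ξ z) * (|partialX u z| + |partialY u z|)) ^ 2 := h
    _ = C * (1 + 1 / p) ^ 2 *
        (∫ z, Real.sqrt (ξ z) * (|partialX u z| + |partialY u z|)) ^ 2 := by ring
    _ ≤ C * (1 + 1 / p) ^ 2 * ((∫ z, ξ z) * (2 * ∫ z, (partialX u z ^ 2 + partialY u z ^ 2))) := by
        refine mul_le_mul_of_nonneg_left (hCS.trans ?_) (by positivity)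
        rw [e2]
        exact mul_le_mul_of_nonneg_left e3 hξ0
    _ = _ := by ring

theorem gnsConstant_nonneg (p : ℝ) : 0 ≤ gnsConstant p := Real.sInf_nonneg fun _ h => h.1

/-- The infimum defining `gnsConstant p` is attained. -/
theorem isGNSConstant_gnsConstant {p : ℝ} (hp : 1 ≤ p) : IsGNSConstant p (gnsConstant p) := by
  intro ξ h0 hs hu
  obtain ⟨C₀, hC₀⟩ := exists_isGNSConstant hp
  set I := ∫ z, (partialX (fun w => ξ w ^ (p / 2)) z ^ 2 + partialY (fun w => ξ w ^ (p / 2)) z ^ 2)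
  have hI : 0 ≤ I := integral_nonneg fun z => by positivity
  have hξ : 0 ≤ ∫ z, ξ z := integral_nonneg h0
  have hx : ∀ C, 0 ≤ C ∧ IsGNSConstant p C → ∫ z, ξ z ^ (p + 1) ≤ C * ((∫ z, ξ z) * I) :=
    fun C hC => by rw [← mul_assoc]; exact hC.2 ξ h0 hs hu
  rw [mul_assoc]
  rcases (mul_nonneg hξ hI).eq_or_lt with h | h
  · have := hx C₀ hC₀
    rw [← h, mul_zero] at this ⊢
    exact this
  · rw [← div_le_iff₀ h]
    exact le_csInf ⟨C₀, hC₀⟩ fun C hC => (div_le_iff₀ h).2 (hx C hC)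

/-! ### Truncated powers -/

/-- A smooth transition from `0` on `(-∞, 1]` to `1` on `[2, ∞)`. -/
noncomputable def unitStep (s : ℝ) : ℝ := Real.smoothTransition (s - 1)

theorem contDiff_unitStep {n : ℕ} : ContDiff ℝ n unitStep :=
  Real.smoothTransition.contDiff.comp (contDiff_id.sub contDiff_const)

theorem unitStep_nonneg (s : ℝ) : 0 ≤ unitStep s := Real.smoothTransition.nonneg _

theorem unitStep_le_one (s : ℝ) : unitStep s ≤ 1 := Real.smoothTransition.le_one _

theorem unitStep_eq_zero {s : ℝ} (h : s ≤ 1) : unitStep s = 0 :=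
  Real.smoothTransition.zero_of_nonpos (by linarith)

theorem unitStep_eq_one {s : ℝ} (h : 2 ≤ s) : unitStep s = 1 :=
  Real.smoothTransition.one_of_one_le (by linarith)

theorem hasDerivAt_unitStep (s : ℝ) : HasDerivAt unitStep (deriv unitStep s) s :=
  ((contDiff_unitStep (n := 1)).differentiable one_ne_zero s).hasDerivAt

theorem deriv_unitStep_of_le {s : ℝ} (h : s ≤ 1) : deriv unitStep s = 0 := by
  refine IsLocalMin.deriv_eq_zero (Eventually.of_forall fun r => ?_)
  rw [unitStep_eq_zero h]
  exact unitStep_nonneg r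

theorem deriv_unitStep_of_ge {s : ℝ} (h : 2 ≤ s) : deriv unitStep s = 0 := by
  refine IsLocalMax.deriv_eq_zero (Eventually.of_forall fun r => ?_)
  rw [unitStep_eq_one h]
  exact unitStep_le_one r

theorem continuous_deriv_unitStep : Continuous (deriv unitStep) :=
  (contDiff_unitStep (n := 1)).continuous_deriv le_rfl

theorem exists_abs_mul_deriv_unitStep_le : ∃ M : ℝ, 0 ≤ M ∧ ∀ s, |s * deriv unitStep s| ≤ M := by
  have hs : HasCompactSupport fun s => s * deriv unitStep s :=
    HasCompactSupport.intro (isCompact_Icc (a := (1 : ℝ)) (b := 2)) fun s hs => by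
      rw [Set.mem_Icc, not_and_or, not_le, not_le] at hs
      rcases hs with h | h
      · rw [deriv_unitStep_of_le h.le, mul_zero]
      · rw [deriv_unitStep_of_ge h.le, mul_zero]
  obtain ⟨M, hM⟩ :=
    (continuous_id.mul continuous_deriv_unitStep).bounded_above_of_compact_support hs
  exact ⟨M, (norm_nonneg _).trans (hM 0), hM⟩

/-- A smooth cutoff on the half line, equal to `1` on `[2 a, b]` and vanishing outside
`[a, 2 b]`. The product of `r` and its derivative is bounded independently of `a` and `b`. -/
noncomputable def levelCutoff (a b r : ℝ) : ℝ := unitStep (r / a) * (1 - unitStep (r / b))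

/-- The derivative of `levelCutoff a b`. -/
noncomputable def levelCutoffDeriv (a b r : ℝ) : ℝ :=
  deriv unitStep (r / a) * a⁻¹ * (1 - unitStep (r / b))
    - unitStep (r / a) * (deriv unitStep (r / b) * b⁻¹)

theorem hasDerivAt_levelCutoff (a b r : ℝ) :
    HasDerivAt (levelCutoff a b) (levelCutoffDeriv a b r) r := by
  have hd : ∀ c : ℝ, HasDerivAt (fun r => unitStep (r / c)) (deriv unitStep (r / c) * c⁻¹) r :=
    fun c => by
      have h1 : HasDerivAt (fun r : ℝ => r / c) c⁻¹ r := by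
        simpa using (hasDerivAt_id r).div_const c
      exact (hasDerivAt_unitStep (r / c)).comp_of_eq r h1 rfl
  refine ((hd a).mul ((hd b).const_sub 1)).congr_deriv ?_
  rw [levelCutoffDeriv]
  ring

theorem continuous_levelCutoffDeriv (a b : ℝ) : Continuous (levelCutoffDeriv a b) := by
  have h1 := continuous_deriv_unitStep
  have h2 := (contDiff_unitStep (n := 0)).continuous
  unfold levelCutoffDeriv
  fun_prop

theorem levelCutoff_nonneg (a b r : ℝ) : 0 ≤ levelCutoff a b r :=
  mul_nonneg (unitStep_nonneg _) (sub_nonneg.2 (unitStep_le_one _))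

theorem levelCutoff_le_one (a b r : ℝ) : levelCutoff a b r ≤ 1 :=
  mul_le_one₀ (unitStep_le_one _) (sub_nonneg.2 (unitStep_le_one _))
    (sub_le_self _ (unitStep_nonneg _))

section

variable {a b r : ℝ}

theorem levelCutoff_of_le (ha : 0 < a) (h : r ≤ a) :
    levelCutoff a b r = 0 ∧ levelCutoffDeriv a b r = 0 := by
  have h1 : r / a ≤ 1 := (div_le_one ha).2 h
  simp [levelCutoff, levelCutoffDeriv, unitStep_eq_zero h1, deriv_unitStep_of_le h1]

theorem levelCutoff_of_ge (hb : 0 < b) (h : 2 * b ≤ r) :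
    levelCutoff a b r = 0 ∧ levelCutoffDeriv a b r = 0 := by
  have h1 : 2 ≤ r / b := (le_div_iff₀ hb).2 h
  simp [levelCutoff, levelCutoffDeriv, unitStep_eq_one h1, deriv_unitStep_of_ge h1]

theorem levelCutoff_of_mem (ha : 0 < a) (hb : 0 < b) (h1 : 2 * a ≤ r) (h2 : r ≤ b) :
    levelCutoff a b r = 1 ∧ levelCutoffDeriv a b r = 0 := by
  have h3 : 2 ≤ r / a := (le_div_iff₀ ha).2 h1
  have h4 : r / b ≤ 1 := (div_le_one hb).2 h2
  simp [levelCutoff, levelCutoffDeriv, unitStep_eq_one h3, deriv_unitStep_of_ge h3,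
    unitStep_eq_zero h4, deriv_unitStep_of_le h4]

theorem abs_mul_levelCutoffDeriv_le {M : ℝ} (hM : ∀ s, |s * deriv unitStep s| ≤ M) :
    |r * levelCutoffDeriv a b r| ≤ 2 * M := by
  have e : r * levelCutoffDeriv a b r = (r / a * deriv unitStep (r / a)) * (1 - unitStep (r / b))
      - unitStep (r / a) * (r / b * deriv unitStep (r / b)) := by
    rw [levelCutoffDeriv]; ring
  rw [e]
  refine (abs_sub _ _).trans ?_
  rw [abs_mul (r / a * _), abs_mul (unitStep (r / a)),
    abs_of_nonneg (sub_nonneg.2 (unitStep_le_one (r / b))),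
    abs_of_nonneg (unitStep_nonneg (r / a))]
  have h1 := mul_le_of_le_one_right (abs_nonneg (r / a * deriv unitStep (r / a)))
    (sub_le_self 1 (unitStep_nonneg (r / b)))
  have h2 := mul_le_of_le_one_left (abs_nonneg (r / b * deriv unitStep (r / b)))
    (unitStep_le_one (r / a))
  linarith [hM (r / a), hM (r / b)]

end

/-- The truncated power `r ^ q χ(r)` with the cutoff `χ = levelCutoff a b`. -/
noncomputable def truncPow (q a b r : ℝ) : ℝ := r ^ q * levelCutoff a b r

/-- The derivative of `truncPow q a b`. -/
noncomputable def truncPowDeriv (q a b r : ℝ) : ℝ :=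
  r ^ (q - 1) * (q * levelCutoff a b r + r * levelCutoffDeriv a b r)

section

variable {q a b r : ℝ}

theorem truncPow_of_le (ha : 0 < a) (h : r ≤ a) :
    truncPow q a b r = 0 ∧ truncPowDeriv q a b r = 0 := by
  obtain ⟨h1, h2⟩ := levelCutoff_of_le (b := b) ha h
  simp [truncPow, truncPowDeriv, h1, h2]

theorem truncPow_of_ge (hb : 0 < b) (h : 2 * b ≤ r) :
    truncPow q a b r = 0 ∧ truncPowDeriv q a b r = 0 := by
  obtain ⟨h1, h2⟩ := levelCutoff_of_ge (a := a) hb h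
  simp [truncPow, truncPowDeriv, h1, h2]

theorem truncPow_of_mem (ha : 0 < a) (hb : 0 < b) (h1 : 2 * a ≤ r) (h2 : r ≤ b) :
    truncPow q a b r = r ^ q ∧ truncPowDeriv q a b r = q * r ^ (q - 1) := by
  obtain ⟨h3, h4⟩ := levelCutoff_of_mem ha hb h1 h2
  simp [truncPow, truncPowDeriv, h3, h4, mul_comm]

theorem truncPow_nonneg (ha : 0 < a) : 0 ≤ truncPow q a b r := by
  rcases le_total r a with h | h
  · rw [(truncPow_of_le ha h).1]
  · exact mul_nonneg (Real.rpow_nonneg (ha.le.trans h) _) (levelCutoff_nonneg _ _ _)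

theorem truncPow_le (hr : 0 ≤ r) : truncPow q a b r ≤ r ^ q :=
  mul_le_of_le_one_right (Real.rpow_nonneg hr _) (levelCutoff_le_one _ _ _)

theorem hasDerivAt_truncPow (ha : 0 < a) (r : ℝ) :
    HasDerivAt (truncPow q a b) (truncPowDeriv q a b r) r := by
  rcases lt_or_ge r a with h | h
  · rw [(truncPow_of_le ha h.le).2]
    refine (hasDerivAt_const r (0 : ℝ)).congr_of_eventuallyEq ?_
    filter_upwards [Iio_mem_nhds h] with s hs
    exact (truncPow_of_le ha (le_of_lt hs)).1
  · have hr : 0 < r := ha.trans_le h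
    refine ((Real.hasDerivAt_rpow_const (Or.inl hr.ne')).mul
      (hasDerivAt_levelCutoff a b r)).congr_deriv ?_
    rw [truncPowDeriv]
    have : r ^ q = r ^ (q - 1) * r := by
      rw [← Real.rpow_add_one hr.ne', sub_add_cancel]
    rw [this]
    ring

theorem continuous_truncPowDeriv (ha : 0 < a) : Continuous (truncPowDeriv q a b) := by
  rw [continuous_iff_continuousAt]
  intro r
  rcases lt_or_ge r a with h | h
  · refine (continuousAt_const (y := (0 : ℝ))).congr ?_
    filter_upwards [Iio_mem_nhds h] with s hs
    exact (truncPow_of_le ha (le_of_lt hs)).2.symm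
  · have hr : 0 < r := ha.trans_le h
    have h1 : Continuous (levelCutoff a b) :=
      continuous_iff_continuousAt.2 fun r => (hasDerivAt_levelCutoff a b r).continuousAt
    have h2 := continuous_levelCutoffDeriv a b
    refine (Real.continuousAt_rpow_const r _ (Or.inl hr.ne')).mul (Continuous.continuousAt ?_)
    fun_prop

theorem continuous_truncPow (ha : 0 < a) : Continuous (truncPow q a b) :=
  continuous_iff_continuousAt.2 fun r => (hasDerivAt_truncPow ha r).continuousAt

theorem abs_truncPowDeriv_le {M : ℝ} (hM : ∀ s, |s * deriv unitStep s| ≤ M) (hq : 0 ≤ q)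
    (hr : 0 ≤ r) : |truncPowDeriv q a b r| ≤ (q + 2 * M) * r ^ (q - 1) := by
  rw [truncPowDeriv, abs_mul, abs_of_nonneg (Real.rpow_nonneg hr _), mul_comm]
  refine mul_le_mul_of_nonneg_right ((abs_add_le _ _).trans (add_le_add ?_ ?_))
    (Real.rpow_nonneg hr _)
  · rw [abs_mul, abs_of_nonneg hq, abs_of_nonneg (levelCutoff_nonneg a b r)]
    exact mul_le_of_le_one_right hq (levelCutoff_le_one a b r)
  · exact abs_mul_levelCutoffDeriv_le hM

end

/-- A continuous function supported in a compact subinterval of `(0, ∞)` is dominated by a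
multiple of `|r|`. -/
theorem exists_abs_le_mul_abs {g : ℝ → ℝ} (hg : Continuous g) {a b : ℝ} (ha : 0 < a)
    (h1 : ∀ r ≤ a, g r = 0) (h2 : ∀ r, b ≤ r → g r = 0) :
    ∃ B : ℝ, 0 ≤ B ∧ ∀ r, |g r| ≤ B * |r| := by
  have hs : HasCompactSupport g := HasCompactSupport.intro (isCompact_Icc (a := a) (b := b))
    fun r hr => by
      rw [Set.mem_Icc, not_and_or, not_le, not_le] at hr
      exact hr.elim (fun h => h1 r h.le) fun h => h2 r h.le
  obtain ⟨C, hC⟩ := hg.bounded_above_of_compact_support hs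
  have hC0 : 0 ≤ C := (norm_nonneg _).trans (hC 0)
  refine ⟨C / a, by positivity, fun r => ?_⟩
  rcases le_total r a with h | h
  · rw [h1 r h, abs_zero]; positivity
  · refine (hC r).trans ?_
    rw [div_mul_eq_mul_div, le_div_iff₀ ha, abs_of_nonneg (ha.le.trans h)]
    exact mul_le_mul_of_nonneg_left h hC0

/-- The error committed by truncating `r ^ p` to levels between about `1 / n` and `n`: it controls
`r ^ p` outside `[4 / n, n]`, and its integral tends to `0` for densities in `L¹ ∩ L^p`. -/
noncomputable def powerError (p n r : ℝ) : ℝ := n ^ (1 - p) * r + if n < r then r ^ p else 0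

theorem powerError_nonneg {p n r : ℝ} (hn : 0 ≤ n) (hr : 0 ≤ r) : 0 ≤ powerError p n r := by
  unfold powerError
  have h1 := mul_nonneg (Real.rpow_nonneg hn (1 - p)) hr
  split_ifs
  · exact add_nonneg h1 (Real.rpow_nonneg hr _)
  · simpa using h1

theorem rpow_le_of_le_div {p n r : ℝ} (hp : 1 < p) (hn : 0 < n) (hr : 0 ≤ r) {c : ℝ} (hc : 0 ≤ c)
    (h : r ≤ c / n) : r ^ p ≤ c ^ (p - 1) * (n ^ (1 - p) * r) := by
  rcases hr.eq_or_lt with rfl | hr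
  · simp [Real.zero_rpow (by linarith : p ≠ 0)]
  · have e1 : r ^ p = r ^ (p - 1) * r := by rw [← Real.rpow_add_one hr.ne', sub_add_cancel]
    have e2 : c ^ (p - 1) * (n ^ (1 - p) * r) = (c / n) ^ (p - 1) * r := by
      rw [Real.div_rpow hc hn.le, show 1 - p = -(p - 1) by ring, Real.rpow_neg hn.le]
      field_simp
    rw [e1, e2]
    gcongr

theorem rpow_le_powerError {p n r : ℝ} (hp : 1 < p) (hn : 0 < n) (hr : 0 ≤ r)
    (h : r ≤ 4 / n ∨ n < r) : r ^ p ≤ 4 ^ (p - 1) * powerError p n r := by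
  have h4 : (1 : ℝ) ≤ 4 ^ (p - 1) := Real.one_le_rpow (by norm_num) (by linarith)
  rcases lt_or_ge n r with h' | h'
  · have : r ^ p ≤ powerError p n r := by
      rw [powerError, if_pos h']
      exact le_add_of_nonneg_left (mul_nonneg (Real.rpow_nonneg hn.le _) hr)
    exact this.trans (le_mul_of_one_le_left (powerError_nonneg hn.le hr) h4)
  · rw [powerError, if_neg (not_lt.2 h'), add_zero]
    exact rpow_le_of_le_div hp hn hr (by norm_num) (h.resolve_right (not_lt.2 h'))

/-- Truncation of `r ^ p` at levels between about `1 / n` and `n`. The function `G` approximates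
`r ^ (p / 2)`, the entropy with second derivative `w = 4 (p - 1) / p G'²` approximates `r ^ p`, and
`H` approximates its flux `(p - 1) r ^ p`. The constant `C` depends on `p` only. -/
structure IsPowerTruncation (p n C B : ℝ) (G G' w H H' : ℝ → ℝ) : Prop where
  hasDerivAt : ∀ r, HasDerivAt G (G' r) r
  continuous_deriv : Continuous G'
  weight_eq : ∀ r, w r = 4 * (p - 1) / p * G' r ^ 2
  linear_zero : IsLinearEntropy (entropy w) (entropyDeriv w) w (fun _ => 0) (fun _ => 0) B
  linear : IsLinearEntropy (entropy w) (entropyDeriv w) w H H' B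
  entropy_nonneg : ∀ r, 0 ≤ entropy w r
  sq_mul_weight_le : ∀ r, 0 ≤ r → r ^ 2 * w r ≤ C * (entropy w r + n ^ (1 - p) * r)
  sq_sub_le : ∀ r, 0 ≤ r → (r * w r - H' r) ^ 2 ≤ w r * (C * powerError p n r)
  abs_entropy_sub_le : ∀ r, 0 ≤ r → |entropy w r - r ^ p| ≤ C * powerError p n r
  rpow_le : ∀ r, 0 ≤ r → r ^ p ≤ G r ^ 2 + C * powerError p n r
  mul_flux_le_rpow : ∀ r, r * H r ≤ (p - 1) * G r ^ (2 + 2 / p)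
  mul_flux_le : ∀ r, r * H r ≤ (p - 1) * (r * G r ^ 2)
  nonneg : ∀ r, 0 ≤ G r
  le_rpow : ∀ r, 0 ≤ r → G r ≤ r ^ (p / 2)
  sq_le : ∀ r, G r ^ 2 ≤ B * |r|
  mul_flux_le_linear : ∀ r, r * H r ≤ B * |r|
  flux_nonneg : ∀ r, 0 ≤ H r

theorem entropyFlux_nonneg {w : ℝ → ℝ} (h0 : ∀ r, 0 ≤ w r) {r : ℝ} (hr : 0 ≤ r) :
    0 ≤ entropyFlux w r :=
  intervalIntegral.integral_nonneg hr fun s hs => mul_nonneg hs.1 (h0 s)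

theorem entropyDeriv_nonneg {w : ℝ → ℝ} (h0 : ∀ r, 0 ≤ w r) {r : ℝ} (hr : 0 ≤ r) :
    0 ≤ entropyDeriv w r :=
  intervalIntegral.integral_nonneg hr fun s _ => h0 s

theorem monotoneOn_entropy {w : ℝ → ℝ} (hw : Continuous w) (h0 : ∀ r, 0 ≤ w r) :
    MonotoneOn (entropy w) (Set.Ici 0) := by
  refine monotoneOn_of_deriv_nonneg (convex_Ici 0)
    (fun r _ => (hasDerivAt_entropy hw r).continuousAt.continuousWithinAt)
    (fun r _ => (hasDerivAt_entropy hw r).differentiableAt.differentiableWithinAt) fun r hr => ?_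
  rw [(hasDerivAt_entropy hw r).deriv]
  rw [interior_Ici] at hr
  exact entropyDeriv_nonneg h0 (le_of_lt hr)

theorem entropyDeriv_le_of_le_rpow {w : ℝ → ℝ} (hw : Continuous w) {p c : ℝ} (hp : 1 < p)
    (hle : ∀ s, 0 ≤ s → w s ≤ c * s ^ (p - 2)) {r : ℝ} (hr : 0 ≤ r) :
    entropyDeriv w r ≤ c / (p - 1) * r ^ (p - 1) := by
  have h1 : entropyDeriv w r ≤ ∫ s in (0 : ℝ)..r, c * s ^ (p - 2) :=
    intervalIntegral.integral_mono_on hr (hw.intervalIntegrable _ _)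
      ((intervalIntegral.intervalIntegrable_rpow' (by linarith)).const_mul c)
      fun s hs => hle s hs.1
  rw [intervalIntegral.integral_const_mul, integral_rpow (Or.inl (by linarith)),
    show p - 2 + 1 = p - 1 by ring, Real.zero_rpow (by linarith)] at h1
  calc _ ≤ _ := h1
    _ = _ := by ring

/-- If `w` agrees with `(s ^ p)''` on `[a, b]` and is `O(s ^ (p - 2))`, its entropy is
`r ^ p + O(a ^ (p - 1) r)` on `[a, b]`. -/
theorem abs_entropy_sub_rpow_le {w : ℝ → ℝ} (hw : Continuous w) (h0 : ∀ r, 0 ≤ w r) {p c a b : ℝ}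
    (hp : 1 < p) (ha : 0 < a) (hle : ∀ s, 0 ≤ s → w s ≤ c * s ^ (p - 2))
    (heq : ∀ s, a ≤ s → s ≤ b → w s = p * (p - 1) * s ^ (p - 2)) {r : ℝ} (har : a ≤ r)
    (hrb : r ≤ b) :
    |entropy w r - r ^ p| ≤ (2 * (c / (p - 1)) + 2 * p) * (a ^ (p - 1) * r) := by
  have hr : 0 < r := ha.trans_le har
  have hw1 : Continuous fun s => s * w s := by fun_prop
  have eD : entropyDeriv w r = entropyDeriv w a + p * (r ^ (p - 1) - a ^ (p - 1)) := by
    rw [entropyDeriv, entropyDeriv, ← intervalIntegral.integral_add_adjacent_intervals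
      (hw.intervalIntegrable 0 a) (hw.intervalIntegrable a r)]
    congr 1
    rw [intervalIntegral.integral_congr (g := fun s => p * (p - 1) * s ^ (p - 2)) fun s hs => by
      rw [Set.uIcc_of_le har] at hs
      exact heq s hs.1 (hs.2.trans hrb), intervalIntegral.integral_const_mul,
      integral_rpow (Or.inl (by linarith)), show p - 2 + 1 = p - 1 by ring]
    have : p - 1 ≠ 0 := by linarith
    field_simp
  have eF : entropyFlux w r = entropyFlux w a + (p - 1) * (r ^ p - a ^ p) := by
    rw [entropyFlux, entropyFlux, ← intervalIntegral.integral_add_adjacent_intervals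
      (hw1.intervalIntegrable 0 a) (hw1.intervalIntegrable a r)]
    congr 1
    rw [intervalIntegral.integral_congr (g := fun s => p * (p - 1) * s ^ (p - 1)) fun s hs => by
      rw [Set.uIcc_of_le har] at hs
      have hs0 : 0 < s := ha.trans_le hs.1
      beta_reduce
      rw [heq s hs.1 (hs.2.trans hrb), show p - 1 = p - 2 + 1 by ring, Real.rpow_add_one hs0.ne']
      ring, intervalIntegral.integral_const_mul,
      integral_rpow (Or.inl (by linarith)), show p - 1 + 1 = p by ring]
    have : p ≠ 0 := by linarith
    field_simp
  have rp : r ^ p = r ^ (p - 1) * r := by rw [← Real.rpow_add_one hr.ne', sub_add_cancel]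
  have ap : a ^ p = a ^ (p - 1) * a := by rw [← Real.rpow_add_one ha.ne', sub_add_cancel]
  have D0 := entropyDeriv_nonneg h0 ha.le
  have D1 := entropyDeriv_le_of_le_rpow hw hp hle ha.le
  have F0 := entropyFlux_nonneg h0 ha.le
  have F1 : entropyFlux w a ≤ a * entropyDeriv w a := by
    have := entropy_nonneg hw h0 a
    rw [entropy] at this
    linarith
  set x := a ^ (p - 1)
  have hx : 0 ≤ x := Real.rpow_nonneg ha.le _
  set y := r ^ (p - 1)
  set d := entropyDeriv w a
  set k := c / (p - 1)
  have e : entropy w r - r ^ p = r * d - p * x * r - entropyFlux w a + (p - 1) * (x * a) := by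
    rw [entropy, eD, eF, rp, ap]
    ring
  have hkx : 0 ≤ k * x := D0.trans D1
  have q1 : r * d ≤ r * (k * x) := mul_le_mul_of_nonneg_left D1 hr.le
  have q2 : a * d ≤ r * (k * x) :=
    (mul_le_mul_of_nonneg_right har D0).trans q1
  have q3 : x * a ≤ x * r := mul_le_mul_of_nonneg_left har hx
  have q4 : 0 ≤ x * a := mul_nonneg hx ha.le
  have q5 := mul_le_mul_of_nonneg_left q3 (by linarith : 0 ≤ p - 1)
  have q6 : 0 ≤ r * d := mul_nonneg hr.le D0
  have q7 : 0 ≤ (p - 1) * (x * a) := mul_nonneg (by linarith) q4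
  have q8 : 0 ≤ x * r := mul_nonneg hx hr.le
  have q9 : 0 ≤ p * (x * r) := mul_nonneg (by linarith) q8
  have q10 : 0 ≤ r * (k * x) := mul_nonneg hr.le hkx
  rw [e, abs_le]
  constructor <;> linarith

set_option maxHeartbeats 1000000 in
/-- Power truncations exist at every level. With `G` cut off at `1 / n` and `2 n`, the identities
for pure powers hold for `G`, `w` on `[2 / n, 2 n]` and for `H`, cut off at `2 / n` and `n`, on
`[4 / n, n]`. Outside of these ranges `r ^ p` itself is bounded by the truncation error, except in
`sq_mul_weight_le`, where monotonicity of the entropy covers the range `[2 n, 4 n]`. -/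
theorem exists_isPowerTruncation {p : ℝ} (hp : 1 < p) : ∃ C : ℝ, 0 ≤ C ∧ ∀ n : ℝ, 1 ≤ n →
    ∃ (B : ℝ) (G G' w H H' : ℝ → ℝ), IsPowerTruncation p n C B G G' w H H' := by
  obtain ⟨M, hM0, hM⟩ := exists_abs_mul_deriv_unitStep_le
  have hp0 : 0 < p := one_pos.trans hp
  have hp1 : 0 < p - 1 := sub_pos.2 hp
  set c₁ := 4 * (p - 1) / p * (p / 2 + 2 * M) ^ 2 with hc1
  have c1_nonneg : 0 ≤ c₁ := by positivity
  set A : ℝ := 4 ^ (p - 1) with hA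
  have A2 : (2 : ℝ) ^ (p - 1) ≤ A := Real.rpow_le_rpow (by norm_num) (by norm_num) hp1.le
  set c₂ := p * (p - 1) + (p - 1) * (p + 2 * M) with hc2
  have c2_nonneg : 0 ≤ c₂ := by positivity
  set cm := (2 * (c₁ / (p - 1)) + 2 * p) * A with hcm
  have cm_nonneg : 0 ≤ cm := by positivity
  set C := c₁ * A + p * (p - 1) * (1 + cm) + c₁ * 2 ^ p * (1 + cm) + c₂ ^ 2 / (p * (p - 1)) * A
    + cm + (c₁ / (p - 1) + 1) * A + A with hC
  have t1 : 0 ≤ c₁ * A := by positivity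
  have t2 : 0 ≤ p * (p - 1) * (1 + cm) := by positivity
  have t3 : 0 ≤ c₁ * 2 ^ p * (1 + cm) := by positivity
  have t4 : 0 ≤ c₂ ^ 2 / (p * (p - 1)) * A := by positivity
  have t6 : 0 ≤ (c₁ / (p - 1) + 1) * A := by positivity
  have t7 : 0 ≤ A := by positivity
  refine ⟨C, by positivity, fun n hn => ?_⟩
  have hn0 : 0 < n := one_pos.trans_le hn
  have ha : 0 < 1 / n := by positivity
  have ha2 : 0 < 2 / n := by positivity
  have h2n : 0 < 2 * n := by positivity
  have e2a : 2 * (1 / n) = 2 / n := by ring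
  have e4a : 2 * (2 / n) = 4 / n := by ring
  have h2le : 2 / n ≤ 2 * n := by
    rw [div_le_iff₀ hn0]; nlinarith
  set G := truncPow (p / 2) (1 / n) (2 * n) with hG
  set G' := truncPowDeriv (p / 2) (1 / n) (2 * n) with hG'
  set w : ℝ → ℝ := fun r => 4 * (p - 1) / p * G' r ^ 2 with hw
  set H : ℝ → ℝ := fun r => (p - 1) * truncPow p (2 / n) n r with hH
  set H' : ℝ → ℝ := fun r => (p - 1) * truncPowDeriv p (2 / n) n r with hH'
  have cG : Continuous G := continuous_truncPow ha
  have cG' : Continuous G' := continuous_truncPowDeriv ha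
  have cw : Continuous w := by fun_prop
  have cH : Continuous H := continuous_const.mul (continuous_truncPow ha2)
  have cH' : Continuous H' := continuous_const.mul (continuous_truncPowDeriv ha2)
  have w0 : ∀ r, 0 ≤ w r := fun r => by
    have : 0 ≤ 4 * (p - 1) / p := by positivity
    exact mul_nonneg this (sq_nonneg _)
  have G0 : ∀ r, 0 ≤ G r := fun r => truncPow_nonneg ha
  have H0 : ∀ r, 0 ≤ H r := fun r => mul_nonneg hp1.le (truncPow_nonneg ha2)
  have wsmall : ∀ r ≤ 1 / n, w r = 0 := fun r hr => by
    simp only [hw, hG', (truncPow_of_le ha hr).2]; simp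
  have wlarge : ∀ r, 4 * n ≤ r → w r = 0 := fun r hr => by
    simp only [hw, hG', (truncPow_of_ge h2n (by linarith)).2]; simp
  have hwi : Integrable w := by
    refine cw.integrable_of_hasCompactSupport (HasCompactSupport.intro
      (isCompact_Icc (a := 1 / n) (b := 4 * n)) fun r hr => ?_)
    rw [Set.mem_Icc, not_and_or, not_le, not_le] at hr
    exact hr.elim (fun h => wsmall r h.le) fun h => wlarge r h.le
  have wle : ∀ r, 0 ≤ r → w r ≤ c₁ * r ^ (p - 2) := fun r hr => by
    have h1 := abs_truncPowDeriv_le (a := 1 / n) (b := 2 * n) hM (q := p / 2) (by positivity) hr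
    have h2 : G' r ^ 2 ≤ ((p / 2 + 2 * M) * r ^ (p / 2 - 1)) ^ 2 := by
      rw [← sq_abs]
      exact pow_le_pow_left₀ (abs_nonneg _) h1 2
    have e : (r ^ (p / 2 - 1)) ^ 2 = r ^ (p - 2) := by
      rw [← Real.rpow_natCast, ← Real.rpow_mul hr]
      congr 1
      push_cast
      ring
    rw [mul_pow, e] at h2
    calc w r ≤ 4 * (p - 1) / p * ((p / 2 + 2 * M) ^ 2 * r ^ (p - 2)) := by
          simp only [hw]; gcongr
      _ = _ := by rw [hc1]; ring
  have r2w : ∀ r, 0 ≤ r → r ^ 2 * w r ≤ c₁ * r ^ p := fun r hr => by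
    rcases hr.eq_or_lt with rfl | hr'
    · simp [Real.zero_rpow hp0.ne']
    · have e : r ^ p = r ^ 2 * r ^ (p - 2) := by
        rw [← Real.rpow_natCast, ← Real.rpow_add hr']
        congr 1
        push_cast
        ring
      rw [e]
      have := mul_le_mul_of_nonneg_left (wle r hr) (sq_nonneg r)
      linarith
  -- On this range the truncation is exact, as `(4 (p - 1) / p) (p / 2) ^ 2 = p (p - 1)`.
  have wmid : ∀ r, 2 / n ≤ r → r ≤ 2 * n → w r = p * (p - 1) * r ^ (p - 2) := fun r h1 h2 => by
    have hr : 0 < r := ha2.trans_le h1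
    have e : (r ^ (p / 2 - 1)) ^ 2 = r ^ (p - 2) := by
      rw [← Real.rpow_natCast, ← Real.rpow_mul hr.le]
      congr 1
      push_cast
      ring
    simp only [hw, hG', (truncPow_of_mem (q := p / 2) ha h2n (by linarith) h2).2]
    rw [mul_pow, e]
    field_simp
    ring
  have Gmid : ∀ r, 2 / n ≤ r → r ≤ 2 * n → G r = r ^ (p / 2) := fun r h1 h2 =>
    (truncPow_of_mem ha h2n (by linarith) h2).1
  have Hout : ∀ r, r ≤ 2 / n ∨ 2 * n ≤ r → H r = 0 ∧ H' r = 0 := by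
    rintro r (h | h)
    · simp [hH, hH', truncPow_of_le (q := p) (b := n) ha2 h]
    · simp [hH, hH', truncPow_of_ge (q := p) (a := 2 / n) hn0 h]
  have Hle : ∀ r, 0 ≤ r → H r ≤ (p - 1) * r ^ p := fun r hr =>
    mul_le_mul_of_nonneg_left (truncPow_le hr) hp1.le
  have hr2 : ∀ r, 0 ≤ r → 0 ≤ n ^ (1 - p) * r := fun r hr =>
    mul_nonneg (Real.rpow_nonneg hn0.le _) hr
  have hE : ∀ r, 0 ≤ r → n ^ (1 - p) * r ≤ powerError p n r := fun r hr => by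
    rw [powerError]
    refine le_add_of_nonneg_right ?_
    split_ifs
    · exact Real.rpow_nonneg hr _
    · exact le_rfl
  have jmid : ∀ r, 2 / n ≤ r → r ≤ 2 * n → |entropy w r - r ^ p| ≤ cm * (n ^ (1 - p) * r) :=
    fun r h1 h2 => by
      have h3 := abs_entropy_sub_rpow_le cw w0 hp ha2 wle wmid h1 h2
      have hr := ha2.le.trans h1
      have e : (2 / n) ^ (p - 1) = 2 ^ (p - 1) * n ^ (1 - p) := by
        rw [Real.div_rpow zero_le_two hn0.le, show 1 - p = -(p - 1) by ring,
          Real.rpow_neg hn0.le]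
        field_simp
      rw [e] at h3
      refine h3.trans ?_
      rw [hcm, mul_assoc, mul_assoc]
      have := hr2 r hr
      gcongr
  have jle : ∀ r, 0 ≤ r → entropy w r ≤ c₁ / (p - 1) * r ^ p := fun r hr => by
    rcases hr.eq_or_lt with rfl | hr'
    · simp [entropy_zero, Real.zero_rpow hp0.ne']
    · have h1 := entropyDeriv_le_of_le_rpow cw hp wle hr
      have h2 := entropyFlux_nonneg w0 hr
      have rp : r ^ p = r ^ (p - 1) * r := by rw [← Real.rpow_add_one hr'.ne', sub_add_cancel]
      have h3 := mul_le_mul_of_nonneg_left h1 hr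
      rw [entropy, rp]
      linarith
  obtain ⟨B₁, hB1, hB1'⟩ := exists_abs_le_mul_abs cH ha2 (fun r hr => (Hout r (Or.inl hr)).1)
    (fun r hr => (Hout r (Or.inr hr)).1)
  have crH : Continuous fun r => r * H r := continuous_id.mul cH
  have cG2 : Continuous fun r => G r ^ 2 := cG.pow 2
  have Gout : ∀ r, r ≤ 1 / n ∨ 4 * n ≤ r → G r ^ 2 = 0 := by
    rintro r (h | h)
    · rw [hG, (truncPow_of_le ha h).1, zero_pow two_ne_zero]
    · rw [hG, (truncPow_of_ge h2n (by linarith)).1, zero_pow two_ne_zero]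
  obtain ⟨B₂, hB2, hB2'⟩ := exists_abs_le_mul_abs crH ha2
    (fun r hr => by rw [(Hout r (Or.inl hr)).1, mul_zero])
    (fun r hr => by rw [(Hout r (Or.inr hr)).1, mul_zero])
  obtain ⟨B₃, hB3, hB3'⟩ := exists_abs_le_mul_abs cG2 ha
    (fun r hr => Gout r (Or.inl hr)) (fun r hr => Gout r (Or.inr hr))
  set W := ∫ s, |w s| with hWdef
  have hW0 : 0 ≤ W := integral_nonneg fun _ => abs_nonneg _
  have hWB : W ≤ W + B₁ + B₂ + B₃ := by linarith
  refine ⟨W + B₁ + B₂ + B₃, G, G', w, H, H', ?_⟩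
  have absr : ∀ r : ℝ, 0 ≤ |r| := abs_nonneg
  refine
    { hasDerivAt := hasDerivAt_truncPow ha
      continuous_deriv := cG'
      weight_eq := fun r => rfl
      linear_zero := ?_
      linear := ?_
      entropy_nonneg := entropy_nonneg cw w0
      sq_mul_weight_le := ?_
      sq_sub_le := ?_
      abs_entropy_sub_le := ?_
      rpow_le := ?_
      mul_flux_le_rpow := ?_
      mul_flux_le := ?_
      nonneg := G0
      le_rpow := fun r hr => truncPow_le hr
      sq_le := ?_
      mul_flux_le_linear := ?_
      flux_nonneg := H0 }
  · refine ⟨hasDerivAt_entropy cw, hasDerivAt_entropyDeriv cw, cw, w0,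
      fun r => hasDerivAt_const _ _, continuous_const,
      fun r => (abs_entropyDeriv_le hwi r).trans hWB,
      fun r => (abs_entropy_le cw hwi r).trans (mul_le_mul_of_nonneg_right hWB (absr r)),
      fun r => ?_⟩
    rw [sub_zero, abs_mul]
    exact mul_le_mul_of_nonneg_right ((abs_entropyDeriv_le hwi r).trans hWB) (absr r)
  · refine ⟨hasDerivAt_entropy cw, hasDerivAt_entropyDeriv cw, cw, w0,
      fun r => (hasDerivAt_truncPow ha2 r).const_mul _, cH',
      fun r => (abs_entropyDeriv_le hwi r).trans hWB,
      fun r => (abs_entropy_le cw hwi r).trans (mul_le_mul_of_nonneg_right hWB (absr r)),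
      fun r => ?_⟩
    refine (abs_sub _ _).trans ?_
    rw [abs_mul]
    have k1 := mul_le_mul_of_nonneg_right (abs_entropyDeriv_le hwi r) (absr r)
    have k2 := hB1' r
    have k3 := mul_nonneg hB2 (absr r)
    have k4 := mul_nonneg hB3 (absr r)
    linarith
  · intro r hr
    have hj := entropy_nonneg cw w0 r
    have hx := hr2 r hr
    have hsum : 0 ≤ entropy w r + n ^ (1 - p) * r := add_nonneg hj hx
    have weak : ∀ c, c ≤ C → c * (entropy w r + n ^ (1 - p) * r) ≤
        C * (entropy w r + n ^ (1 - p) * r) := fun c hc => mul_le_mul_of_nonneg_right hc hsum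
    rcases le_total r (2 / n) with h1 | h1
    · refine le_trans ?_ (weak (c₁ * A) (by linarith))
      have h2 := rpow_le_of_le_div hp hn0 hr zero_le_two h1
      calc r ^ 2 * w r ≤ c₁ * r ^ p := r2w r hr
        _ ≤ c₁ * (2 ^ (p - 1) * (n ^ (1 - p) * r)) := by gcongr
        _ ≤ c₁ * (A * (entropy w r + n ^ (1 - p) * r)) := by gcongr; linarith
        _ = _ := by ring
    rcases le_total r (2 * n) with h2 | h2
    · refine le_trans ?_ (weak (p * (p - 1) * (1 + cm)) (by linarith))
      have hr' : 0 < r := ha2.trans_le h1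
      have e : r ^ p = r ^ 2 * r ^ (p - 2) := by
        rw [← Real.rpow_natCast, ← Real.rpow_add hr']
        congr 1
        push_cast
        ring
      have h3 := (abs_le.1 (jmid r h1 h2)).1
      have h4 : r ^ p ≤ (1 + cm) * (entropy w r + n ^ (1 - p) * r) := by
        have := mul_nonneg cm_nonneg hj
        linarith
      rw [wmid r h1 h2]
      calc _ = p * (p - 1) * r ^ p := by rw [e]; ring
        _ ≤ p * (p - 1) * ((1 + cm) * (entropy w r + n ^ (1 - p) * r)) := by gcongr
        _ = _ := by ring
    rcases le_total (4 * n) r with h3 | h3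
    · rw [wlarge r h3, mul_zero]
      exact mul_nonneg (by positivity) hsum
    · refine le_trans ?_ (weak (c₁ * 2 ^ p * (1 + cm)) (by linarith))
      have h4 := (abs_le.1 (jmid (2 * n) h2le le_rfl)).1
      have h5 : entropy w (2 * n) ≤ entropy w r :=
        monotoneOn_entropy cw w0 (Set.mem_Ici.2 h2n.le) (Set.mem_Ici.2 hr) h2
      have h6 : n ^ (1 - p) * (2 * n) ≤ n ^ (1 - p) * r :=
        mul_le_mul_of_nonneg_left h2 (Real.rpow_nonneg hn0.le _)
      have h7 : (2 * n) ^ p ≤ (1 + cm) * (entropy w r + n ^ (1 - p) * r) := by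
        have := mul_nonneg cm_nonneg hj
        have := mul_le_mul_of_nonneg_left h6 cm_nonneg
        linarith
      have h8 : r ^ p ≤ 2 ^ p * (2 * n) ^ p := by
        rw [← Real.mul_rpow zero_le_two h2n.le]
        exact Real.rpow_le_rpow hr (by linarith) hp0.le
      calc r ^ 2 * w r ≤ c₁ * r ^ p := r2w r hr
        _ ≤ c₁ * (2 ^ p * (2 * n) ^ p) := by gcongr
        _ ≤ c₁ * (2 ^ p * ((1 + cm) * (entropy w r + n ^ (1 - p) * r))) := by gcongr
        _ = _ := by ring
  · intro r hr
    have hpe := powerError_nonneg (p := p) hn0.le hr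
    have weak : ∀ c, c ≤ C → w r * (c * powerError p n r) ≤ w r * (C * powerError p n r) :=
      fun c hc => mul_le_mul_of_nonneg_left (mul_le_mul_of_nonneg_right hc hpe) (w0 r)
    by_cases hout : r ≤ 2 / n ∨ 2 * n ≤ r
    · refine le_trans ?_ (weak (c₁ * A) (by linarith))
      have h4 : r ≤ 4 / n ∨ n < r := hout.imp (fun h => h.trans (by gcongr; norm_num))
        fun h => by linarith
      rw [(Hout r hout).2, sub_zero]
      calc (r * w r) ^ 2 = w r * (r ^ 2 * w r) := by ring
        _ ≤ w r * (c₁ * (A * powerError p n r)) :=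
          mul_le_mul_of_nonneg_left ((r2w r hr).trans (mul_le_mul_of_nonneg_left
            (rpow_le_powerError hp hn0 hr h4) c1_nonneg)) (w0 r)
        _ = _ := by ring
    rw [not_or, not_le, not_le] at hout
    obtain ⟨h1, h2⟩ := hout
    have hr' : 0 < r := ha2.trans h1
    have e1 : r ^ (p - 1) = r ^ (p - 2) * r := by
      rw [← Real.rpow_add_one hr'.ne']; congr 1; ring
    have e2 : r ^ p = r ^ (p - 2) * r * r := by
      rw [← e1, ← Real.rpow_add_one hr'.ne', sub_add_cancel]
    by_cases hin : 4 / n ≤ r ∧ r ≤ n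
    · have h5 := (truncPow_of_mem (q := p) ha2 hn0 (by linarith [hin.1]) hin.2).2
      have : r * w r - H' r = 0 := by
        rw [wmid r h1.le h2.le]
        simp only [hH', h5, e1]
        ring
      rw [this]
      have := mul_nonneg (w0 r) (mul_nonneg (by positivity : 0 ≤ C) hpe)
      simpa using this
    · refine le_trans ?_ (weak (c₂ ^ 2 / (p * (p - 1)) * A) (by linarith))
      have h4 : r ≤ 4 / n ∨ n < r := by
        rw [not_and_or, not_le, not_le] at hin
        exact hin.imp le_of_lt id
      have h5 := abs_truncPowDeriv_le (a := 2 / n) (b := n) hM (q := p) hp0.le hr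
      have h6 : |r * w r - H' r| ≤ c₂ * r ^ (p - 1) := by
        refine (abs_sub _ _).trans ?_
        have k1 : |r * w r| = p * (p - 1) * r ^ (p - 1) := by
          rw [abs_of_nonneg (mul_nonneg hr (w0 r)), wmid r h1.le h2.le, e1]
          ring
        have k2 : |H' r| ≤ (p - 1) * ((p + 2 * M) * r ^ (p - 1)) := by
          simp only [hH', abs_mul, abs_of_pos hp1]
          gcongr
        rw [k1, hc2]
        linarith
      calc (r * w r - H' r) ^ 2 ≤ (c₂ * r ^ (p - 1)) ^ 2 := by
            rw [← sq_abs]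
            exact pow_le_pow_left₀ (abs_nonneg _) h6 2
        _ = w r * (c₂ ^ 2 / (p * (p - 1)) * r ^ p) := by
            rw [wmid r h1.le h2.le, e1, e2]
            field_simp
        _ ≤ w r * (c₂ ^ 2 / (p * (p - 1)) * (A * powerError p n r)) :=
            mul_le_mul_of_nonneg_left (mul_le_mul_of_nonneg_left
              (rpow_le_powerError hp hn0 hr h4) (by positivity)) (w0 r)
        _ = _ := by ring
  · intro r hr
    have hpe := powerError_nonneg (p := p) hn0.le hr
    have weak : ∀ c, c ≤ C → c * powerError p n r ≤ C * powerError p n r :=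
      fun c hc => mul_le_mul_of_nonneg_right hc hpe
    by_cases hmid : 2 / n ≤ r ∧ r ≤ 2 * n
    · refine le_trans ((jmid r hmid.1 hmid.2).trans ?_) (weak cm (by linarith))
      exact mul_le_mul_of_nonneg_left (hE r hr) cm_nonneg
    · refine le_trans ?_ (weak ((c₁ / (p - 1) + 1) * A) (by linarith))
      have h4 : r ≤ 4 / n ∨ n < r := by
        rw [not_and_or, not_le, not_le] at hmid
        exact hmid.imp (fun h => h.le.trans (by gcongr; norm_num)) fun h => by linarith
      have h5 := jle r hr
      have h6 := entropy_nonneg cw w0 r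
      have h7 := Real.rpow_nonneg hr p
      have h8 := mul_nonneg (div_nonneg c1_nonneg hp1.le) h7
      calc |entropy w r - r ^ p| ≤ (c₁ / (p - 1) + 1) * r ^ p := by
            rw [abs_le]; constructor <;> linarith
        _ ≤ (c₁ / (p - 1) + 1) * (A * powerError p n r) :=
            mul_le_mul_of_nonneg_left (rpow_le_powerError hp hn0 hr h4) (by positivity)
        _ = _ := by ring
  · intro r hr
    have hpe := powerError_nonneg (p := p) hn0.le hr
    have weak : ∀ c, c ≤ C → c * powerError p n r ≤ C * powerError p n r :=
      fun c hc => mul_le_mul_of_nonneg_right hc hpe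
    by_cases hmid : 2 / n ≤ r ∧ r ≤ 2 * n
    · have e : r ^ p = G r ^ 2 := by
        rw [Gmid r hmid.1 hmid.2, ← Real.rpow_natCast, ← Real.rpow_mul hr]
        congr 1
        push_cast
        ring
      rw [e]
      exact le_add_of_nonneg_right (mul_nonneg (by positivity) hpe)
    · have h4 : r ≤ 4 / n ∨ n < r := by
        rw [not_and_or, not_le, not_le] at hmid
        exact hmid.imp (fun h => h.le.trans (by gcongr; norm_num)) fun h => by linarith
      have h5 := (rpow_le_powerError hp hn0 hr h4).trans (weak A (by linarith))
      linarith [sq_nonneg (G r)]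
  · intro r
    by_cases hout : r ≤ 2 / n ∨ 2 * n ≤ r
    · rw [(Hout r hout).1, mul_zero]
      exact mul_nonneg hp1.le (Real.rpow_nonneg (G0 r) _)
    · rw [not_or, not_le, not_le] at hout
      have hr : 0 < r := ha2.trans hout.1
      have e : G r ^ (2 + 2 / p) = r * r ^ p := by
        rw [Gmid r hout.1.le hout.2.le, ← Real.rpow_mul hr.le, mul_comm r,
          ← Real.rpow_add_one hr.ne']
        congr 1
        field_simp
      rw [e]
      have := mul_le_mul_of_nonneg_left (Hle r hr.le) hr.le
      linarith
  · intro r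
    by_cases hout : r ≤ 2 / n ∨ 2 * n ≤ r
    · rw [(Hout r hout).1, mul_zero]
      rcases le_total 0 r with hr | hr
      · positivity
      · rw [hG, (truncPow_of_le ha (hr.trans ha.le)).1]
        simp
    · rw [not_or, not_le, not_le] at hout
      have hr : 0 < r := ha2.trans hout.1
      have e : G r ^ 2 = r ^ p := by
        rw [Gmid r hout.1.le hout.2.le, ← Real.rpow_natCast, ← Real.rpow_mul hr.le]
        congr 1
        push_cast
        ring
      rw [e]
      have := mul_le_mul_of_nonneg_left (Hle r hr.le) hr.le
      linarith
  · intro r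
    have k1 := (le_abs_self _).trans (hB3' r)
    have k2 := mul_nonneg hB1 (absr r)
    have k3 := mul_nonneg hB2 (absr r)
    have k4 := mul_nonneg hW0 (absr r)
    linarith
  · intro r
    have k1 := (le_abs_self _).trans (hB2' r)
    have k2 := mul_nonneg hB1 (absr r)
    have k3 := mul_nonneg hB3 (absr r)
    have k4 := mul_nonneg hW0 (absr r)
    linarith

/-! ### Propagation of integrability -/

theorem powerError_le {p n r : ℝ} (hr : 0 ≤ r) : powerError p n r ≤ n ^ (1 - p) * r + r ^ p := by
  unfold powerError
  split_ifs
  · exact le_rfl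
  · simpa using Real.rpow_nonneg hr p

theorem measurable_powerError (p n : ℝ) : Measurable (powerError p n) := by
  refine (measurable_id.const_mul _).add (Measurable.ite measurableSet_Ioi ?_ measurable_const)
  exact measurable_id.pow_const p

theorem tendsto_rpow_one_sub {p : ℝ} (hp : 1 < p) :
    Tendsto (fun k : ℕ => ((k : ℝ) + 1) ^ (1 - p)) atTop (𝓝 0) := by
  have h1 : Tendsto (fun k : ℕ => (k : ℝ) + 1) atTop atTop :=
    tendsto_atTop_add_const_right _ _ tendsto_natCast_atTop_atTop
  have := (tendsto_rpow_neg_atTop (sub_pos.2 hp)).comp h1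
  rw [neg_sub] at this
  exact this

theorem tendsto_powerError {p : ℝ} (hp : 1 < p) (r : ℝ) :
    Tendsto (fun k : ℕ => powerError p ((k : ℝ) + 1) r) atTop (𝓝 0) := by
  have h1 := (tendsto_rpow_one_sub hp).mul_const r
  rw [zero_mul] at h1
  refine h1.congr' ?_
  filter_upwards [eventually_ge_atTop ⌈r⌉₊] with k hk
  have h2 : ¬ ((k : ℝ) + 1 < r) := by
    have : r ≤ k := (Nat.le_ceil r).trans (by exact_mod_cast hk)
    linarith
  rw [powerError, if_neg h2, add_zero]

section powerError

variable {α : Type*} [MeasurableSpace α] {μ : Measure α} {f : α → ℝ} {p : ℝ}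

theorem integrable_powerError (hf : Integrable f μ) (h0 : ∀ᵐ z ∂μ, 0 ≤ f z)
    (hfp : Integrable (fun z => f z ^ p) μ) {n : ℝ} (hn : 0 ≤ n) :
    Integrable (fun z => powerError p n (f z)) μ := by
  refine ((hf.const_mul (n ^ (1 - p))).add hfp).mono'
    ((measurable_powerError p n).comp_aemeasurable hf.aemeasurable).aestronglyMeasurable ?_
  filter_upwards [h0] with z hz
  rw [Real.norm_eq_abs, abs_of_nonneg (powerError_nonneg hn hz)]
  exact powerError_le hz

theorem integral_powerError_le (hf : Integrable f μ) (h0 : ∀ᵐ z ∂μ, 0 ≤ f z)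
    (hfp : Integrable (fun z => f z ^ p) μ) {n : ℝ} (hn : 1 ≤ n) (hp : 1 ≤ p) :
    ∫ z, powerError p n (f z) ∂μ ≤ (∫ z, f z ∂μ) + ∫ z, f z ^ p ∂μ := by
  rw [← integral_add hf hfp]
  refine integral_mono_ae (integrable_powerError hf h0 hfp (zero_le_one.trans hn))
    (hf.add hfp) ?_
  filter_upwards [h0] with z hz
  refine (powerError_le hz).trans (add_le_add_left ?_ _)
  exact mul_le_of_le_one_left hz (Real.rpow_le_one_of_one_le_of_nonpos hn (by linarith))

theorem tendsto_integral_powerError (hf : Integrable f μ) (h0 : ∀ᵐ z ∂μ, 0 ≤ f z)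
    (hfp : Integrable (fun z => f z ^ p) μ) (hp : 1 < p) :
    Tendsto (fun k : ℕ => ∫ z, powerError p ((k : ℝ) + 1) (f z) ∂μ) atTop (𝓝 0) := by
  have h1 : ∀ k : ℕ, (1 : ℝ) ≤ (k : ℝ) + 1 := fun k => by
    have := k.cast_nonneg (α := ℝ); linarith
  have := tendsto_integral_filter_of_dominated_convergence (μ := μ) (l := atTop) (f := fun _ => 0)
    (F := fun (k : ℕ) z => powerError p ((k : ℝ) + 1) (f z)) (fun z => f z + f z ^ p)
    (Eventually.of_forall fun k =>
      (integrable_powerError hf h0 hfp (zero_le_one.trans (h1 k))).aestronglyMeasurable)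
    (Eventually.of_forall fun k => ?_) (hf.add hfp)
    (Eventually.of_forall fun z => tendsto_powerError hp (f z))
  · simpa using this
  · filter_upwards [h0] with z hz
    rw [Real.norm_eq_abs, abs_of_nonneg (powerError_nonneg (zero_le_one.trans (h1 k)) hz)]
    refine (powerError_le hz).trans (add_le_add_left ?_ _)
    exact mul_le_of_le_one_left hz (Real.rpow_le_one_of_one_le_of_nonpos (h1 k) (by linarith))

end powerError

namespace IsPowerTruncation

variable {p n C B : ℝ} {G G' w H H' : ℝ → ℝ}

theorem continuous_weight (hG : IsPowerTruncation p n C B G G' w H H') : Continuous w :=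
  hG.linear.continuous

theorem continuous_entropy (hG : IsPowerTruncation p n C B G G' w H H') :
    Continuous (entropy w) :=
  continuous_iff_continuousAt.2 fun r => (hG.linear.hasDerivAt r).continuousAt

theorem bound_nonneg (hG : IsPowerTruncation p n C B G G' w H H') : 0 ≤ B :=
  (abs_nonneg _).trans (hG.linear.abs_deriv_le 0)

theorem integrable_entropy (hG : IsPowerTruncation p n C B G G' w H H') {α : Type*}
    [MeasurableSpace α] {μ : Measure α} {f : α → ℝ} (hf : Integrable f μ) :
    Integrable (fun z => entropy w (f z)) μ :=
  (hf.abs.const_mul B).mono' (hG.continuous_entropy.comp_aestronglyMeasurable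
    hf.aestronglyMeasurable) (Eventually.of_forall fun _ => hG.linear.abs_le _)

theorem abs_integral_entropy_sub_le (hG : IsPowerTruncation p n C B G G' w H H') {α : Type*}
    [MeasurableSpace α] {μ : Measure α} {f : α → ℝ} (hn : 0 ≤ n) (hf : Integrable f μ)
    (h0 : ∀ᵐ z ∂μ, 0 ≤ f z) (hfp : Integrable (fun z => f z ^ p) μ) :
    |(∫ z, entropy w (f z) ∂μ) - ∫ z, f z ^ p ∂μ| ≤ C * ∫ z, powerError p n (f z) ∂μ := by
  rw [← integral_sub (hG.integrable_entropy hf) hfp, ← integral_const_mul]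
  refine (abs_integral_le_integral_abs).trans (integral_mono_ae
    ((hG.integrable_entropy hf).sub hfp).abs
    ((integrable_powerError hf h0 hfp hn).const_mul C) ?_)
  filter_upwards [h0] with z hz using hG.abs_entropy_sub_le _ hz

end IsPowerTruncation

namespace IsSmoothSolution

variable {D : ℝ} {T : EReal} {ρ₀ : ℝ × ℝ → ℝ} {ρ : ℝ → ℝ × ℝ → ℝ}

/-- Membership of the datum in `L^p` is propagated, with a bound that may grow in time. Dropping the
quadratic term from the flux, the drift contributes at most a multiple of the entropy itself. -/
theorem exists_integral_rpow_le (hD : 0 < D) (h : IsSmoothSolution D T ρ₀ ρ) {p : ℝ} (hp : 1 < p)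
    (hint : Integrable fun z => ρ₀ z ^ p) {τ : ℝ} (hτ : (τ : EReal) < T) :
    ∃ N : ℝ, ∀ t, 0 ≤ t → t ≤ τ →
      Integrable (fun z => ρ t z ^ p) ∧ ∫ z, ρ t z ^ p ≤ N := by
  obtain ⟨C, hC0, hC⟩ := exists_isPowerTruncation hp
  obtain ⟨K, C', hK0, hC'0, hK, hE⟩ := h.exists_deriv_entropy_le hD hτ
  have m0 : 0 ≤ ∫ z, ρ₀ z := integral_nonneg_of_ae h.nonneg_data
  set m := ∫ z, ρ₀ z
  have P0 : 0 ≤ ∫ z, ρ₀ z ^ p := integral_nonneg_of_ae (by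
    filter_upwards [h.nonneg_data] with z hz using Real.rpow_nonneg hz p)
  set P := ∫ z, ρ₀ z ^ p
  set a := K ^ 2 / (2 * 1 * D) * C + 1 with ha
  have a0 : 0 < a := by positivity
  set N := Real.exp (a * τ) * (P + C * (m + P) + m) with hN
  refine ⟨N, fun t ht htτ => ?_⟩
  have htT := lt_of_le htτ hτ
  have hn1 : ∀ k : ℕ, (1 : ℝ) ≤ (k : ℝ) + 1 := fun k => by
    have := k.cast_nonneg (α := ℝ); linarith
  choose B G G' w H H' hG using fun k : ℕ => hC ((k : ℝ) + 1) (hn1 k)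
  refine integrable_of_tendsto_of_integral_le (g := fun k z => entropy (w k) (ρ t z))
    (b := fun _ => N) (fun k => (hG k).integrable_entropy (h.integrable_slice ht htT))
    (fun k => Eventually.of_forall fun z => (hG k).entropy_nonneg _) ?_
    (Eventually.of_forall fun k => ?_) tendsto_const_nhds
  · filter_upwards [h.ae_nonneg hD ht htT] with z hz
    have l := (tendsto_powerError hp (ρ t z)).const_mul C
    rw [mul_zero] at l
    exact tendsto_iff_norm_sub_tendsto_zero.2
      (squeeze_zero (fun _ => norm_nonneg _) (fun k => (hG k).abs_entropy_sub_le _ hz) l)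
  have e1 : ((k : ℝ) + 1) ^ (1 - p) ≤ 1 :=
    Real.rpow_le_one_of_one_le_of_nonpos (hn1 k) (by linarith)
  have e0 : 0 ≤ ((k : ℝ) + 1) ^ (1 - p) := Real.rpow_nonneg (zero_le_one.trans (hn1 k)) _
  have gk := hG k
  set e := ((k : ℝ) + 1) ^ (1 - p)
  set wk := w k
  have hB0 := gk.bound_nonneg
  have key : ∀ R : ℝ, 1 ≤ R → (∫ z, entropy wk (ρ t z) * planeCutoff R z ^ 2) +
      (e * m + B k * C' / R / a) ≤ Real.exp (a * t) *
        ((∫ z, entropy wk (ρ 0 z) * planeCutoff R z ^ 2) + (e * m + B k * C' / R / a)) := by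
    intro R hR
    have hR0 : 0 < R := one_pos.trans_le hR
    obtain ⟨hc, hd⟩ := hE _ _ _ _ _ _ gk.linear_zero R hR
    have := sub_le_exp_mul_sub_of_deriv_le (l := -a) (b := -(e * m + B k * C' / R / a)) ht
      (hc.mono (Set.Icc_subset_Icc_right htτ))
      (fun r hr => (hd r hr.1 (hr.2.le.trans htτ)).1.hasDerivAt) fun r hr => by
        have hrτ := hr.2.le.trans htτ
        have hrT := lt_of_le hrτ hτ
        have cρ := (h.contDiff_slice hr.1 hrT).continuous
        have iρ := h.integrable_slice hr.1.le hrT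
        have cS : Continuous fun z => ρ r z ^ 2 * wk (ρ r z) :=
          (cρ.pow 2).mul (gk.continuous_weight.comp cρ)
        have cψ := (contDiff_planeCutoff_sq R (n := 0)).continuous
        have iS := integrable_mul_of_hasCompactSupport cS cψ (hasCompactSupport_planeCutoff_sq hR0)
        have h1 := (hd r hr.1 hrτ).2 1 (fun z => ρ r z ^ 2 * wk (ρ r z)) one_pos
          (fun z => mul_nonneg (sq_nonneg _) (gk.linear.nonneg _)) iS
          (fun z => le_of_eq (by ring))
        simp only [mul_zero, zero_mul, integral_zero, sub_self, zero_add] at h1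
        have iJ := integrable_mul_planeCutoff_sq (gk.integrable_entropy iρ) R
        have iM := integrable_mul_planeCutoff_sq iρ R
        have h2 : ∫ z, ρ r z ^ 2 * wk (ρ r z) * planeCutoff R z ^ 2 ≤
            C * ((∫ z, entropy wk (ρ r z) * planeCutoff R z ^ 2)
              + e * ∫ z, ρ r z * planeCutoff R z ^ 2) := by
          rw [← integral_const_mul, ← integral_add iJ (iM.const_mul e), ← integral_const_mul]
          refine integral_mono iS ((iJ.add (iM.const_mul e)).const_mul C) fun z => ?_
          have := mul_le_mul_of_nonneg_right (gk.sq_mul_weight_le _ (h.nonneg hD hr.1 hrT z))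
            (sq_nonneg (planeCutoff R z))
          refine this.trans (le_of_eq ?_)
          simp only [e]
          ring
        have h3 : ∫ z, ρ r z * planeCutoff R z ^ 2 ≤ m := by
          refine (integral_mono iM iρ fun z => ?_).trans (h.mass_eq hD hr.1.le hrT).le
          exact mul_le_of_le_one_right (h.nonneg hD hr.1 hrT z)
            (pow_le_one₀ (planeCutoff_nonneg R z) (planeCutoff_le_one R z))
        have hJ0 : 0 ≤ ∫ z, entropy wk (ρ r z) * planeCutoff R z ^ 2 :=
          integral_nonneg fun z => mul_nonneg (gk.entropy_nonneg _) (sq_nonneg _)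
        have h4 : (0 : ℝ) ≤ K ^ 2 / (2 * 1 * D) := by positivity
        have h5 := mul_le_mul_of_nonneg_left h3 e0
        have h6 := mul_le_mul_of_nonneg_left (h2.trans
          (mul_le_mul_of_nonneg_left (add_le_add_right h5 _) hC0)) h4
        have h7 : a * (B k * C' / R / a) = B k * C' / R := by field_simp
        have h8 : 0 ≤ e * m := mul_nonneg e0 m0
        rw [neg_neg, sub_neg_eq_add, mul_add a, mul_add a, h7, ha]
        linarith
    simpa only [sub_neg_eq_add, neg_neg, sub_zero] using this
  have htz : Tendsto (fun R : ℝ => B k * C' / R / a) atTop (𝓝 0) := by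
    simpa using (tendsto_const_nhds.div_atTop tendsto_id).div_const a
  have l1 := (tendsto_integral_mul_planeCutoff_sq
    (gk.integrable_entropy (h.integrable_slice ht htT))).add
      ((tendsto_const_nhds (x := e * m)).add htz)
  have i0 : Integrable (ρ 0) := by rw [h.initial]; exact h.integrable_data
  have l2 := ((tendsto_integral_mul_planeCutoff_sq (gk.integrable_entropy i0)).add
      ((tendsto_const_nhds (x := e * m)).add htz)).const_mul (Real.exp (a * t))
  have h1 := le_of_tendsto_of_tendsto l1 l2 (by
    filter_upwards [eventually_ge_atTop 1] with R hR using key R hR)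
  rw [h.initial, add_zero] at h1
  have h2 := (abs_le.1 (gk.abs_integral_entropy_sub_le (zero_le_one.trans (hn1 k))
    h.integrable_data h.nonneg_data hint)).2
  have h3 := integral_powerError_le h.integrable_data h.nonneg_data hint (hn1 k) hp.le
  have h4 := mul_le_mul_of_nonneg_left h3 hC0
  have h5 : e * m ≤ m := mul_le_of_le_one_left m0 e1
  have h6 : 0 ≤ e * m := mul_nonneg e0 m0
  have h7 : (∫ z, entropy wk (ρ₀ z)) + e * m ≤ P + C * (m + P) + m := by linarith
  have h8 := mul_le_mul_of_nonneg_left h7 (Real.exp_pos (a * t)).le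
  have h9 : Real.exp (a * t) * (P + C * (m + P) + m) ≤ N :=
    mul_le_mul_of_nonneg_right (Real.exp_le_exp.2 (by gcongr)) (by positivity)
  linarith

end IsSmoothSolution

/-! ### Entropy dissipation controls a Dirichlet energy -/

/-- The Dirichlet energy `∬ |∇f|²`. -/
noncomputable def dirichletEnergy (f : ℝ × ℝ → ℝ) : ℝ :=
  ∫ z, (partialX f z ^ 2 + partialY f z ^ 2)

theorem dirichletEnergy_nonneg (f : ℝ × ℝ → ℝ) : 0 ≤ dirichletEnergy f :=
  integral_nonneg fun _ => add_nonneg (sq_nonneg _) (sq_nonneg _)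

theorem partialX_comp_mul {G G' : ℝ → ℝ} (hG : ∀ r, HasDerivAt G (G' r) r) {f ψ : ℝ × ℝ → ℝ}
    (hf : ContDiff ℝ 1 f) (hψ : ContDiff ℝ 1 ψ) (z : ℝ × ℝ) :
    partialX (fun w => G (f w) * ψ w) z = G' (f z) * partialX f z * ψ z + G (f z) * partialX ψ z :=
  (((hG (f z)).comp z.1 (hf.hasDerivAt_partialX z)).mul (hψ.hasDerivAt_partialX z)).deriv

theorem partialY_comp_mul {G G' : ℝ → ℝ} (hG : ∀ r, HasDerivAt G (G' r) r) {f ψ : ℝ × ℝ → ℝ}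
    (hf : ContDiff ℝ 1 f) (hψ : ContDiff ℝ 1 ψ) (z : ℝ × ℝ) :
    partialY (fun w => G (f w) * ψ w) z = G' (f z) * partialY f z * ψ z + G (f z) * partialY ψ z :=
  partialX_comp_mul hG hf.comp_prodSwap hψ.comp_prodSwap z.swap

theorem contDiff_comp_mul {G G' : ℝ → ℝ} (hG : ∀ r, HasDerivAt G (G' r) r) (hG' : Continuous G')
    {f ψ : ℝ × ℝ → ℝ} (hf : ContDiff ℝ 1 f) (hψ : ContDiff ℝ 1 ψ) :
    ContDiff ℝ 1 (fun w => G (f w) * ψ w) := by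
  have h1 : ContDiff ℝ 1 G := by
    rw [contDiff_one_iff_deriv]
    refine ⟨fun r => (hG r).differentiableAt, ?_⟩
    rwa [show deriv G = G' from funext fun r => (hG r).deriv]
  exact (h1.comp hf).mul hψ

theorem sq_add_le_of_pos {δ : ℝ} (hδ : 0 < δ) (a b : ℝ) :
    (a + b) ^ 2 ≤ (1 + δ) * a ^ 2 + (1 + 1 / δ) * b ^ 2 := by
  have h : (1 + δ) * a ^ 2 + (1 + 1 / δ) * b ^ 2 - (a + b) ^ 2 = (δ * a - b) ^ 2 / δ := by
    field_simp
    ring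
  have := div_nonneg (sq_nonneg (δ * a - b)) hδ.le
  linarith

/-- The energy of a localized function `G(f) ψ`, up to errors from the gradient of `ψ`. -/
theorem dirichletEnergy_comp_mul_le {G G' : ℝ → ℝ} (hG : ∀ r, HasDerivAt G (G' r) r)
    (hG' : Continuous G') {f ψ : ℝ × ℝ → ℝ} (hf : ContDiff ℝ 1 f) (hψ : ContDiff ℝ 1 ψ)
    (hs : HasCompactSupport ψ) {δ B b : ℝ} (hδ : 0 < δ) (hB : ∀ r, G r ^ 2 ≤ B * |r|)
    (hi : Integrable f) (hx : ∀ z, |partialX ψ z| ≤ b) (hy : ∀ z, |partialY ψ z| ≤ b) :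
    dirichletEnergy (fun z => G (f z) * ψ z) ≤
      (1 + δ) * (∫ z, G' (f z) ^ 2 * (partialX f z ^ 2 + partialY f z ^ 2) * ψ z ^ 2)
      + (1 + 1 / δ) * (2 * b ^ 2 * B) * ∫ z, |f z| := by
  have cfx := hf.continuous_partialX
  have cfy := hf.continuous_partialY
  have cψ := hψ.continuous
  have cf := hf.continuous
  have cu := contDiff_comp_mul hG hG' hf hψ
  have su : HasCompactSupport (fun z => G (f z) * ψ z) := hs.mul_left
  have s2 : ∀ {g : ℝ × ℝ → ℝ}, HasCompactSupport g → HasCompactSupport fun z => g z ^ 2 :=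
    fun hg => hg.comp_left (g := fun r => r ^ 2) (by simp)
  have i1 : Integrable fun z => partialX (fun z => G (f z) * ψ z) z ^ 2
      + partialY (fun z => G (f z) * ψ z) z ^ 2 :=
    ((cu.continuous_partialX.pow 2).integrable_of_hasCompactSupport (s2 su.partialX)).add
      ((cu.continuous_partialY.pow 2).integrable_of_hasCompactSupport (s2 su.partialY))
  have i2 : Integrable fun z => G' (f z) ^ 2 * (partialX f z ^ 2 + partialY f z ^ 2) * ψ z ^ 2 :=
    integrable_mul_of_hasCompactSupport (by fun_prop) (by fun_prop) (s2 hs)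
  rw [dirichletEnergy, ← integral_const_mul, ← integral_const_mul,
    ← integral_add (i2.const_mul _) (hi.abs.const_mul _)]
  refine integral_mono i1 ((i2.const_mul _).add (hi.abs.const_mul _)) fun z => ?_
  simp only [partialX_comp_mul hG hf hψ, partialY_comp_mul hG hf hψ]
  have h1 := sq_add_le_of_pos hδ (G' (f z) * partialX f z * ψ z) (G (f z) * partialX ψ z)
  have h2 := sq_add_le_of_pos hδ (G' (f z) * partialY f z * ψ z) (G (f z) * partialY ψ z)
  have h3 : partialX ψ z ^ 2 ≤ b ^ 2 := sq_le_sq' (abs_le.1 (hx z)).1 (abs_le.1 (hx z)).2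
  have h4 : partialY ψ z ^ 2 ≤ b ^ 2 := sq_le_sq' (abs_le.1 (hy z)).1 (abs_le.1 (hy z)).2
  have h5 : G (f z) ^ 2 * (partialX ψ z ^ 2 + partialY ψ z ^ 2) ≤ B * |f z| * (2 * b ^ 2) :=
    mul_le_mul (hB _) (by linarith) (by positivity) ((sq_nonneg _).trans (hB _))
  have h6 : 0 ≤ 1 + 1 / δ := by positivity
  have h7 := mul_le_mul_of_nonneg_left h5 h6
  have e : (1 + 1 / δ) * (G (f z) ^ 2 * (partialX ψ z ^ 2 + partialY ψ z ^ 2)) =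
      (1 + 1 / δ) * (G (f z) * partialX ψ z) ^ 2 + (1 + 1 / δ) * (G (f z) * partialY ψ z) ^ 2 := by
    ring
  rw [e] at h7
  linarith

namespace IsSmoothSolution

variable {D : ℝ} {T : EReal} {ρ₀ : ℝ × ℝ → ℝ} {ρ : ℝ → ℝ × ℝ → ℝ}

/-- The localized `L^p` inequality: up to a truncation error and a localization error, the
dissipated quantity is the Dirichlet energy of `G(ρ) ψ ≈ ρ^(p / 2)`, with a constant arbitrarily
close to the optimal one. -/
theorem exists_deriv_truncation_le (hD : 0 < D) (h : IsSmoothSolution D T ρ₀ ρ) {p : ℝ}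
    (hp : 1 < p) (hint : Integrable fun z => ρ₀ z ^ p) {τ : ℝ} (hτ : (τ : EReal) < T) {δ : ℝ}
    (hδ : 0 < δ) (hδ1 : δ < 1) {C : ℝ} (hC : 0 ≤ C) : ∃ Q : ℝ, 0 ≤ Q ∧
      ∀ (n B : ℝ) (G G' w H H' : ℝ → ℝ), 0 ≤ n → IsPowerTruncation p n C B G G' w H H' →
      ∃ E : ℝ, ∀ R : ℝ, 1 ≤ R →
        ContinuousOn (fun s => ∫ z, entropy w (ρ s z) * planeCutoff R z ^ 2) (Set.Icc 0 τ) ∧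
        ∀ t, 0 < t → t ≤ τ →
          DifferentiableAt ℝ (fun s => ∫ z, entropy w (ρ s z) * planeCutoff R z ^ 2) t ∧
          deriv (fun s => ∫ z, entropy w (ρ s z) * planeCutoff R z ^ 2) t ≤
            4 * (∫ z, ρ t z * H (ρ t z) * planeCutoff R z ^ 2)
            - (1 - δ) / (1 + δ) * (4 * (p - 1) / p) * D
              * dirichletEnergy (fun z => G (ρ t z) * planeCutoff R z)
            + Q * (∫ z, powerError p n (ρ t z)) + E / R := by
  obtain ⟨N, hN⟩ := h.exists_integral_rpow_le hD hp hint hτ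
  obtain ⟨K, C', hK0, hC'0, hK, hE⟩ := h.exists_deriv_entropy_le hD hτ
  obtain ⟨A, hA0, hA⟩ := exists_planeCutoff_bound
  have hp0 : 0 < p := one_pos.trans hp
  have hp1 : 0 < p - 1 := sub_pos.2 hp
  have hδ' : 0 < 1 - δ := sub_pos.2 hδ1
  set q := K ^ 2 / (2 * δ * D) with hq
  have q0 : 0 ≤ q := by positivity
  refine ⟨q * C, by positivity, fun n B G G' w H H' hn hG => ?_⟩
  have hB0 := hG.bound_nonneg
  set k := (1 - δ) / (1 + δ) * (4 * (p - 1) / p) * D with hk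
  have k0 : 0 ≤ k := by positivity
  refine ⟨B * C' + k * ((1 + 1 / δ) * (2 * A ^ 2 * B) * K), fun R hR => ?_⟩
  have hR0 : 0 < R := one_pos.trans_le hR
  obtain ⟨hc, hd⟩ := hE _ _ _ _ _ _ hG.linear R hR
  refine ⟨hc, fun t ht htτ => ⟨(hd t ht htτ).1, ?_⟩⟩
  have htT := lt_of_le htτ hτ
  have hρ0 := h.nonneg hD ht htT
  have iρ := h.integrable_slice ht.le htT
  have iE := integrable_powerError iρ (Eventually.of_forall hρ0) (hN t ht.le htτ).1 hn
  have E0 : ∀ z, 0 ≤ C * powerError p n (ρ t z) := fun z =>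
    mul_nonneg hC (powerError_nonneg hn (hρ0 z))
  have iS := integrable_mul_planeCutoff_sq (iE.const_mul C) R
  have h1 := (hd t ht htτ).2 δ (fun z => C * powerError p n (ρ t z)) hδ E0 iS
    (fun z => hG.sq_sub_le _ (hρ0 z))
  have h2 : ∫ z, C * powerError p n (ρ t z) * planeCutoff R z ^ 2 ≤
      C * ∫ z, powerError p n (ρ t z) := by
    rw [← integral_const_mul]
    refine integral_mono iS (iE.const_mul C) fun z => ?_
    exact mul_le_of_le_one_right (E0 z)
      (pow_le_one₀ (planeCutoff_nonneg R z) (planeCutoff_le_one R z))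
  have h3 := dirichletEnergy_comp_mul_le hG.hasDerivAt hG.continuous_deriv
    ((h.contDiff_slice ht htT).of_le (by norm_num)) (contDiff_planeCutoff R)
    (hasCompactSupport_planeCutoff hR0) hδ hG.sq_le iρ (fun z => (hA R hR z).1.1)
    (fun z => (hA R hR z).1.2)
  set X := dirichletEnergy (fun z => G (ρ t z) * planeCutoff R z)
  have e1 : (∫ z, w (ρ t z) * (partialX (ρ t) z ^ 2 + partialY (ρ t) z ^ 2) * planeCutoff R z ^ 2) =
      4 * (p - 1) / p *
        ∫ z, G' (ρ t z) ^ 2 * (partialX (ρ t) z ^ 2 + partialY (ρ t) z ^ 2)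
          * planeCutoff R z ^ 2 := by
    rw [← integral_const_mul]
    refine integral_congr_ae (Eventually.of_forall fun z => ?_)
    simp only [hG.weight_eq]
    ring
  rw [e1] at h1
  set Y := ∫ z, G' (ρ t z) ^ 2 * (partialX (ρ t) z ^ 2 + partialY (ρ t) z ^ 2)
    * planeCutoff R z ^ 2
  have h4 : (1 + 1 / δ) * (2 * (A / R) ^ 2 * B) * ∫ z, |ρ t z| ≤
      (1 + 1 / δ) * (2 * A ^ 2 * B) * K / R := by
    have h5 : (A / R) ^ 2 ≤ A ^ 2 / R := by
      rw [div_pow]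
      exact div_le_div_of_nonneg_left (sq_nonneg A) hR0 (le_self_pow₀ hR two_ne_zero)
    calc _ ≤ (1 + 1 / δ) * (2 * (A ^ 2 / R) * B) * K := by
          have := (hK t ht htτ).2
          gcongr
      _ = _ := by ring
  have h6 := mul_le_mul_of_nonneg_left (h3.trans (add_le_add_right h4 _)) k0
  have e2 : k * ((1 + δ) * Y) = (1 - δ) * D * (4 * (p - 1) / p * Y) := by
    rw [hk]
    field_simp
  rw [mul_add, e2] at h6
  have h7 := mul_le_mul_of_nonneg_left h2 q0
  have e3 : (B * C' + k * ((1 + 1 / δ) * (2 * A ^ 2 * B) * K)) / R =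
      B * C' / R + k * ((1 + 1 / δ) * (2 * A ^ 2 * B) * K / R) := by ring
  rw [e3]
  linarith

end IsSmoothSolution

/-! ### Monotonicity of the `L^p` norms -/

theorem sq_sub_rpow_le {s q : ℝ} (h0 : 0 ≤ s) (h1 : s ≤ 1) (hq : q ≤ 4) :
    s ^ 2 - s ^ q ≤ 1 - s ^ 2 := by
  have h : s ^ 4 ≤ s ^ q := by
    rw [← Real.rpow_natCast]
    exact Real.rpow_le_rpow_of_exponent_ge_of_imp h0 h1 (by exact_mod_cast hq) fun _ hq0 => by
      norm_num at hq0
  nlinarith [sq_nonneg (s ^ 2 - 1)]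

namespace IsPowerTruncation

variable {p n C B : ℝ} {G G' w H H' : ℝ → ℝ}

/-- The Gagliardo–Nirenberg–Sobolev inequality for `(G(f) ψ)^(2 / p) ≤ f` bounds the aggregation
term by the Dirichlet energy. -/
theorem integral_mul_flux_le (hG : IsPowerTruncation p n C B G G' w H H') (hp : 1 < p)
    {f : ℝ × ℝ → ℝ} (hf : ContDiff ℝ 1 f) (h0 : ∀ z, 0 ≤ f z) (hi : Integrable f) {R : ℝ}
    (hR : 0 < R) :
    ∫ z, f z * H (f z) * planeCutoff R z ^ 2 ≤
      (p - 1) * (gnsConstant p * (∫ z, f z)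
        * dirichletEnergy (fun z => G (f z) * planeCutoff R z))
      + B * ∫ z, f z * (1 - planeCutoff R z ^ 2) := by
  have hp0 : 0 < p := one_pos.trans hp
  have hB := hG.bound_nonneg
  have cH : Continuous H := continuous_iff_continuousAt.2 fun r =>
    (hG.linear.hasDerivAt_flux r).continuousAt
  have cf := hf.continuous
  set ψ := planeCutoff R
  have ψ0 : ∀ z, 0 ≤ ψ z := planeCutoff_nonneg R
  have ψ1 : ∀ z, ψ z ≤ 1 := planeCutoff_le_one R
  have dψ : ContDiff ℝ 1 ψ := contDiff_planeCutoff R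
  set u : ℝ × ℝ → ℝ := fun z => G (f z) * ψ z with hu
  have u0 : ∀ z, 0 ≤ u z := fun z => mul_nonneg (hG.nonneg _) (ψ0 z)
  have du : ContDiff ℝ 1 u := contDiff_comp_mul hG.hasDerivAt hG.continuous_deriv hf dψ
  have su : HasCompactSupport u := (hasCompactSupport_planeCutoff hR).mul_left
  set ξ : ℝ × ℝ → ℝ := fun z => u z ^ (2 / p) with hξ
  have h2p : 0 < 2 / p := by positivity
  have sξ : HasCompactSupport ξ :=
    su.comp_left (g := fun r : ℝ => r ^ (2 / p)) (Real.zero_rpow h2p.ne')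
  have cξ : Continuous ξ := du.continuous.rpow_const fun z => Or.inr h2p.le
  have ξ0 : ∀ z, 0 ≤ ξ z := fun z => Real.rpow_nonneg (u0 z) _
  have eu : (fun z => ξ z ^ (p / 2)) = u := by
    funext z
    rw [hξ, ← Real.rpow_mul (u0 z), show 2 / p * (p / 2) = 1 by field_simp, Real.rpow_one]
  have eξ : ∀ z, ξ z ^ (p + 1) = G (f z) ^ (2 + 2 / p) * ψ z ^ (2 + 2 / p) := fun z => by
    rw [hξ, ← Real.rpow_mul (u0 z), show 2 / p * (p + 1) = 2 + 2 / p by field_simp, hu,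
      Real.mul_rpow (hG.nonneg _) (ψ0 z)]
  have gns := isGNSConstant_gnsConstant hp.le ξ ξ0 sξ (by rw [eu]; exact du)
  rw [eu] at gns
  have ξf : ∀ z, ξ z ≤ f z := fun z => by
    have h1 : u z ≤ f z ^ (p / 2) :=
      (mul_le_of_le_one_right (hG.nonneg _) (ψ1 z)).trans (hG.le_rpow _ (h0 z))
    have h2 := Real.rpow_le_rpow (u0 z) h1 h2p.le
    rwa [← Real.rpow_mul (h0 z), show p / 2 * (2 / p) = 1 by field_simp, Real.rpow_one] at h2
  have iξ : Integrable ξ := cξ.integrable_of_hasCompactSupport sξ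
  have h1 : ∫ z, ξ z ≤ ∫ z, f z := integral_mono iξ hi ξf
  have h2 : ∫ z, ξ z ^ (p + 1) ≤ gnsConstant p * (∫ z, f z) * dirichletEnergy u :=
    gns.trans (mul_le_mul_of_nonneg_right (mul_le_mul_of_nonneg_left h1 (gnsConstant_nonneg p))
      (dirichletEnergy_nonneg u))
  have iξp : Integrable fun z => ξ z ^ (p + 1) :=
    (cξ.rpow_const fun z => Or.inr (by positivity)).integrable_of_hasCompactSupport
      (sξ.comp_left (g := fun r : ℝ => r ^ (p + 1)) (Real.zero_rpow (by positivity)))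
  have it : Integrable fun z => f z * (1 - ψ z ^ 2) := by
    simp_rw [mul_sub, mul_one]
    exact hi.sub (integrable_mul_planeCutoff_sq hi R)
  have iH : Integrable fun z => f z * H (f z) * ψ z ^ 2 :=
    integrable_mul_of_hasCompactSupport (cf.mul (cH.comp cf)) (dψ.continuous.pow 2)
      (hasCompactSupport_planeCutoff_sq hR)
  calc ∫ z, f z * H (f z) * ψ z ^ 2
      ≤ ∫ z, ((p - 1) * ξ z ^ (p + 1) + B * (f z * (1 - ψ z ^ 2))) := by
        refine integral_mono iH ((iξp.const_mul _).add (it.const_mul B)) fun z => ?_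
        have hfH : 0 ≤ f z * H (f z) := mul_nonneg (h0 z) (hG.flux_nonneg _)
        have k1 := mul_le_mul_of_nonneg_right (hG.mul_flux_le_rpow (f z))
          (Real.rpow_nonneg (ψ0 z) (2 + 2 / p))
        have k2 : ψ z ^ 2 - ψ z ^ (2 + 2 / p) ≤ 1 - ψ z ^ 2 :=
          sq_sub_rpow_le (ψ0 z) (ψ1 z) (by
            have : 2 / p ≤ 2 := div_le_self zero_le_two hp.le
            linarith)
        have k3 := mul_le_mul_of_nonneg_left k2 hfH
        have k4 := hG.mul_flux_le_linear (f z)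
        rw [abs_of_nonneg (h0 z)] at k4
        have k5 : 0 ≤ 1 - ψ z ^ 2 := sub_nonneg.2 (pow_le_one₀ (ψ0 z) (ψ1 z))
        have k6 := mul_le_mul_of_nonneg_right k4 k5
        beta_reduce
        rw [eξ]
        linarith
    _ = (p - 1) * (∫ z, ξ z ^ (p + 1)) + B * ∫ z, f z * (1 - ψ z ^ 2) := by
        rw [integral_add (iξp.const_mul _) (it.const_mul B), integral_const_mul,
          integral_const_mul]
    _ ≤ _ := by
        have := mul_le_mul_of_nonneg_left h2 (sub_pos.2 hp).le
        linarith

end IsPowerTruncation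

namespace IsSmoothSolution

variable {D : ℝ} {T : EReal} {ρ₀ : ℝ × ℝ → ℝ} {ρ : ℝ → ℝ × ℝ → ℝ}

theorem aestronglyMeasurable_integral_comp (h : IsSmoothSolution D T ρ₀ ρ) {φ : ℝ → ℝ}
    (hφ : Measurable φ) {s t : ℝ} (hs : 0 ≤ s) (htT : (t : EReal) < T) :
    AEStronglyMeasurable (fun r => ∫ z, φ (ρ r z)) (volume.restrict (Set.Ioc s t)) := by
  have h1 : ContinuousOn (fun q : ℝ × (ℝ × ℝ) => ρ q.1 q.2) (Set.Ioc s t ×ˢ Set.univ) :=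
    h.smooth.continuousOn.mono fun q hq => ⟨hs.trans_lt hq.1.1, lt_of_le hq.1.2 htT⟩
  have h2 : AEStronglyMeasurable (fun q : ℝ × (ℝ × ℝ) => ρ q.1 q.2)
      ((volume.restrict (Set.Ioc s t)).prod volume) := by
    have e : ((volume : Measure ℝ).restrict (Set.Ioc s t)).prod (volume : Measure (ℝ × ℝ)) =
        (volume.prod volume).restrict (Set.Ioc s t ×ˢ Set.univ) := by
      rw [← Measure.prod_restrict, Measure.restrict_univ]
    rw [e]
    exact h1.aestronglyMeasurable (measurableSet_Ioc.prod MeasurableSet.univ)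
  exact (hφ.comp_aemeasurable h2.aemeasurable).aestronglyMeasurable.integral_prod_right'

theorem tendsto_intervalIntegral_powerError (hD : 0 < D) (h : IsSmoothSolution D T ρ₀ ρ) {p : ℝ}
    (hp : 1 < p) (hint : Integrable fun z => ρ₀ z ^ p) {s t : ℝ} (hs : 0 ≤ s) (hst : s ≤ t)
    (htT : (t : EReal) < T) :
    (∀ k : ℕ, IntegrableOn (fun r => ∫ z, powerError p ((k : ℝ) + 1) (ρ r z)) (Set.Icc s t)) ∧
    Tendsto (fun k : ℕ => ∫ r in s..t, ∫ z, powerError p ((k : ℝ) + 1) (ρ r z)) atTop (𝓝 0) := by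
  obtain ⟨N, hN⟩ := h.exists_integral_rpow_le hD hp hint htT
  have hk1 : ∀ k : ℕ, (1 : ℝ) ≤ (k : ℝ) + 1 := fun k => by
    have := k.cast_nonneg (α := ℝ); linarith
  have hm := fun k : ℕ =>
    h.aestronglyMeasurable_integral_comp (measurable_powerError p ((k : ℝ) + 1)) hs htT
  have hb : ∀ (k : ℕ), ∀ r ∈ Set.Ioc s t,
      ‖∫ z, powerError p ((k : ℝ) + 1) (ρ r z)‖ ≤ (∫ z, ρ₀ z) + N := by
    intro k r hr
    have hr0 : 0 ≤ r := hs.trans hr.1.le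
    have hrT := lt_of_le hr.2 htT
    have hae := h.ae_nonneg hD hr0 hrT
    have h1 : 0 ≤ ∫ z, powerError p ((k : ℝ) + 1) (ρ r z) := integral_nonneg_of_ae (by
      filter_upwards [hae] with z hz using powerError_nonneg (zero_le_one.trans (hk1 k)) hz)
    rw [Real.norm_eq_abs, abs_of_nonneg h1, ← h.mass_eq hD hr0 hrT]
    exact (integral_powerError_le (h.integrable_slice hr0 hrT) hae (hN r hr0 hr.2).1 (hk1 k)
      hp.le).trans (add_le_add_right (hN r hr0 hr.2).2 _)
  refine ⟨fun k => ?_, ?_⟩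
  · rw [integrableOn_Icc_iff_integrableOn_Ioc]
    exact (integrableOn_const (by simp)).mono' (hm k)
      ((ae_restrict_iff' measurableSet_Ioc).2 (Eventually.of_forall (hb k)))
  · have := intervalIntegral.tendsto_integral_filter_of_dominated_convergence (μ := volume) (a := s)
      (b := t) (l := atTop) (f := fun _ => (0 : ℝ))
      (F := fun (k : ℕ) r => ∫ z, powerError p ((k : ℝ) + 1) (ρ r z)) (fun _ => (∫ z, ρ₀ z) + N)
      (Eventually.of_forall fun k => by rw [Set.uIoc_of_le hst]; exact hm k)
      (Eventually.of_forall fun k => Eventually.of_forall fun r hr => by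
        rw [Set.uIoc_of_le hst] at hr; exact hb k r hr) (by simp)
      (Eventually.of_forall fun r hr => by
        rw [Set.uIoc_of_le hst] at hr
        have hr0 : 0 ≤ r := hs.trans hr.1.le
        have hrT := lt_of_le hr.2 htT
        exact tendsto_integral_powerError (h.integrable_slice hr0 hrT) (h.ae_nonneg hD hr0 hrT)
          (hN r hr0 hr.2).1 hp)
    simpa using this

/-- For subcritical mass the dissipation dominates the aggregation term, so that `∬ ρ ^ p` does not
increase. The truncation error is integrated in time and removed last. -/
theorem integral_rpow_le (hD : 0 < D) (h : IsSmoothSolution D T ρ₀ ρ) {p : ℝ} (hp : 1 < p)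
    (hint : Integrable fun z => ρ₀ z ^ p) (hsub : p * gnsConstant p * (∫ z, ρ₀ z) < D)
    {s t : ℝ} (hs : 0 ≤ s) (hst : s ≤ t) (htT : (t : EReal) < T) :
    ∫ z, ρ t z ^ p ≤ ∫ z, ρ s z ^ p := by
  have hp0 : 0 < p := one_pos.trans hp
  have hp1 : 0 < p - 1 := sub_pos.2 hp
  have ht : 0 ≤ t := hs.trans hst
  have hsT := lt_of_le hst htT
  have m0 : 0 ≤ ∫ z, ρ₀ z := integral_nonneg_of_ae h.nonneg_data
  set c := p * gnsConstant p * ∫ z, ρ₀ z with hc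
  have c0 : 0 ≤ c := mul_nonneg (mul_nonneg hp0.le (gnsConstant_nonneg p)) m0
  -- `δ` is small enough that the loss in the dissipation stays below the gap `D - c`.
  set δ := (D - c) / (D + c) with hδ
  have hDc : 0 < D - c := sub_pos.2 hsub
  have hδ0 : 0 < δ := by positivity
  obtain ⟨δ', hδ'0, hδ'1, hδ'⟩ : ∃ δ' : ℝ, 0 < δ' ∧ δ' < 1 ∧ c ≤ (1 - δ') / (1 + δ') * D := by
    refine ⟨δ / 2, by positivity, ?_, ?_⟩
    · have : δ ≤ 1 := (div_le_one (by positivity)).2 (by linarith)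
      linarith
    · rw [div_mul_eq_mul_div, le_div_iff₀ (by positivity)]
      have : δ * (D + c) = D - c := by rw [hδ]; field_simp
      nlinarith
  obtain ⟨C, hC0, hC⟩ := exists_isPowerTruncation hp
  obtain ⟨Q, hQ0, hQ⟩ := h.exists_deriv_truncation_le hD hp hint htT hδ'0 hδ'1 hC0
  obtain ⟨N, hN⟩ := h.exists_integral_rpow_le hD hp hint htT
  obtain ⟨e, he, heR⟩ := h.exists_tail_le hD htT
  obtain ⟨hti, htl⟩ := h.tendsto_intervalIntegral_powerError hD hp hint hs hst htT
  have hk1 : ∀ k : ℕ, (1 : ℝ) ≤ (k : ℝ) + 1 := fun k => by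
    have := k.cast_nonneg (α := ℝ); linarith
  have key : ∀ k : ℕ, (∫ z, ρ t z ^ p) - ∫ z, ρ s z ^ p ≤
      Q * (∫ r in s..t, ∫ z, powerError p ((k : ℝ) + 1) (ρ r z))
      + (C * (∫ z, powerError p ((k : ℝ) + 1) (ρ t z))
        + C * ∫ z, powerError p ((k : ℝ) + 1) (ρ s z)) := by
    intro k
    have hk0 : (0 : ℝ) ≤ (k : ℝ) + 1 := zero_le_one.trans (hk1 k)
    obtain ⟨B, G, G', w, H, H', hG⟩ := hC _ (hk1 k)
    obtain ⟨E, hE⟩ := hQ _ B G G' w H H' hk0 hG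
    have hR : ∀ R : ℝ, 1 ≤ R → (∫ z, entropy w (ρ t z) * planeCutoff R z ^ 2)
        - (∫ z, entropy w (ρ s z) * planeCutoff R z ^ 2) ≤
        Q * (∫ r in s..t, ∫ z, powerError p ((k : ℝ) + 1) (ρ r z))
        + (t - s) * (4 * B * e R + E / R) := by
      intro R hR
      obtain ⟨hcont, hd⟩ := hE R hR
      have hconst : IntegrableOn (fun _ : ℝ => 4 * B * e R + E / R) (Set.Icc s t) :=
        integrableOn_const (by simp)
      have := sub_le_integral_of_hasDerivAt_le hst (hcont.mono (Set.Icc_subset_Icc_left hs))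
        (fun r hr => (hd r (hs.trans_lt hr.1) hr.2.le).1.hasDerivAt)
        (((hti k).const_mul Q).add hconst) fun r hr => by
          have hr0 := hs.trans_lt hr.1
          have hrT := lt_of_le hr.2.le htT
          have h1 := (hd r hr0 hr.2.le).2
          have h2 := hG.integral_mul_flux_le hp
            ((h.contDiff_slice hr0 hrT).of_le (by norm_num)) (h.nonneg hD hr0 hrT)
            (h.integrable_slice hr0.le hrT) (one_pos.trans_le hR)
          rw [h.mass_eq hD hr0.le hrT] at h2
          have h3 := mul_le_mul_of_nonneg_left (heR R hR r hr0.le hr.2.le) hG.bound_nonneg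
          set X := dirichletEnergy (fun z => G (ρ r z) * planeCutoff R z)
          have h4 : (p - 1) * (gnsConstant p * (∫ z, ρ₀ z) * X) * 4 ≤
              (1 - δ') / (1 + δ') * (4 * (p - 1) / p) * D * X := by
            have h5 := mul_le_mul_of_nonneg_right hδ' (mul_nonneg
              (by positivity : 0 ≤ 4 * (p - 1) / p) (dirichletEnergy_nonneg _ : 0 ≤ X))
            calc _ = c * (4 * (p - 1) / p * X) := by rw [hc]; field_simp
              _ ≤ _ := h5
              _ = _ := by ring
          simp only [Pi.add_apply]
          linarith
      refine this.trans (le_of_eq ?_)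
      simp only [Pi.add_apply]
      rw [intervalIntegral.integral_add, intervalIntegral.integral_const_mul,
        intervalIntegral.integral_const, smul_eq_mul]
      · exact ((intervalIntegrable_iff_integrableOn_Icc_of_le hst).2 (hti k)).const_mul Q
      · exact intervalIntegrable_const
    have l1 := (tendsto_integral_mul_planeCutoff_sq
      (hG.integrable_entropy (h.integrable_slice ht htT))).sub
      (tendsto_integral_mul_planeCutoff_sq (hG.integrable_entropy (h.integrable_slice hs hsT)))
    have l2 : Tendsto (fun R : ℝ => Q * (∫ r in s..t, ∫ z, powerError p ((k : ℝ) + 1) (ρ r z))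
        + (t - s) * (4 * B * e R + E / R)) atTop
        (𝓝 (Q * (∫ r in s..t, ∫ z, powerError p ((k : ℝ) + 1) (ρ r z)))) := by
      have l3 : Tendsto (fun R : ℝ => E / R) atTop (𝓝 0) :=
        tendsto_const_nhds.div_atTop tendsto_id
      simpa using ((((he.const_mul (4 * B)).add l3).const_mul (t - s)).const_add _)
    have h1 := le_of_tendsto_of_tendsto l1 l2 (by
      filter_upwards [eventually_ge_atTop 1] with R h using hR R h)
    have h2 := (abs_le.1 (hG.abs_integral_entropy_sub_le hk0 (h.integrable_slice ht htT)
      (h.ae_nonneg hD ht htT) (hN t ht le_rfl).1)).1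
    have h3 := (abs_le.1 (hG.abs_integral_entropy_sub_le hk0 (h.integrable_slice hs hsT)
      (h.ae_nonneg hD hs hsT) (hN s hs hst).1)).2
    linarith
  have l4 := (htl.const_mul Q).add (((tendsto_integral_powerError (h.integrable_slice ht htT)
    (h.ae_nonneg hD ht htT) (hN t ht le_rfl).1 hp).const_mul C).add
    ((tendsto_integral_powerError (h.integrable_slice hs hsT)
    (h.ae_nonneg hD hs hsT) (hN s hs hst).1 hp).const_mul C))
  simp only [mul_zero, add_zero] at l4
  exact sub_nonpos.1 (ge_of_tendsto' l4 key)

end IsSmoothSolution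

/-! ### The iterated `L^p` estimate -/

theorem le_add_of_sq_le_four_mul {x a b : ℝ} (ha : 0 ≤ a) (hb : 0 ≤ b) (h : x ^ 2 ≤ 4 * (a * b)) :
    x ≤ a + b :=
  le_of_sq_le_sq (h.trans (by nlinarith [sq_nonneg (a - b)])) (add_nonneg ha hb)

/-- Cubic aggregation is absorbed by the dissipation: the Gagliardo–Nirenberg–Sobolev inequality
with `p = 1` handles `∬ f u²` and with `p = 2` it yields Nash's inequality for `u`. -/
theorem integral_mul_sq_sub_dirichletEnergy_le {u f : ℝ × ℝ → ℝ} (hu : ContDiff ℝ 1 u)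
    (hs : HasCompactSupport u) (h0 : ∀ z, 0 ≤ u z) (hf : Continuous f)
    (hf2 : Integrable fun z => f z ^ 2) {N α κ : ℝ} (hN : ∫ z, f z ^ 2 ≤ N)
    (hα : ∫ z, u z ≤ α) (hκ : 0 < κ) :
    4 * (∫ z, f z * u z ^ 2) - 2 * κ * dirichletEnergy u ≤
      -(∫ z, u z ^ 2) + (4 * N * gnsConstant 1 / κ + 1) ^ 2 * gnsConstant 2 * α ^ 2 / (4 * κ) := by
  have cu := hu.continuous
  have C1 := gnsConstant_nonneg 1
  have C2 := gnsConstant_nonneg 2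
  set X := dirichletEnergy u
  have X0 : 0 ≤ X := dirichletEnergy_nonneg u
  set U := ∫ z, u z ^ 2
  have U0 : 0 ≤ U := integral_nonneg fun z => sq_nonneg _
  have N0 : 0 ≤ N := (integral_nonneg fun z => sq_nonneg _).trans hN
  have I0 : 0 ≤ ∫ z, u z := integral_nonneg h0
  have su : ∀ k : ℕ, k ≠ 0 → HasCompactSupport fun z => u z ^ k := fun k hk =>
    hs.comp_left (g := fun r => r ^ k) (by simp [hk])
  have iu : ∀ k : ℕ, k ≠ 0 → Integrable fun z => u z ^ k := fun k hk =>
    (cu.pow k).integrable_of_hasCompactSupport (su k hk)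
  have e1 : (fun z => (u z ^ 2) ^ ((1 : ℝ) / 2)) = u := by
    funext z
    rw [← Real.sqrt_eq_rpow, Real.sqrt_sq (h0 z)]
  have g1 := isGNSConstant_gnsConstant le_rfl (fun z => u z ^ 2) (fun z => sq_nonneg _)
    (su 2 two_ne_zero) (by rw [e1]; exact hu)
  rw [e1, show (1 : ℝ) + 1 = ((2 : ℕ) : ℝ) by norm_num] at g1
  simp only [Real.rpow_natCast, ← pow_mul] at g1
  change _ ≤ gnsConstant 1 * U * X at g1
  have e2 : (fun z => u z ^ ((2 : ℝ) / 2)) = u := by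
    funext z
    rw [div_self two_ne_zero, Real.rpow_one]
  have g2 := isGNSConstant_gnsConstant one_le_two u h0 hs (by rw [e2]; exact hu)
  rw [e2, show (2 : ℝ) + 1 = ((3 : ℕ) : ℝ) by norm_num] at g2
  simp only [Real.rpow_natCast] at g2
  change _ ≤ gnsConstant 2 * (∫ z, u z) * X at g2
  have h1 : (∫ z, f z * u z ^ 2) ^ 2 ≤ N * (gnsConstant 1 * U * X) := by
    have i4 : Integrable fun z => (u z ^ 2) ^ 2 := by
      simpa only [← pow_mul] using iu 4 (by norm_num)
    refine (sq_integral_mul_le hf2 i4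
      (integrable_mul_of_hasCompactSupport hf (cu.pow 2) (su 2 two_ne_zero))).trans ?_
    simp only [← pow_mul]
    exact mul_le_mul hN g1 (integral_nonneg fun z => pow_nonneg (h0 z) _) N0
  have h2 : U ^ 2 ≤ gnsConstant 2 * α ^ 2 * X := by
    -- Interpolate `U` between `∬ u` and `∬ u³`.
    have e3 : ∀ z, √(u z) * √(u z) ^ 3 = u z ^ 2 := fun z => by
      rw [show √(u z) * √(u z) ^ 3 = (√(u z) ^ 2) ^ 2 by ring, Real.sq_sqrt (h0 z)]
    have e4 : ∀ z, (√(u z) ^ 3) ^ 2 = u z ^ 3 := fun z => by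
      rw [show (√(u z) ^ 3) ^ 2 = (√(u z) ^ 2) ^ 3 by ring, Real.sq_sqrt (h0 z)]
    have i1 : Integrable u := by simpa using iu 1 one_ne_zero
    have := sq_integral_mul_le (f := fun z => √(u z)) (g := fun z => √(u z) ^ 3)
      (by simpa only [fun z => Real.sq_sqrt (h0 z)] using i1)
      (by simpa only [e4] using iu 3 (by norm_num))
      (by simpa only [e3] using iu 2 two_ne_zero)
    simp only [e3, e4, fun z => Real.sq_sqrt (h0 z)] at this
    calc U ^ 2 ≤ _ := this
      _ ≤ (∫ z, u z) * (gnsConstant 2 * (∫ z, u z) * X) := mul_le_mul_of_nonneg_left g2 I0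
      _ = gnsConstant 2 * (∫ z, u z) ^ 2 * X := by ring
      _ ≤ _ := by gcongr
  -- Half of the dissipation absorbs `∬ f u²` at the cost of `κ' U`, the other half absorbs
  -- `(κ' + 1) U` through Nash's inequality; the surplus `-U` remains.
  set κ' := 4 * N * gnsConstant 1 / κ with hκ'
  have κ0 : 0 ≤ κ' := by positivity
  have h3 : 4 * (∫ z, f z * u z ^ 2) ≤ κ * X + κ' * U := by
    refine le_add_of_sq_le_four_mul (by positivity) (by positivity) ?_
    have : 4 * (κ * X * (κ' * U)) = 16 * (N * (gnsConstant 1 * U * X)) := by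
      rw [hκ']; field_simp; ring
    rw [this, mul_pow]
    linarith
  have h4 : (κ' + 1) * U ≤ κ * X + (κ' + 1) ^ 2 * gnsConstant 2 * α ^ 2 / (4 * κ) := by
    refine le_add_of_sq_le_four_mul (by positivity) (by positivity) ?_
    have : 4 * (κ * X * ((κ' + 1) ^ 2 * gnsConstant 2 * α ^ 2 / (4 * κ))) =
        (κ' + 1) ^ 2 * (gnsConstant 2 * α ^ 2 * X) := by
      field_simp
    rw [this, mul_pow]
    exact mul_le_mul_of_nonneg_left h2 (sq_nonneg _)
  linarith

theorem le_max_of_sub_le_mul_sub {x y b e : ℝ} (h0 : 0 ≤ e) (h1 : e ≤ 1)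
    (h : x - b ≤ e * (y - b)) : x ≤ max y b := by
  rcases le_total y b with hyb | hyb
  · rw [max_eq_right hyb]
    nlinarith
  · rw [max_eq_left hyb]
    nlinarith

theorem powerError_le_add_div {p n r : ℝ} (hn : 0 < n) (hr : 0 ≤ r) :
    powerError p n r ≤ n ^ (1 - p) * r + r ^ (p + 1) / n := by
  unfold powerError
  refine add_le_add_right ?_ _
  split_ifs with h
  · have hr0 : 0 < r := hn.trans h
    rw [le_div_iff₀ hn, Real.rpow_add_one hr0.ne']
    exact mul_le_mul_of_nonneg_left h.le (Real.rpow_nonneg hr _)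
  · exact div_nonneg (Real.rpow_nonneg hr _) hn.le

namespace IsSmoothSolution

variable {D : ℝ} {T : EReal} {ρ₀ : ℝ × ℝ → ℝ} {ρ : ℝ → ℝ × ℝ → ℝ}

/-- A uniform `L²` bound allows to control the `L^p` norm by the `L^(p / 2)` norm, with a constant
that is polynomial in `p` and does not depend on time. -/
theorem integral_rpow_le_max (hD : 0 < D) (h : IsSmoothSolution D T ρ₀ ρ) {p : ℝ} (hp : 1 < p)
    (hint : Integrable fun z => ρ₀ z ^ p) (hint' : Integrable fun z => ρ₀ z ^ (p + 1)) {t : ℝ}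
    (ht : 0 ≤ t) (htT : (t : EReal) < T) {N α : ℝ}
    (hN : ∀ r, 0 < r → r ≤ t → Integrable (fun z => ρ r z ^ 2) ∧ ∫ z, ρ r z ^ 2 ≤ N)
    (hα : ∀ r, 0 < r → r ≤ t → Integrable (fun z => ρ r z ^ (p / 2)) ∧ ∫ z, ρ r z ^ (p / 2) ≤ α) :
    ∫ z, ρ t z ^ p ≤ max (∫ z, ρ₀ z ^ p)
      ((4 * N * gnsConstant 1 / (D / p) + 1) ^ 2 * gnsConstant 2 * α ^ 2 / (4 * (D / p))) := by
  have hp0 : 0 < p := one_pos.trans hp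
  have hp1 : 0 < p - 1 := sub_pos.2 hp
  set b := (4 * N * gnsConstant 1 / (D / p) + 1) ^ 2 * gnsConstant 2 * α ^ 2 / (4 * (D / p))
    with hb
  obtain ⟨C, hC0, hC⟩ := exists_isPowerTruncation hp
  -- With `δ = 1 / 3` half of the dissipation is kept.
  obtain ⟨Q, hQ0, hQ⟩ := h.exists_deriv_truncation_le hD hp hint htT (δ := 1 / 3) (by norm_num)
    (by norm_num) hC0
  obtain ⟨P, hP⟩ := h.exists_integral_rpow_le hD hp hint htT
  obtain ⟨P', hP'⟩ := h.exists_integral_rpow_le hD (by linarith : 1 < p + 1) hint' htT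
  have hk1 : ∀ k : ℕ, (1 : ℝ) ≤ (k : ℝ) + 1 := fun k => by
    have := k.cast_nonneg (α := ℝ); linarith
  set ε : ℕ → ℝ := fun k => ((k : ℝ) + 1) ^ (1 - p) * (∫ z, ρ₀ z) + P' / ((k : ℝ) + 1) with hε
  have hε0 : Tendsto ε atTop (𝓝 0) := by
    have l1 := (tendsto_rpow_one_sub hp).mul_const (∫ z, ρ₀ z)
    have l2 : Tendsto (fun k : ℕ => P' / ((k : ℝ) + 1)) atTop (𝓝 0) :=
      tendsto_const_nhds.div_atTop
        (tendsto_atTop_add_const_right _ _ tendsto_natCast_atTop_atTop)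
    simpa using l1.add l2
  have herr : ∀ (k : ℕ) (r : ℝ), 0 ≤ r → r ≤ t →
      ∫ z, powerError p ((k : ℝ) + 1) (ρ r z) ≤ ε k := by
    intro k r hr hrt
    have hrT := lt_of_le hrt htT
    have i1 := h.integrable_slice hr hrT
    have i2 := (hP' r hr hrt).1
    have hk0 : (0 : ℝ) < (k : ℝ) + 1 := one_pos.trans_le (hk1 k)
    calc ∫ z, powerError p ((k : ℝ) + 1) (ρ r z)
        ≤ ∫ z, (((k : ℝ) + 1) ^ (1 - p) * ρ r z + ρ r z ^ (p + 1) / ((k : ℝ) + 1)) := by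
          refine integral_mono_ae (integrable_powerError i1 (h.ae_nonneg hD hr hrT)
            (hP r hr hrt).1 hk0.le) ((i1.const_mul _).add (i2.div_const _)) ?_
          filter_upwards [h.ae_nonneg hD hr hrT] with z hz using powerError_le_add_div hk0 hz
      _ = ((k : ℝ) + 1) ^ (1 - p) * (∫ z, ρ r z) + (∫ z, ρ r z ^ (p + 1)) / ((k : ℝ) + 1) := by
          rw [integral_add (i1.const_mul _) (i2.div_const _), integral_const_mul,
            integral_div]
      _ ≤ _ := by
          rw [h.mass_eq hD hr hrT]
          have := (hP' r hr hrt).2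
          simp only [hε]
          gcongr
  have key : ∀ k : ℕ, (∫ z, ρ t z ^ p) - C * ε k ≤
      max ((∫ z, ρ₀ z ^ p) + C * ε k) (b + 2 * C * ε k + Q * ε k / (p - 1)) := by
    intro k
    have hk0 : (0 : ℝ) ≤ (k : ℝ) + 1 := zero_le_one.trans (hk1 k)
    obtain ⟨B, G, G', w, H, H', hG⟩ := hC _ (hk1 k)
    obtain ⟨E, hE⟩ := hQ _ B G G' w H H' hk0 hG
    have cH : Continuous H := continuous_iff_continuousAt.2 fun r =>
      (hG.linear.hasDerivAt_flux r).continuousAt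
    have hR : ∀ R : ℝ, 1 ≤ R → (∫ z, entropy w (ρ t z) * planeCutoff R z ^ 2) ≤
        max (∫ z, entropy w (ρ 0 z) * planeCutoff R z ^ 2)
          (b + 2 * C * ε k + (Q * ε k + E / R) / (p - 1)) := by
      intro R hR
      have hR0 : 0 < R := one_pos.trans_le hR
      obtain ⟨hcont, hd⟩ := hE R hR
      refine le_max_of_sub_le_mul_sub (Real.exp_pos (-(p - 1) * (t - 0))).le
        (Real.exp_le_one_iff.2 (by nlinarith)) (sub_le_exp_mul_sub_of_deriv_le (l := p - 1) ht hcont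
        (fun r hr => (hd r hr.1 hr.2.le).1.hasDerivAt) fun r hr => ?_)
      have hrT := lt_of_le hr.2.le htT
      have h1 := (hd r hr.1 hr.2.le).2
      have hρ0 := h.nonneg hD hr.1 hrT
      have cρ := (h.contDiff_slice hr.1 hrT)
      have iρ := h.integrable_slice hr.1.le hrT
      have her := herr k r hr.1.le hr.2.le
      have iE := integrable_powerError iρ (Eventually.of_forall hρ0) (hP r hr.1.le hr.2.le).1 hk0
      have ψ0 := planeCutoff_nonneg R
      have ψ1 := planeCutoff_le_one R
      have dψ : ContDiff ℝ 1 (planeCutoff R) := contDiff_planeCutoff R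
      have sψ := hasCompactSupport_planeCutoff_sq hR0
      set u : ℝ × ℝ → ℝ := fun z => G (ρ r z) * planeCutoff R z with hu
      have du : ContDiff ℝ 1 u :=
        contDiff_comp_mul hG.hasDerivAt hG.continuous_deriv (cρ.of_le (by norm_num)) dψ
      have su : HasCompactSupport u := (hasCompactSupport_planeCutoff hR0).mul_left
      have su2 : HasCompactSupport fun z => u z ^ 2 :=
        su.comp_left (g := fun r => r ^ 2) (by simp)
      have u0 : ∀ z, 0 ≤ u z := fun z => mul_nonneg (hG.nonneg _) (ψ0 z)
      have hα' : ∫ z, u z ≤ α := by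
        refine (integral_mono (du.continuous.integrable_of_hasCompactSupport su)
          (hα r hr.1 hr.2.le).1 fun z => ?_).trans (hα r hr.1 hr.2.le).2
        exact (mul_le_of_le_one_right (hG.nonneg _) (ψ1 z)).trans (hG.le_rpow _ (hρ0 z))
      have h2 := integral_mul_sq_sub_dirichletEnergy_le du su u0 cρ.continuous
        (hN r hr.1 hr.2.le).1 (hN r hr.1 hr.2.le).2 hα' (div_pos hD hp0)
      rw [← hb] at h2
      set X := dirichletEnergy u
      have h3 : ∫ z, ρ r z * H (ρ r z) * planeCutoff R z ^ 2 ≤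
          (p - 1) * ∫ z, ρ r z * u z ^ 2 := by
        rw [← integral_const_mul]
        refine integral_mono (integrable_mul_of_hasCompactSupport
          (cρ.continuous.mul (cH.comp cρ.continuous)) (dψ.continuous.pow 2) sψ)
          ((integrable_mul_of_hasCompactSupport cρ.continuous (du.continuous.pow 2)
            su2).const_mul _) fun z => ?_
        have := mul_le_mul_of_nonneg_right (hG.mul_flux_le (ρ r z)) (sq_nonneg (planeCutoff R z))
        refine this.trans (le_of_eq ?_)
        simp only [hu]
        ring
      have h4 : ∫ z, entropy w (ρ r z) * planeCutoff R z ^ 2 ≤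
          (∫ z, u z ^ 2) + 2 * C * ∫ z, powerError p ((k : ℝ) + 1) (ρ r z) := by
        have iu2 : Integrable fun z => u z ^ 2 :=
          (du.continuous.pow 2).integrable_of_hasCompactSupport su2
        rw [← integral_const_mul, ← integral_add iu2 (iE.const_mul _)]
        refine integral_mono (integrable_mul_planeCutoff_sq (hG.integrable_entropy iρ) R)
          (iu2.add (iE.const_mul _)) fun z => ?_
        have k1 := (abs_le.1 (hG.abs_entropy_sub_le _ (hρ0 z))).2
        have k2 := hG.rpow_le _ (hρ0 z)
        have k3 : 0 ≤ 2 * C * powerError p ((k : ℝ) + 1) (ρ r z) :=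
          mul_nonneg (by positivity) (powerError_nonneg hk0 (hρ0 z))
        have k4 : planeCutoff R z ^ 2 ≤ 1 := pow_le_one₀ (ψ0 z) (ψ1 z)
        have k5 : entropy w (ρ r z) ≤
          G (ρ r z) ^ 2 + 2 * C * powerError p ((k : ℝ) + 1) (ρ r z) := by linarith
        have k6 := mul_le_mul_of_nonneg_right k5 (sq_nonneg (planeCutoff R z))
        have k7 := mul_le_of_le_one_right k3 k4
        simp only [hu, mul_pow]
        linarith
      have h5 := mul_le_mul_of_nonneg_left h2 hp1.le
      have h6 := mul_le_mul_of_nonneg_left her hQ0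
      have h7 := mul_le_mul_of_nonneg_left her (by positivity : 0 ≤ 2 * C)
      have h8 := mul_le_mul_of_nonneg_left (h4.trans (add_le_add_right h7 _)) hp1.le
      have e1 : (1 - 1 / 3) / (1 + 1 / 3) * (4 * (p - 1) / p) * D * X =
          (p - 1) * (2 * (D / p) * X) := by
        field_simp
        ring
      have e2 : (p - 1) * ((Q * ε k + E / R) / (p - 1)) = Q * ε k + E / R := by field_simp
      rw [e1] at h1
      have e3 : -(p - 1) * ((∫ z, entropy w (ρ r z) * planeCutoff R z ^ 2)
          - (b + 2 * C * ε k + (Q * ε k + E / R) / (p - 1))) =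
          -((p - 1) * (∫ z, entropy w (ρ r z) * planeCutoff R z ^ 2))
          + (p - 1) * (b + 2 * C * ε k) + (p - 1) * ((Q * ε k + E / R) / (p - 1)) := by ring
      rw [e3, e2]
      linarith
    have i0 : Integrable (ρ 0) := by rw [h.initial]; exact h.integrable_data
    have l1 := tendsto_integral_mul_planeCutoff_sq
      (hG.integrable_entropy (h.integrable_slice ht htT))
    have l2 := tendsto_integral_mul_planeCutoff_sq (hG.integrable_entropy i0)
    have l3 : Tendsto (fun R : ℝ => b + 2 * C * ε k + (Q * ε k + E / R) / (p - 1)) atTop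
        (𝓝 (b + 2 * C * ε k + Q * ε k / (p - 1))) := by
      have : Tendsto (fun R : ℝ => E / R) atTop (𝓝 0) := tendsto_const_nhds.div_atTop tendsto_id
      simpa using ((this.const_add (Q * ε k)).div_const (p - 1)).const_add (b + 2 * C * ε k)
    have h1 := le_of_tendsto_of_tendsto l1 (l2.max l3) (by
      filter_upwards [eventually_ge_atTop 1] with R h using hR R h)
    have h2 := (abs_le.1 (hG.abs_integral_entropy_sub_le hk0 (h.integrable_slice ht htT)
      (h.ae_nonneg hD ht htT) (hP t ht le_rfl).1)).1
    have h3 := (abs_le.1 (hG.abs_integral_entropy_sub_le hk0 h.integrable_data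
      h.nonneg_data hint)).2
    have h4 := mul_le_mul_of_nonneg_left (herr k t ht le_rfl) hC0
    have h5 := mul_le_mul_of_nonneg_left (herr k 0 le_rfl ht) hC0
    rw [h.initial] at h1 h5
    have h6 : (∫ z, entropy w (ρ₀ z)) ≤ (∫ z, ρ₀ z ^ p) + C * ε k := by linarith
    have h7 := h1.trans (max_le_max h6 le_rfl)
    linarith
  have l1 := (hε0.const_mul C).const_sub (∫ z, ρ t z ^ p)
  have l2 := ((hε0.const_mul C).const_add (∫ z, ρ₀ z ^ p)).max
    (((hε0.const_mul (2 * C)).const_add b).add ((hε0.const_mul Q).div_const (p - 1)))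
  simp only [mul_zero, sub_zero, add_zero, zero_div] at l1 l2
  exact le_of_tendsto_of_tendsto' l1 l2 key

end IsSmoothSolution

theorem rpow_two_pow (x : ℝ) (k : ℕ) : x ^ ((2 : ℝ) ^ k) = x ^ (2 ^ k) := by
  rw [← Real.rpow_natCast x (2 ^ k), Nat.cast_pow, Nat.cast_ofNat]

theorem ae_le_two_mul_of_integral_rpow_le {α : Type*} [MeasurableSpace α] {μ : Measure α}
    {f : α → ℝ} {A : ℝ} (hA : 0 < A) (h0 : ∀ᵐ z ∂μ, 0 ≤ f z)
    (h : ∀ k : ℕ, Integrable (fun z => f z ^ ((2 : ℝ) ^ k)) μ ∧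
      ∫ z, f z ^ ((2 : ℝ) ^ k) ∂μ ≤ A ^ (2 ^ k)) : ∀ᵐ z ∂μ, f z ≤ 2 * A := by
  have key : ∀ k : ℕ, μ {z | 2 * A < f z} ≤ ENNReal.ofReal ((1 / 2) ^ (2 ^ k)) := by
    intro k
    obtain ⟨hi, hle⟩ := h k
    set c : ℝ := (2 * A) ^ (2 ^ k) with hc
    have c0 : 0 < c := by positivity
    have h1 := mul_meas_ge_le_integral_of_nonneg (μ := μ) (f := fun z => f z ^ ((2 : ℝ) ^ k))
      (by filter_upwards [h0] with z hz using Real.rpow_nonneg hz _) hi c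
    have hfin : μ {z | c ≤ f z ^ ((2 : ℝ) ^ k)} < ⊤ := hi.measure_ge_lt_top c0
    have h2 : μ {z | 2 * A < f z} ≤ μ {z | c ≤ f z ^ ((2 : ℝ) ^ k)} := by
      refine measure_mono fun z hz => ?_
      rw [Set.mem_ofPred_eq, rpow_two_pow, hc]
      exact pow_le_pow_left₀ (by positivity) (le_of_lt hz) _
    refine h2.trans ?_
    rw [← ENNReal.ofReal_toReal hfin.ne]
    refine ENNReal.ofReal_le_ofReal ?_
    have h3 := h1.trans hle
    have h4 : A ^ (2 ^ k) = c * (1 / 2) ^ (2 ^ k) := by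
      rw [hc, ← mul_pow]
      congr 1
      ring
    rw [h4] at h3
    exact le_of_mul_le_mul_left h3 c0
  have l1 : Tendsto (fun k : ℕ => ENNReal.ofReal ((1 / 2) ^ (2 ^ k))) atTop (𝓝 0) := by
    have l2 : Tendsto (fun k : ℕ => ((1 : ℝ) / 2) ^ (2 ^ k)) atTop (𝓝 0) :=
      (tendsto_pow_atTop_nhds_zero_of_lt_one (by norm_num) (by norm_num)).comp
        (tendsto_pow_atTop_atTop_of_one_lt one_lt_two)
    simpa using ENNReal.tendsto_ofReal l2
  have h5 : μ {z | 2 * A < f z} = 0 := le_antisymm (ge_of_tendsto' l1 key) bot_le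
  rw [ae_iff]
  simpa only [not_le] using h5

theorem integrable_rpow_of_ae_le {α : Type*} [MeasurableSpace α] {μ : Measure α} {f : α → ℝ}
    (hf : Integrable f μ) (h0 : ∀ᵐ z ∂μ, 0 ≤ f z) {L p : ℝ} (hp : 1 ≤ p) (hL : ∀ᵐ z ∂μ, f z ≤ L) :
    Integrable (fun z => f z ^ p) μ ∧ ∫ z, f z ^ p ∂μ ≤ L ^ (p - 1) * ∫ z, f z ∂μ := by
  have hle : ∀ᵐ z ∂μ, f z ^ p ≤ L ^ (p - 1) * f z := by
    filter_upwards [h0, hL] with z hz hzL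
    rcases hz.eq_or_lt with hz0 | hz0
    · rw [← hz0, Real.zero_rpow (by linarith), mul_zero]
    · calc f z ^ p = f z ^ (p - 1) * f z := by rw [← Real.rpow_add_one hz0.ne', sub_add_cancel]
        _ ≤ _ := mul_le_mul_of_nonneg_right (Real.rpow_le_rpow hz hzL (by linarith)) hz
  have hi : Integrable (fun z => f z ^ p) μ := by
    refine (hf.const_mul (L ^ (p - 1))).mono' (hf.aemeasurable.pow_const p).aestronglyMeasurable ?_
    filter_upwards [hle, h0] with z hz hz0
    rwa [Real.norm_eq_abs, abs_of_nonneg (Real.rpow_nonneg hz0 _)]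
  refine ⟨hi, ?_⟩
  rw [← integral_const_mul]
  exact integral_mono_ae hi (hf.const_mul _) hle

namespace IsSmoothSolution

variable {D : ℝ} {T : EReal} {ρ₀ : ℝ × ℝ → ℝ} {ρ : ℝ → ℝ × ℝ → ℝ}

/-- The Moser–Alikakos iteration over the exponents `2 ^ k`. The denominator in the bound makes the
induction close: `integral_rpow_le_max` loses a factor `Q p³ = Q 8 ^ (k + 1)` in the step from
`2 ^ k` to `p = 2 ^ (k + 1)`. -/
theorem integral_rpow_two_pow_le (hD : 0 < D) (h : IsSmoothSolution D T ρ₀ ρ) {Λ Q : ℝ}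
    (hΛ : 1 ≤ Λ) (hm : ∫ z, ρ₀ z ≤ Λ) (hL : ∀ᵐ z, ρ₀ z ≤ Λ)
    (hsub : 2 * gnsConstant 2 * (∫ z, ρ₀ z) < D)
    (hQ : Q = (4 * Λ ^ 2 * gnsConstant 1 / D + 1) ^ 2 * gnsConstant 2 / (4 * D) + 1) (k : ℕ) :
    ∀ t : ℝ, 0 ≤ t → (t : EReal) < T → Integrable (fun z => ρ t z ^ ((2 : ℝ) ^ k)) ∧
      ∫ z, ρ t z ^ ((2 : ℝ) ^ k) ≤ (512 * Q * Λ) ^ (2 ^ k) / (Q * 8 ^ (k + 2)) := by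
  have Λ0 : 0 < Λ := one_pos.trans_le hΛ
  have C1 := gnsConstant_nonneg 1
  have C2 := gnsConstant_nonneg 2
  have Q1 : 1 ≤ Q := by
    rw [hQ]
    exact le_add_of_nonneg_left (by positivity)
  have Q0 : 0 < Q := one_pos.trans_le Q1
  have data : ∀ p : ℝ, 1 ≤ p → Integrable (fun z => ρ₀ z ^ p) ∧ ∫ z, ρ₀ z ^ p ≤ Λ ^ p := by
    intro p hp
    obtain ⟨h1, h2⟩ := integrable_rpow_of_ae_le h.integrable_data h.nonneg_data hp hL
    refine ⟨h1, h2.trans ?_⟩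
    have : Λ ^ p = Λ ^ (p - 1) * Λ := by rw [← Real.rpow_add_one Λ0.ne', sub_add_cancel]
    rw [this]
    exact mul_le_mul_of_nonneg_left hm (Real.rpow_nonneg Λ0.le _)
  have hΛk : ∀ k : ℕ, Λ ^ (2 ^ k) ≤ (512 * Q * Λ) ^ (2 ^ k) / (Q * 8 ^ (k + 2)) := by
    intro k
    rw [le_div_iff₀ (by positivity), mul_pow (512 * Q), mul_comm]
    refine mul_le_mul_of_nonneg_right ?_ (by positivity)
    have h1 : k + 1 ≤ 2 ^ k := Nat.lt_two_pow_self
    rw [mul_pow, mul_comm]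
    refine mul_le_mul ?_ (le_self_pow₀ Q1 (by positivity)) Q0.le (by positivity)
    calc (8 : ℝ) ^ (k + 2) ≤ 8 ^ (3 * 2 ^ k) := pow_le_pow_right₀ (by norm_num) (by omega)
      _ = 512 ^ (2 ^ k) := by rw [pow_mul]; norm_num
  have hsq : ∀ r : ℝ, 0 ≤ r → (r : EReal) < T →
      Integrable (fun z => ρ r z ^ 2) ∧ ∫ z, ρ r z ^ 2 ≤ Λ ^ 2 := by
    intro r hr hrT
    obtain ⟨h1, h2⟩ := data 2 one_le_two
    obtain ⟨N, hN⟩ := h.exists_integral_rpow_le hD one_lt_two h1 hrT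
    have h3 := h.integral_rpow_le hD one_lt_two h1 hsub le_rfl hr hrT
    rw [h.initial] at h3
    have h4 := (hN r hr le_rfl).1
    have h5 := h3.trans h2
    simp only [Real.rpow_two] at h4 h5
    exact ⟨h4, h5⟩
  induction k with
  | zero =>
    intro t ht htT
    simp only [pow_zero, Real.rpow_one]
    refine ⟨h.integrable_slice ht htT, ?_⟩
    rw [h.mass_eq hD ht htT]
    exact hm.trans (by simpa using hΛk 0)
  | succ k ih =>
    intro t ht htT
    have hp : (1 : ℝ) < 2 ^ (k + 1) := one_lt_pow₀ one_lt_two (Nat.succ_ne_zero k)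
    set p : ℝ := 2 ^ (k + 1) with hpdef
    have hp0 : 0 < p := one_pos.trans hp
    have hp2 : p / 2 = 2 ^ k := by rw [hpdef, pow_succ]; ring
    obtain ⟨N, hN⟩ := h.exists_integral_rpow_le hD hp (data p hp.le).1 htT
    refine ⟨(hN t ht le_rfl).1, ?_⟩
    refine (h.integral_rpow_le_max hD hp (data p hp.le).1 (data (p + 1) (by linarith)).1 ht htT
      (fun r hr hrt => hsq r hr.le (lt_of_le hrt htT))
      (fun r hr hrt => by rw [hp2]; exact ih r hr.le (lt_of_le hrt htT))).trans (max_le ?_ ?_)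
    · refine (data p hp.le).2.trans ?_
      rw [hpdef, rpow_two_pow]
      exact hΛk (k + 1)
    · set α := (512 * Q * Λ) ^ (2 ^ k) / (Q * 8 ^ (k + 2)) with hα
      have α0 : 0 ≤ α := by positivity
      have p8 : p ^ 3 = 8 ^ (k + 1) := by
        rw [hpdef, ← pow_mul, mul_comm, pow_mul]; norm_num
      have h1 : 4 * Λ ^ 2 * gnsConstant 1 / (D / p) + 1 ≤
          p * (4 * Λ ^ 2 * gnsConstant 1 / D + 1) := by
        have : 4 * Λ ^ 2 * gnsConstant 1 / (D / p) = p * (4 * Λ ^ 2 * gnsConstant 1 / D) := by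
          field_simp
        rw [this]
        linarith
      calc _ ≤ (p * (4 * Λ ^ 2 * gnsConstant 1 / D + 1)) ^ 2 * gnsConstant 2 * α ^ 2
            / (4 * (D / p)) := by gcongr
        _ = p ^ 3 * ((4 * Λ ^ 2 * gnsConstant 1 / D + 1) ^ 2 * gnsConstant 2 / (4 * D))
            * α ^ 2 := by field_simp
        _ ≤ p ^ 3 * Q * α ^ 2 := by
            gcongr
            linarith
        _ = _ := by
            rw [p8, hα, pow_succ 2 k, pow_mul _ (2 ^ k) 2]
            field_simp
            ring

/-- The bound is explicit in terms of `D`, the mass and the maximum of the datum. -/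
theorem ae_le (hD : 0 < D) (h : IsSmoothSolution D T ρ₀ ρ) {Λ Q : ℝ}
    (hΛ : 1 ≤ Λ) (hm : ∫ z, ρ₀ z ≤ Λ) (hL : ∀ᵐ z, ρ₀ z ≤ Λ)
    (hsub : 2 * gnsConstant 2 * (∫ z, ρ₀ z) < D)
    (hQ : Q = (4 * Λ ^ 2 * gnsConstant 1 / D + 1) ^ 2 * gnsConstant 2 / (4 * D) + 1)
    {t : ℝ} (ht : 0 ≤ t) (htT : (t : EReal) < T) : ∀ᵐ z, ρ t z ≤ 2 * (512 * Q * Λ) := by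
  have C2 := gnsConstant_nonneg 2
  have Q1 : 1 ≤ Q := by
    rw [hQ]
    exact le_add_of_nonneg_left (by positivity)
  refine ae_le_two_mul_of_integral_rpow_le (by positivity) (h.ae_nonneg hD ht htT) fun k => ?_
  obtain ⟨h1, h2⟩ := h.integral_rpow_two_pow_le hD hΛ hm hL hsub hQ k t ht htT
  refine ⟨h1, h2.trans (div_le_self (by positivity) ?_)⟩
  exact one_le_mul_of_one_le_of_one_le Q1 (one_le_pow₀ (by norm_num))

/-- The `L^p` norms do not increase, for every subcritical `p ≥ 1`. -/
theorem eLpNorm_le (hD : 0 < D) (h : IsSmoothSolution D T ρ₀ ρ) {p : ℝ} (hp : 1 ≤ p)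
    (hmem : MemLp ρ₀ (ENNReal.ofReal p)) (hsub : p * gnsConstant p * (∫ z, ρ₀ z) < D)
    {s t : ℝ} (hs : 0 ≤ s) (hst : s ≤ t) (htT : (t : EReal) < T) :
    eLpNorm (ρ t) (ENNReal.ofReal p) ≤ eLpNorm (ρ s) (ENNReal.ofReal p) := by
  have hp0 : 0 < p := one_pos.trans_le hp
  have ht := hs.trans hst
  have hsT := lt_of_le hst htT
  have hpn : ENNReal.ofReal p ≠ 0 := (ENNReal.ofReal_pos.2 hp0).ne'
  have key : ∀ r : ℝ, 0 ≤ r → (r : EReal) < T → Integrable (fun z => ρ r z ^ p) →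
      eLpNorm (ρ r) (ENNReal.ofReal p) = ENNReal.ofReal (∫ z, ρ r z ^ p) ^ (1 / p) := by
    intro r hr hrT hi
    have hae := h.ae_nonneg hD hr hrT
    rw [eLpNorm_eq_lintegral_rpow_enorm_toReal hpn ENNReal.ofReal_ne_top,
      ENNReal.toReal_ofReal hp0.le, ofReal_integral_eq_lintegral_ofReal hi (by
        filter_upwards [hae] with z hz using Real.rpow_nonneg hz p)]
    congr 1
    refine lintegral_congr_ae ?_
    filter_upwards [hae] with z hz
    rw [Real.enorm_of_nonneg hz, ENNReal.ofReal_rpow_of_nonneg hz hp0.le]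
  have hint : Integrable fun z => ρ₀ z ^ p := by
    refine (hmem.integrable_norm_rpow hpn ENNReal.ofReal_ne_top).congr ?_
    filter_upwards [h.nonneg_data] with z hz
    rw [ENNReal.toReal_ofReal hp0.le, Real.norm_of_nonneg hz]
  have hall : ∀ r, 0 ≤ r → r ≤ t → Integrable fun z => ρ r z ^ p := by
    intro r hr hrt
    rcases hp.eq_or_lt with rfl | hp1
    · simpa only [Real.rpow_one] using h.integrable_slice hr (lt_of_le hrt htT)
    · obtain ⟨N, hN⟩ := h.exists_integral_rpow_le hD hp1 hint htT
      exact (hN r hr hrt).1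
  rw [key t ht htT (hall t ht le_rfl), key s hs hsT (hall s hs hst)]
  refine ENNReal.rpow_le_rpow (ENNReal.ofReal_le_ofReal ?_) (by positivity)
  rcases hp.eq_or_lt with rfl | hp1
  · simp only [Real.rpow_one]
    rw [h.mass_eq hD ht htT, h.mass_eq hD hs hsT]
  · exact h.integral_rpow_le hD hp1 hint hsub hs hst htT

end IsSmoothSolution

theorem proposition2p1 (D : ℝ) (hD : 0 < D) :
    (∀ (T : EReal) (ρ₀ : ℝ × ℝ → ℝ) (ρ : ℝ → ℝ × ℝ → ℝ), IsSmoothSolution D T ρ₀ ρ →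
      ∀ t : ℝ, 0 ≤ t → (t : EReal) < T → ∫ z, ρ t z = ∫ z, ρ₀ z) ∧
    (∀ (T : EReal) (ρ₀ : ℝ × ℝ → ℝ) (ρ : ℝ → ℝ × ℝ → ℝ), IsSmoothSolution D T ρ₀ ρ →
      ∀ p : ℝ, 1 ≤ p → MemLp ρ₀ (ENNReal.ofReal p) → p * gnsConstant p * (∫ z, ρ₀ z) < D →
      ∀ s t : ℝ, 0 ≤ s → s ≤ t → (t : EReal) < T →
        eLpNorm (ρ t) (ENNReal.ofReal p) volume ≤ eLpNorm (ρ s) (ENNReal.ofReal p) volume) ∧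
    (∀ m L : ℝ, 2 * gnsConstant 2 * m < D → ∃ M : ℝ, 0 < M ∧
      ∀ (T : EReal) (ρ₀ : ℝ × ℝ → ℝ) (ρ : ℝ → ℝ × ℝ → ℝ), IsSmoothSolution D T ρ₀ ρ →
        ∫ z, ρ₀ z ≤ m → eLpNorm ρ₀ ⊤ volume ≤ ENNReal.ofReal L →
        ∀ t : ℝ, 0 ≤ t → (t : EReal) < T → ∀ᵐ z, 0 ≤ ρ t z ∧ ρ t z ≤ M) ∧
    (∀ (T : EReal) (ρ₀ : ℝ × ℝ → ℝ) (ρ : ℝ → ℝ × ℝ → ℝ), IsSmoothSolution D T ρ₀ ρ →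
      Integrable (fun z : ℝ × ℝ => (z.1 ^ 2 + z.2 ^ 2) * ρ₀ z) →
      ∀ t : ℝ, 0 ≤ t → (t : EReal) < T →
        Integrable (fun z : ℝ × ℝ => (z.1 ^ 2 + z.2 ^ 2) * ρ t z) ∧
        secondMoment (ρ t) ≤ secondMoment ρ₀ + 4 * D * (∫ z, ρ₀ z) * t) := by
  refine ⟨fun T ρ₀ ρ h t ht htT => h.mass_eq hD ht htT,
    fun T ρ₀ ρ h p hp hmem hsub s t hs hst htT => h.eLpNorm_le hD hp hmem hsub hs hst htT,
    fun m L hm => ?_, fun T ρ₀ ρ h hint t ht htT => h.secondMoment_le hD hint ht htT⟩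
  set Λ := max (max m L) 1 with hΛ
  have hΛ1 : 1 ≤ Λ := le_max_right _ _
  set Q := (4 * Λ ^ 2 * gnsConstant 1 / D + 1) ^ 2 * gnsConstant 2 / (4 * D) + 1 with hQ
  have C2 := gnsConstant_nonneg 2
  have hQ0 : 0 < Q := by positivity
  refine ⟨2 * (512 * Q * Λ), by positivity, fun T ρ₀ ρ h hm' hL t ht htT => ?_⟩
  have hL0 : ∀ᵐ z, ρ₀ z ≤ Λ := by
    rw [eLpNorm_exponent_top] at hL
    filter_upwards [ae_le_eLpNormEssSup (f := ρ₀) (μ := volume), h.nonneg_data] with z hz hz0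
    have h1 := hz.trans hL
    rw [Real.enorm_of_nonneg hz0] at h1
    -- If `L < 0` then `ENNReal.ofReal L = 0`, so the bound has to be compared with `Λ ≥ 0`.
    exact (ENNReal.ofReal_le_ofReal_iff (zero_le_one.trans hΛ1)).1
      (h1.trans (ENNReal.ofReal_le_ofReal ((le_max_right _ _).trans (le_max_left _ _))))
  have hsub : 2 * gnsConstant 2 * (∫ z, ρ₀ z) < D :=
    (mul_le_mul_of_nonneg_left hm' (by positivity)).trans_lt hm
  filter_upwards [h.ae_nonneg hD ht htT,
    h.ae_le hD hΛ1 (hm'.trans ((le_max_left _ _).trans (le_max_left _ _))) hL0 hsub hQ ht htT]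
    with z h0 h1 using ⟨h0, h1⟩
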